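/- Let $\pi : P \to M$ be a smooth principal $G$-bundle, where $M$, $G$, $P$ are smooth, second countable, Hausdorff manifolds of finite and nonzero dimension, and the structure group $G$ is a semisimple Lie group (its Lie algebra $\mathfrak g \neq 0$ has zero radical). Let $A = TP/G$ be the Atiyah algebroid of $P$, with anchor $A \to TM$, $[X_u] \mapsto T_u\pi(X_u)$, and kernel bundle $K = P\times_G \mathfrak g$. Let $\mathcal A = \Gamma(A)$ be the Lie algebra of smooth sections of $A$, identified with the Lie algebra of smooth $G$-invariant vector fields on $P$ with the bracket of vector fields. For $a\in\mathcal A$ denote by $a_m \in A_m$ its value at $m\in M$ and by $\hat a$ its anchor, and put $$\mathcal K = \Gamma(K)=\{a\in\mathcal A : \hat a = 0\},\quad \mathcal A(m) = \{a\in\mathcal A : a_m = 0\},\quad \mathcal K(m) = \{k\in\mathcal K : k_m = 0\},\quad \mathcal A_m = \{a\in\mathcal A : \hat a_m = 0\}.$$ A maximal finite-codimensional Lie subalgebra (respectively Lie ideal) is a maximal element of the set of all proper Lie subalgebras (respectively Lie ideals) of finite codimension. For a Lie subalgebra $T\subset\mathcal A$ let $\mathcal K^{T}$ be the intersection of all maximal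 finite-codimensional Lie ideals $J$ of $\mathcal K$ that are normalized by $T$, i.e. $[T,J]\subset J$. Then: 1. A Lie subalgebra $\mathcal A_0\subset\mathcal A$ is of the form $\mathcal A(m)$ for some $m\in M$ if and only if it is maximal in the class of all Lie subalgebras $S\subset\mathcal A$ such that $[S,\mathcal K]\subset\mathcal K(m)$ for some $m\in M$. 2. A Lie subalgebra $\mathcal A_0\subset\mathcal A$ is of the form $\mathcal A(m)$ for some $m\in M$ if and only if it is maximal in the class of all Lie subalgebras $S\subset\mathcal A$ such that $[S,\mathcal K]\subset\mathcal K^{T}$ for some maximal finite-codimensional Lie subalgebra $T$ of $\mathcal A$. 3. The subalgebra $T$ that corresponds to $\mathcal A(m)$ in 2 is $\mathcal A_m$: for every $m\in M$, $\mathcal A_m$ is a maximal finite-codimensional Lie subalgebra of $\mathcal A$, $\mathcal A(m)$ is maximal among the Lie subalgebras $S\subset\mathcal A$ with $[S,\mathcal K]\subset\mathcal K^{\mathcal A_m}$, and $\mathcal A_m$ is the only maximal finite-codimensional Lie subalgebra $T$ of $\mathcal A$ with $[\mathcal A(m),\mathcal K]\subset\mathcal K^{T}$. -/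

import Mathlib

open scoped Manifold ContDiff Bundle
open VectorField
noncomputable section

instance instLEInftyMinSmoothness : ENat.LEInfty (minSmoothness ℝ 3) :=
  ⟨by rw [minSmoothness_of_isRCLikeNormedField]; exact ENat.LEInfty.out⟩

/-- The smooth vector fields on a manifold `P` modelled on `E`. -/
abbrev SmoothVectorField (E P : Type*) [NormedAddCommGroup E] [NormedSpace ℝ E]
    [TopologicalSpace P] [ChartedSpace E P] [IsManifold 𝓘(ℝ, E) ∞ P] : Type _ :=
  ContMDiffSection 𝓘(ℝ, E) E ∞ (TangentSpace 𝓘(ℝ, E) : P → Type _)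

namespace SmoothVectorField
variable {E P : Type*} [NormedAddCommGroup E] [NormedSpace ℝ E]
    [TopologicalSpace P] [ChartedSpace E P] [IsManifold 𝓘(ℝ, E) ∞ P]


theorem mdifferentiableAt (X : SmoothVectorField E P) (u : P) :
    MDifferentiableAt 𝓘(ℝ, E) (𝓘(ℝ, E).prod 𝓘(ℝ, E))
      (fun x => (X x : TangentBundle 𝓘(ℝ, E) P)) u :=
  (X.contMDiff u).mdifferentiableAt (by simp)

theorem contMDiffAt_mvfderiv_apply {φ : P → ℝ} {u : P} (hφ : ContMDiffAt 𝓘(ℝ, E) 𝓘(ℝ, ℝ) ∞ φ u)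
    (X : SmoothVectorField E P) :
    ContMDiffAt 𝓘(ℝ, E) 𝓘(ℝ, ℝ) ∞ (fun y => mvfderiv 𝓘(ℝ, E) φ y (X y)) u := by
  have A := hφ.mfderiv_const (m := ∞) (by simp)
  have B := ContMDiffAt.clm_apply_of_inCoordinates (n := ∞) (E₁ := TangentSpace 𝓘(ℝ, E))
    (E₂ := TangentSpace 𝓘(ℝ, ℝ)) (ϕ := fun y => mfderiv 𝓘(ℝ, E) 𝓘(ℝ, ℝ) φ y) (v := fun y => X y) (b₁ := id) (b₂ := φ) A (X.contMDiff u) hφ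
  rw [Bundle.contMDiffAt_totalSpace] at B
  simpa using! B.2

variable [CompleteSpace E]

/-- The Lie bracket of smooth vector fields. -/
instance : Bracket (SmoothVectorField E P) (SmoothVectorField E P) where
  bracket X Y := ⟨mlieBracket 𝓘(ℝ, E) X Y, by
    have : IsManifold 𝓘(ℝ, E) ((⊤ : ℕ∞) + 1) P := by simpa using (inferInstance : IsManifold 𝓘(ℝ, E) ∞ P)
    exact ContDiff.mlieBracket_vectorField (n := ⊤) (m := ⊤) X.contMDiff Y.contMDiff (by simp)⟩

theorem bracket_apply (X Y : SmoothVectorField E P) (u : P) :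
    ⁅X, Y⁆ u = mlieBracket 𝓘(ℝ, E) X Y u := rfl

theorem coe_bracket (X Y : SmoothVectorField E P) :
    ⇑⁅X, Y⁆ = mlieBracket 𝓘(ℝ, E) X Y := rfl

instance : LieRing (SmoothVectorField E P) where
  add_lie X Y Z := by
    ext u
    simp only [bracket_apply, ContMDiffSection.coe_add, Pi.add_apply]
    exact mlieBracket_add_left (X.mdifferentiableAt u) (Y.mdifferentiableAt u)
  lie_add X Y Z := by
    ext u
    simp only [bracket_apply, ContMDiffSection.coe_add, Pi.add_apply]
    exact mlieBracket_add_right (Y.mdifferentiableAt u) (Z.mdifferentiableAt u)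
  lie_self X := by
    ext u
    simp [bracket_apply]
  leibniz_lie X Y Z := by
    ext u
    simp only [bracket_apply, coe_bracket, ContMDiffSection.coe_add, Pi.add_apply]
    have h : minSmoothness ℝ 2 ≤ ∞ := by
      rw [minSmoothness_of_isRCLikeNormedField]; exact ENat.LEInfty.out
    exact leibniz_identity_mlieBracket_apply ((X.contMDiff u).of_le h) ((Y.contMDiff u).of_le h)
      ((Z.contMDiff u).of_le h)

instance : LieAlgebra ℝ (SmoothVectorField E P) where
  lie_smul c X Y := by
    ext u
    simp only [bracket_apply, ContMDiffSection.coe_smul, Pi.smul_apply]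
    exact mlieBracket_const_smul_right (Y.mdifferentiableAt u)


/-- `[X, Y] φ = X (Y φ) - Y (X φ)`. -/
theorem mvfderiv_bracket {φ : P → ℝ} {u : P} (hφ : ContMDiffAt 𝓘(ℝ, E) 𝓘(ℝ, ℝ) ∞ φ u)
    (X Y : SmoothVectorField E P) :
    mvfderiv 𝓘(ℝ, E) φ u (⁅X, Y⁆ u) =
      mvfderiv 𝓘(ℝ, E) (fun y => mvfderiv 𝓘(ℝ, E) φ y (Y y)) u (X u) -
      mvfderiv 𝓘(ℝ, E) (fun y => mvfderiv 𝓘(ℝ, E) φ y (X y)) u (Y u) := by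
  rcases subsingleton_or_nontrivial E with hE | hE
  · have h (v : TangentSpace 𝓘(ℝ, E) u) : v = 0 := Subsingleton.elim (α := E) _ _
    rw [h (⁅X, Y⁆ u), h (X u), h (Y u)]; simp
  obtain ⟨z, hz⟩ := exists_ne (0 : E)
  let Z : ∀ y : P, TangentSpace 𝓘(ℝ, E) y :=
    FiberBundle.extend E (E := (TangentSpace 𝓘(ℝ, E) : P → Type _)) (x := u) z
  have hZ : ContMDiffAt 𝓘(ℝ, E) (𝓘(ℝ, E).prod 𝓘(ℝ, E)) ∞
      (fun y => (Z y : TangentBundle 𝓘(ℝ, E) P)) u :=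
    FiberBundle.contMDiffAt_extend 𝓘(ℝ, E) E (V := (TangentSpace 𝓘(ℝ, E) : P → Type _)) (x := u) z
  have hZu : Z u ≠ 0 := by
    have : Z u = z := FiberBundle.extend_apply_self E _
    rw [this]; exact hz
  have e1 : ∀ᶠ y in nhds u, ContMDiffAt 𝓘(ℝ, E) 𝓘(ℝ, ℝ) 1 φ y :=
    (contMDiffAt_iff_contMDiffAt_nhds (by simp)).1 (hφ.of_le (by simp))
  have e2 : ∀ᶠ y in nhds u, ContMDiffAt 𝓘(ℝ, E) (𝓘(ℝ, E).prod 𝓘(ℝ, E)) 1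
      (fun y => (Z y : TangentBundle 𝓘(ℝ, E) P)) y :=
    (contMDiffAt_iff_contMDiffAt_nhds (by simp)).1 (hZ.of_le (by simp))
  have : IsManifold 𝓘(ℝ, E) ((⊤ : ℕ∞) + 1) P := by
    simpa using (inferInstance : IsManifold 𝓘(ℝ, E) ∞ P)
  have hB (W : SmoothVectorField E P) : MDifferentiableAt 𝓘(ℝ, E) (𝓘(ℝ, E).prod 𝓘(ℝ, E))
      (fun y => (mlieBracket 𝓘(ℝ, E) W Z y : TangentBundle 𝓘(ℝ, E) P)) u :=
    (ContMDiffAt.mlieBracket_vectorField (n := ⊤) (m := ⊤) (W.contMDiff u) hZ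
      (by simp)).mdifferentiableAt (by simp)
  have hφ1 : MDifferentiableAt 𝓘(ℝ, E) 𝓘(ℝ, ℝ) φ u := hφ.mdifferentiableAt (by simp)
  have hZ1 := hZ.mdifferentiableAt (by simp : ∞ ≠ 0)
  have key (V W : SmoothVectorField E P) :
      mlieBracket 𝓘(ℝ, E) V (mlieBracket 𝓘(ℝ, E) W (φ • Z)) u =
        mvfderiv 𝓘(ℝ, E) (fun y => mvfderiv 𝓘(ℝ, E) φ y (W y)) u (V u) • Z u
        + mvfderiv 𝓘(ℝ, E) φ u (W u) • mlieBracket 𝓘(ℝ, E) V Z u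
        + (mvfderiv 𝓘(ℝ, E) φ u (V u) • mlieBracket 𝓘(ℝ, E) W Z u
        + φ u • mlieBracket 𝓘(ℝ, E) V (mlieBracket 𝓘(ℝ, E) W Z) u) := by
    have e : mlieBracket 𝓘(ℝ, E) W (φ • Z) =ᶠ[nhds u]
        ((fun y => mvfderiv 𝓘(ℝ, E) φ y (W y)) • Z + φ • mlieBracket 𝓘(ℝ, E) W Z) := by
      filter_upwards [e1, e2] with y h1 h2
      exact mlieBracket_smul_right (h1.mdifferentiableAt (by simp))
        (h2.mdifferentiableAt (by simp))
    have hd := contMDiffAt_mvfderiv_apply hφ W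
    have e' := Filter.EventuallyEq.mlieBracket_vectorField_eq
      (Filter.EventuallyEq.refl (nhds u) (V : ∀ y : P, TangentSpace 𝓘(ℝ, E) y)) e
    refine e'.trans ?_
    rw [mlieBracket_add_right, mlieBracket_smul_right, mlieBracket_smul_right]
    · exact hφ1
    · exact hB W
    · exact hd.mdifferentiableAt (by simp)
    · exact hZ1
    · exact (hd.smul_section hZ).mdifferentiableAt (by simp)
    · exact MDifferentiableAt.smul_section hφ1 (hB W)
  have h2 : minSmoothness ℝ 2 ≤ ∞ := by
    rw [minSmoothness_of_isRCLikeNormedField]; exact ENat.LEInfty.out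
  have J := leibniz_identity_mlieBracket_apply ((X.contMDiff u).of_le h2)
    ((Y.contMDiff u).of_le h2) (((hφ.smul_section hZ)).of_le h2)
  have J' := leibniz_identity_mlieBracket_apply ((X.contMDiff u).of_le h2)
    ((Y.contMDiff u).of_le h2) (hZ.of_le h2)
  rw [key, key, mlieBracket_smul_right hφ1 hZ1, J'] at J
  rw [bracket_apply]
  rw [eq_sub_iff_add_eq]
  have J2 : (mvfderiv 𝓘(ℝ, E) φ u (mlieBracket 𝓘(ℝ, E) X Y u) +
      mvfderiv 𝓘(ℝ, E) (fun y => mvfderiv 𝓘(ℝ, E) φ y (X y)) u (Y u)) • Z u =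
      mvfderiv 𝓘(ℝ, E) (fun y => mvfderiv 𝓘(ℝ, E) φ y (Y y)) u (X u) • Z u := by
    rw [add_smul]
    rw [smul_add] at J
    generalize mlieBracket 𝓘(ℝ, E) (⇑X) Z u = a1 at J
    generalize mlieBracket 𝓘(ℝ, E) (⇑Y) Z u = a2 at J
    linear_combination (norm := module) (-1 : ℝ) • J
  exact smul_left_injective ℝ hZu J2

end SmoothVectorField

/-- A smooth principal `G`-bundle `proj : P → M`, with right action `act u g = u.g`: the action
preserves the fibres of `proj`, and around every point of `M` there is an equivariant
diffeomorphism `proj ⁻¹ U ≃ U × G` over an open set `U`. -/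
structure SmoothPrincipalBundle (EM EG EP M G P : Type*)
    [NormedAddCommGroup EM] [NormedSpace ℝ EM] [NormedAddCommGroup EG] [NormedSpace ℝ EG]
    [NormedAddCommGroup EP] [NormedSpace ℝ EP]
    [TopologicalSpace M] [ChartedSpace EM M]
    [TopologicalSpace G] [ChartedSpace EG G] [Group G]
    [TopologicalSpace P] [ChartedSpace EP P] where
  proj : P → M
  act : P → G → P
  act_one : ∀ u, act u 1 = u
  act_mul : ∀ u g h, act u (g * h) = act (act u g) h
  proj_act : ∀ u g, proj (act u g) = proj u
  contMDiff_proj : ContMDiff 𝓘(ℝ, EP) 𝓘(ℝ, EM) ∞ proj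
  contMDiff_act : ContMDiff (𝓘(ℝ, EP).prod 𝓘(ℝ, EG)) 𝓘(ℝ, EP) ∞ (fun p : P × G => act p.1 p.2)
  exists_trivialization : ∀ m : M, ∃ (U : Set M) (e : OpenPartialHomeomorph P (M × G)),
    IsOpen U ∧ m ∈ U ∧ e.source = proj ⁻¹' U ∧ e.target = U ×ˢ Set.univ ∧
    ContMDiffOn 𝓘(ℝ, EP) (𝓘(ℝ, EM).prod 𝓘(ℝ, EG)) ∞ e e.source ∧
    ContMDiffOn (𝓘(ℝ, EM).prod 𝓘(ℝ, EG)) 𝓘(ℝ, EP) ∞ e.symm e.target ∧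
    (∀ u ∈ e.source, (e u).1 = proj u) ∧
    ∀ u ∈ e.source, ∀ g, e (act u g) = (proj u, (e u).2 * g)

namespace SmoothPrincipalBundle


variable {EM EG EP M G P : Type*}
    [NormedAddCommGroup EM] [NormedSpace ℝ EM] [NormedAddCommGroup EG] [NormedSpace ℝ EG]
    [NormedAddCommGroup EP] [NormedSpace ℝ EP]
    [TopologicalSpace M] [ChartedSpace EM M] [IsManifold 𝓘(ℝ, EM) ∞ M]
    [TopologicalSpace G] [ChartedSpace EG G] [Group G]
    [TopologicalSpace P] [ChartedSpace EP P] [IsManifold 𝓘(ℝ, EP) ∞ P]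
    (B : SmoothPrincipalBundle EM EG EP M G P)

/-- The right translation `r_g : u ↦ u.g`. -/
def rightTranslation (g : G) (u : P) : P := B.act u g

theorem contMDiff_rightTranslation (g : G) :
    ContMDiff 𝓘(ℝ, EP) 𝓘(ℝ, EP) ∞ (B.rightTranslation g) :=
  B.contMDiff_act.comp (contMDiff_id.prodMk contMDiff_const)

theorem mdifferentiableAt_rightTranslation (g : G) (u : P) :
    MDifferentiableAt 𝓘(ℝ, EP) 𝓘(ℝ, EP) (B.rightTranslation g) u :=
  (B.contMDiff_rightTranslation g u).mdifferentiableAt (by simp)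

theorem rightTranslation_comp_inv (g : G) :
    B.rightTranslation g ∘ B.rightTranslation g⁻¹ = id := by
  ext u; simp [rightTranslation, ← B.act_mul, B.act_one]

theorem rightTranslation_inv_comp (g : G) :
    B.rightTranslation g⁻¹ ∘ B.rightTranslation g = id := by
  ext u; simp [rightTranslation, ← B.act_mul, B.act_one]

/-- The vector field `X` on `P` is `G`-invariant: `T_u r_g (X_u) = X_{u.g}`. -/
def IsInvariant (X : SmoothVectorField EP P) : Prop :=
  ∀ (g : G) (u : P),
    mfderiv 𝓘(ℝ, EP) 𝓘(ℝ, EP) (B.rightTranslation g) u (X u) = X (B.rightTranslation g u)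

theorem isInvertible_mfderiv_rightTranslation (g : G) (u : P) :
    (mfderiv 𝓘(ℝ, EP) 𝓘(ℝ, EP) (B.rightTranslation g) u).IsInvertible := by
  let Φ : Diffeomorph 𝓘(ℝ, EP) 𝓘(ℝ, EP) P P ∞ :=
    { toFun := B.rightTranslation g
      invFun := B.rightTranslation g⁻¹
      left_inv := congrFun (B.rightTranslation_inv_comp g)
      right_inv := congrFun (B.rightTranslation_comp_inv g)
      contMDiff_toFun := B.contMDiff_rightTranslation g
      contMDiff_invFun := B.contMDiff_rightTranslation g⁻¹ }
  exact ⟨Φ.mfderivToContinuousLinearEquiv (by simp) u, rfl⟩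

theorem mpullback_eq_of_isInvariant {X : SmoothVectorField EP P} (hX : B.IsInvariant X) (g : G) :
    mpullback 𝓘(ℝ, EP) 𝓘(ℝ, EP) (B.rightTranslation g) X = X := by
  ext u
  rw [mpullback_apply, ← hX g u]
  exact (B.isInvertible_mfderiv_rightTranslation g u).inverse_apply_self _

theorem mdifferentiableAt_proj (u : P) : MDifferentiableAt 𝓘(ℝ, EP) 𝓘(ℝ, EM) B.proj u :=
  (B.contMDiff_proj u).mdifferentiableAt (by simp)

/-- The derivative of a function `ψ ∘ proj` along an invariant vector field is constant along
the fibres. -/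
theorem mvfderiv_comp_proj_act {X : SmoothVectorField EP P} (hX : B.IsInvariant X) {ψ : M → ℝ}
    (w : P) (g : G) (hψ : MDifferentiableAt 𝓘(ℝ, EM) 𝓘(ℝ, ℝ) ψ (B.proj w)) :
    mvfderiv 𝓘(ℝ, EP) (ψ ∘ B.proj) (B.act w g) (X (B.act w g)) =
      mvfderiv 𝓘(ℝ, EP) (ψ ∘ B.proj) w (X w) := by
  have hc : (ψ ∘ B.proj) ∘ B.rightTranslation g = ψ ∘ B.proj := by
    ext y; simp [rightTranslation, B.proj_act]
  have hd : MDifferentiableAt 𝓘(ℝ, EP) 𝓘(ℝ, ℝ) (ψ ∘ B.proj) (B.rightTranslation g w) := by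
    refine MDifferentiableAt.comp _ ?_ (B.mdifferentiableAt_proj _)
    rwa [show B.proj (B.rightTranslation g w) = B.proj w from B.proj_act w g]
  have h := mvfderiv_comp w hd (B.mdifferentiableAt_rightTranslation g w)
  rw [hc] at h
  rw [h, ContinuousLinearMap.comp_apply, hX g w]
  rfl

/-- For `X` invariant, the derivative of `X (ψ ∘ proj)` along a vertical vector vanishes. -/
theorem mvfderiv_mvfderiv_comp_proj {X : SmoothVectorField EP P} (hX : B.IsInvariant X)
    {ψ : M → ℝ} (u : P) (hψ : ContMDiffAt 𝓘(ℝ, EM) 𝓘(ℝ, ℝ) ∞ ψ (B.proj u))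
    (v : TangentSpace 𝓘(ℝ, EP) u) (hv : mfderiv 𝓘(ℝ, EP) 𝓘(ℝ, EM) B.proj u v = 0) :
    mvfderiv 𝓘(ℝ, EP) (fun y => mvfderiv 𝓘(ℝ, EP) (ψ ∘ B.proj) y (X y)) u v = 0 := by
  obtain ⟨U, e, hU, hmU, hs, ht, -, hes, he1, he2⟩ := B.exists_trivialization (B.proj u)
  let h : P → ℝ := fun y => mvfderiv 𝓘(ℝ, EP) (ψ ∘ B.proj) y (X y)
  let σ : M → P := fun x => e.symm (x, (e u).2)
  have hus : u ∈ e.source := by rw [hs]; exact hmU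
  have hσu : σ (B.proj u) = u := by
    have : (B.proj u, (e u).2) = e u := Prod.ext (he1 u hus).symm rfl
    simp only [σ, this]
    exact e.left_inv hus
  have hh : MDifferentiableAt 𝓘(ℝ, EP) 𝓘(ℝ, ℝ) h u :=
    (SmoothVectorField.contMDiffAt_mvfderiv_apply
      (ContMDiffAt.comp u hψ (B.contMDiff_proj u)) X).mdifferentiableAt (by simp)
  have hσ : MDifferentiableAt 𝓘(ℝ, EM) 𝓘(ℝ, EP) σ (B.proj u) := by
    have hmem : (B.proj u, (e u).2) ∈ e.target := by rw [ht]; exact ⟨hmU, trivial⟩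
    have h1 := hes.contMDiffAt (e.open_target.mem_nhds hmem)
    have h2 : ContMDiffAt 𝓘(ℝ, EM) (𝓘(ℝ, EM).prod 𝓘(ℝ, EG)) ∞
        (fun x : M => (x, (e u).2)) (B.proj u) := contMDiffAt_id.prodMk contMDiffAt_const
    exact (ContMDiffAt.comp (B.proj u) h1 h2).mdifferentiableAt (by simp)
  have hψn : ∀ᶠ y in nhds u, MDifferentiableAt 𝓘(ℝ, EM) 𝓘(ℝ, ℝ) ψ (B.proj y) := by
    have h1 : ∀ᶠ x in nhds (B.proj u), ContMDiffAt 𝓘(ℝ, EM) 𝓘(ℝ, ℝ) 1 ψ x :=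
      (contMDiffAt_iff_contMDiffAt_nhds (by simp)).1 (hψ.of_le (by simp))
    filter_upwards [B.contMDiff_proj.continuous.continuousAt.eventually h1] with y hy
    exact hy.mdifferentiableAt (by simp)
  have heq : h =ᶠ[nhds u] (h ∘ σ) ∘ B.proj := by
    filter_upwards [hψn, e.open_source.mem_nhds hus] with y hy hys
    have hyU : B.proj y ∈ U := by rw [hs] at hys; exact hys
    have hmem : (B.proj y, (e u).2) ∈ e.target := by rw [ht]; exact ⟨hyU, trivial⟩
    have hws : σ (B.proj y) ∈ e.source := e.map_target hmem
    have hew : e (σ (B.proj y)) = (B.proj y, (e u).2) := e.right_inv hmem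
    have hpw : B.proj (σ (B.proj y)) = B.proj y := by rw [← he1 _ hws, hew]
    have hact : B.act (σ (B.proj y)) ((e u).2⁻¹ * (e y).2) = y := by
      refine e.injOn ?_ hys ?_
      · rw [hs, Set.mem_preimage, B.proj_act, hpw]; exact hyU
      · rw [he2 _ hws, hew, hpw]
        exact Prod.ext (he1 y hys).symm (by simp)
    have := B.mvfderiv_comp_proj_act hX (ψ := ψ) (σ (B.proj y)) ((e u).2⁻¹ * (e y).2)
      (by rw [hpw]; exact hy)
    rw [hact] at this
    exact this
  have hd : mfderiv 𝓘(ℝ, EP) 𝓘(ℝ, ℝ) h u = mfderiv 𝓘(ℝ, EP) 𝓘(ℝ, ℝ) ((h ∘ σ) ∘ B.proj) u :=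
    heq.mfderiv_eq
  have hhσ : MDifferentiableAt 𝓘(ℝ, EM) 𝓘(ℝ, ℝ) (h ∘ σ) (B.proj u) :=
    MDifferentiableAt.comp _ (by rw [hσu]; exact hh) hσ
  have hc := mfderiv_comp (I := 𝓘(ℝ, EP)) (I' := 𝓘(ℝ, EM)) (I'' := 𝓘(ℝ, ℝ)) u hhσ
    (B.mdifferentiableAt_proj u)
  have : mfderiv 𝓘(ℝ, EP) 𝓘(ℝ, ℝ) h u v = 0 := by
    have h5 : mfderiv 𝓘(ℝ, EM) 𝓘(ℝ, ℝ) (h ∘ σ) (B.proj u)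
        (mfderiv 𝓘(ℝ, EP) 𝓘(ℝ, EM) B.proj u v) = 0 := by rw [hv, map_zero]
    exact (congrArg (fun L : EP →L[ℝ] ℝ => L v) (hd.trans hc)).trans h5
  exact this

/-- A tangent vector of `P` is vertical as soon as it kills all functions `ψ ∘ proj`. -/
theorem mfderiv_proj_eq_zero (u : P) (v : TangentSpace 𝓘(ℝ, EP) u)
    (h : ∀ ψ : M → ℝ, ContMDiffAt 𝓘(ℝ, EM) 𝓘(ℝ, ℝ) ∞ ψ (B.proj u) →
      mvfderiv 𝓘(ℝ, EP) (ψ ∘ B.proj) u v = 0) :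
    mfderiv 𝓘(ℝ, EP) 𝓘(ℝ, EM) B.proj u v = 0 := by
  have hchart : ContMDiffAt 𝓘(ℝ, EM) 𝓘(ℝ, EM) ∞ (extChartAt 𝓘(ℝ, EM) (B.proj u)) (B.proj u) :=
    contMDiffAt_extChartAt
  have hinv := isInvertible_mfderiv_extChartAt (I := 𝓘(ℝ, EM))
    (mem_extChartAt_source (I := 𝓘(ℝ, EM)) (B.proj u))
  apply hinv.injective
  rw [map_zero]
  refine SeparatingDual.eq_zero_of_forall_dual_eq_zero (R := ℝ) (V := EM) fun ℓ => ?_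
  have hψ : ContMDiffAt 𝓘(ℝ, EM) 𝓘(ℝ, ℝ) ∞ (ℓ ∘ extChartAt 𝓘(ℝ, EM) (B.proj u)) (B.proj u) :=
    ContMDiffAt.comp _ ℓ.contMDiff.contMDiffAt hchart
  have h1 := h _ hψ
  have h2 := mfderiv_comp (I := 𝓘(ℝ, EP)) (I' := 𝓘(ℝ, EM)) (I'' := 𝓘(ℝ, ℝ)) u
    (hψ.mdifferentiableAt (by simp)) (B.mdifferentiableAt_proj u)
  have h3 := mfderiv_comp (I := 𝓘(ℝ, EM)) (I' := 𝓘(ℝ, EM)) (I'' := 𝓘(ℝ, ℝ)) (B.proj u)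
    (ℓ.contMDiff.contMDiffAt.mdifferentiableAt (by simp : (∞ : WithTop ℕ∞) ≠ 0))
    (hchart.mdifferentiableAt (by simp))
  have h4 : mfderiv 𝓘(ℝ, EP) 𝓘(ℝ, ℝ) ((ℓ ∘ extChartAt 𝓘(ℝ, EM) (B.proj u)) ∘ B.proj) u v = 0 := h1
  rw [h2, h3] at h4
  simp only [mfderiv_eq_fderiv, ContinuousLinearMap.fderiv] at h4
  exact h4

variable [CompleteSpace EP]

theorem isInvariant_bracket {X Y : SmoothVectorField EP P} (hX : B.IsInvariant X)
    (hY : B.IsInvariant Y) : B.IsInvariant ⁅X, Y⁆ := by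
  intro g u
  have h := mpullback_mlieBracket (I := 𝓘(ℝ, EP)) (I' := 𝓘(ℝ, EP)) (n := ∞) (x₀ := u)
    (X.mdifferentiableAt (B.rightTranslation g u)) (Y.mdifferentiableAt (B.rightTranslation g u))
    (B.contMDiff_rightTranslation g u) (by
      rw [minSmoothness_of_isRCLikeNormedField]; exact ENat.LEInfty.out)
  rw [B.mpullback_eq_of_isInvariant hX, B.mpullback_eq_of_isInvariant hY, mpullback_apply] at h
  rw [SmoothVectorField.bracket_apply, SmoothVectorField.bracket_apply, ← h]
  exact (B.isInvertible_mfderiv_rightTranslation g u).self_apply_inverse _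

/-- The Lie algebra `𝒜` of smooth sections of the Atiyah algebroid `A = TP/G`, i.e. of smooth
`G`-invariant vector fields on `P`, with the bracket of vector fields. -/
def atiyahAlgebra : LieSubalgebra ℝ (SmoothVectorField EP P) where
  carrier := {X | B.IsInvariant X}
  zero_mem' := fun g u => by simp
  add_mem' := fun {X Y} hX hY g u => by
    simp only [ContMDiffSection.coe_add, Pi.add_apply]
    rw [← hX g u, ← hY g u]; exact map_add _ _ _
  smul_mem' := fun c X hX g u => by
    simp only [ContMDiffSection.coe_smul, Pi.smul_apply]
    rw [← hX g u]; exact map_smul _ _ _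
  lie_mem' := fun hX hY => B.isInvariant_bracket hX hY

/-- The bracket of two invariant vector fields that are vertical at `u` is vertical at `u`. -/
theorem mfderiv_proj_bracket {X Y : SmoothVectorField EP P} (hX : B.IsInvariant X)
    (hY : B.IsInvariant Y) (u : P) (hXu : mfderiv 𝓘(ℝ, EP) 𝓘(ℝ, EM) B.proj u (X u) = 0)
    (hYu : mfderiv 𝓘(ℝ, EP) 𝓘(ℝ, EM) B.proj u (Y u) = 0) :
    mfderiv 𝓘(ℝ, EP) 𝓘(ℝ, EM) B.proj u (⁅X, Y⁆ u) = 0 := by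
  refine B.mfderiv_proj_eq_zero u _ fun ψ hψ => ?_
  rw [SmoothVectorField.mvfderiv_bracket (ContMDiffAt.comp u hψ (B.contMDiff_proj u)),
    B.mvfderiv_mvfderiv_comp_proj hY u hψ _ hXu, B.mvfderiv_mvfderiv_comp_proj hX u hψ _ hYu,
    sub_zero]

/-- The bracket of an invariant vector field with a vertical one is vertical. -/
theorem mfderiv_proj_bracket_of_vertical {X Y : SmoothVectorField EP P} (hX : B.IsInvariant X)
    (hY : ∀ u, mfderiv 𝓘(ℝ, EP) 𝓘(ℝ, EM) B.proj u (Y u) = 0) (u : P) :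
    mfderiv 𝓘(ℝ, EP) 𝓘(ℝ, EM) B.proj u (⁅X, Y⁆ u) = 0 := by
  refine B.mfderiv_proj_eq_zero u _ fun ψ hψ => ?_
  have h0 : (fun y => mvfderiv 𝓘(ℝ, EP) (ψ ∘ B.proj) y (Y y)) =ᶠ[nhds u] fun _ => (0 : ℝ) := by
    have h1 : ∀ᶠ x in nhds (B.proj u), ContMDiffAt 𝓘(ℝ, EM) 𝓘(ℝ, ℝ) 1 ψ x :=
      (contMDiffAt_iff_contMDiffAt_nhds (by simp)).1 (hψ.of_le (by simp))
    filter_upwards [B.contMDiff_proj.continuous.continuousAt.eventually h1] with y hy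
    rw [mvfderiv_comp y (hy.mdifferentiableAt (by simp)) (B.mdifferentiableAt_proj y),
      ContinuousLinearMap.comp_apply, hY y, map_zero]
  have h2 : mvfderiv 𝓘(ℝ, EP) (fun y => mvfderiv 𝓘(ℝ, EP) (ψ ∘ B.proj) y (Y y)) u (X u) = 0 := by
    have : mfderiv 𝓘(ℝ, EP) 𝓘(ℝ, ℝ) (fun y => mvfderiv 𝓘(ℝ, EP) (ψ ∘ B.proj) y (Y y)) u (X u)
        = 0 := by
      rw [h0.mfderiv_eq, mfderiv_const]; rfl
    exact this
  rw [SmoothVectorField.mvfderiv_bracket (ContMDiffAt.comp u hψ (B.contMDiff_proj u)),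
    B.mvfderiv_mvfderiv_comp_proj hX u hψ _ (hY u), sub_zero]
  exact h2

/-- The fibre `A_m` of the Atiyah algebroid `A = TP/G`: an equivalence class of tangent vectors
under `X_u ∼ T_u r_g (X_u)`, `proj u = m`, contains exactly one vector at each point of
`proj ⁻¹ m`, so that it is an equivariant family of vectors along `proj ⁻¹ m`. -/
def fiber (m : M) : Submodule ℝ (∀ u : {u : P // B.proj u = m}, TangentSpace 𝓘(ℝ, EP) u.1) where
  carrier := {X | ∀ (g : G) (u : {u : P // B.proj u = m}),
    mfderiv 𝓘(ℝ, EP) 𝓘(ℝ, EP) (B.rightTranslation g) u.1 (X u) =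
      X ⟨B.rightTranslation g u.1, (B.proj_act u.1 g).trans u.2⟩}
  zero_mem' := fun g u => by simp
  add_mem' := fun {X Y} hX hY g u => by
    simp only [Pi.add_apply]
    rw [← hX g u, ← hY g u]; exact map_add _ _ _
  smul_mem' := fun c X hX g u => by
    simp only [Pi.smul_apply]
    rw [← hX g u]; exact map_smul _ _ _

/-- The value `a_m ∈ A_m` at `m` of a section `a ∈ 𝒜`. -/
def value (m : M) : B.atiyahAlgebra →ₗ[ℝ] B.fiber m where
  toFun a := ⟨fun u => a.1 u.1, fun g u => a.2 g u.1⟩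
  map_add' _ _ := rfl
  map_smul' _ _ := rfl

/-- The fibre `K_m` of the kernel `K = P ×_G 𝔤` of the anchor `A → TM`, `[X_u] ↦ T_u proj (X_u)`. -/
def kernelFiber (m : M) : Submodule ℝ (B.fiber m) where
  carrier := {X | ∀ u : {u : P // B.proj u = m},
    mfderiv 𝓘(ℝ, EP) 𝓘(ℝ, EM) B.proj u.1 (X.1 u) = 0}
  zero_mem' := fun u => map_zero _
  add_mem' := fun {X Y} hX hY u => by
    refine (map_add _ (X.1 u) (Y.1 u)).trans ?_
    rw [hX u, hY u, add_zero]
  smul_mem' := fun c X hX u => by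
    refine (map_smul _ c (X.1 u)).trans ?_
    rw [hX u, smul_zero]

/-- The Lie ideal `𝒦 = Γ(K)` of `𝒜`: the sections with values in the kernel of the anchor. -/
def kernel : LieIdeal ℝ B.atiyahAlgebra where
  carrier := {a | ∀ m, B.value m a ∈ B.kernelFiber m}
  zero_mem' := fun m => by rw [map_zero]; exact zero_mem _
  add_mem' := fun ha hb m => by rw [map_add]; exact add_mem (ha m) (hb m)
  smul_mem' := fun c a ha m => by rw [map_smul]; exact Submodule.smul_mem _ c (ha m)
  lie_mem := fun {a b} hb m u =>
    B.mfderiv_proj_bracket_of_vertical a.2 (fun w => hb (B.proj w) ⟨w, rfl⟩) u.1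

/-- The Lie subalgebra `𝒜(m) = {a ∈ 𝒜 : a_m = 0}`. -/
def vanishingAt (m : M) : LieSubalgebra ℝ B.atiyahAlgebra where
  carrier := {a | B.value m a = 0}
  zero_mem' := map_zero _
  add_mem' := fun {a b} (ha : B.value m a = 0) (hb : B.value m b = 0) => by
    change B.value m (a + b) = 0
    rw [map_add, ha, hb, add_zero]
  smul_mem' := fun c a (ha : B.value m a = 0) => by
    change B.value m (c • a) = 0
    rw [map_smul, ha, smul_zero]
  lie_mem' := fun {a b} ha hb => by
    refine Subtype.ext (funext fun u => ?_)
    have hau : a.1 u.1 = 0 := congrFun (congrArg Subtype.val ha) u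
    have hbu : b.1 u.1 = 0 := congrFun (congrArg Subtype.val hb) u
    change mlieBracket 𝓘(ℝ, EP) a.1 b.1 u.1 = 0
    rw [← mlieBracketWithin_univ]
    exact mlieBracketWithin_eq_zero_of_eq_zero hau hbu

/-- The Lie subalgebra `𝒜_m = {a ∈ 𝒜 : â_m = 0}` of the sections whose anchor `â` vanishes
at `m`. -/
def anchorVanishingAt (m : M) : LieSubalgebra ℝ B.atiyahAlgebra where
  carrier := {a | B.value m a ∈ B.kernelFiber m}
  zero_mem' := by
    change B.value m 0 ∈ B.kernelFiber m
    rw [map_zero]; exact zero_mem _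
  add_mem' := fun {a b} ha hb => by
    change B.value m (a + b) ∈ B.kernelFiber m
    rw [map_add]; exact add_mem ha hb
  smul_mem' := fun c a ha => by
    change B.value m (c • a) ∈ B.kernelFiber m
    rw [map_smul]; exact Submodule.smul_mem _ c ha
  lie_mem' := fun {a b} ha hb u => B.mfderiv_proj_bracket a.2 b.2 u.1 (ha u) (hb u)

/-- The space `𝒦(m) = {k ∈ 𝒦 : k_m = 0}`. -/
def kernelVanishingAt (m : M) : Submodule ℝ B.kernel :=
  LinearMap.ker (B.value m ∘ₗ B.kernel.toSubmodule.subtype)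

end SmoothPrincipalBundle

section LieAlgebraic

variable {L : Type*} [LieRing L] [LieAlgebra ℝ L]

/-- `T` is a maximal finite-codimensional Lie subalgebra: it is maximal among the proper Lie
subalgebras of finite codimension. -/
def IsMaximalFiniteCodimSubalgebra (T : LieSubalgebra ℝ L) : Prop :=
  Maximal (fun S : LieSubalgebra ℝ L => S ≠ ⊤ ∧ FiniteDimensional ℝ (L ⧸ S.toSubmodule)) T

/-- `J` is a maximal finite-codimensional Lie ideal: it is maximal among the proper Lie ideals of
finite codimension. -/
def IsMaximalFiniteCodimIdeal (J : LieIdeal ℝ L) : Prop :=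
  Maximal (fun S : LieIdeal ℝ L => S ≠ ⊤ ∧ FiniteDimensional ℝ (L ⧸ S.toSubmodule)) J

/-- For a Lie ideal `K` of `L`: the bracket `[S, K]` is included in the subspace `W` of `K`. -/
def BracketIncluded {K : LieIdeal ℝ L} (S : LieSubalgebra ℝ L) (W : Submodule ℝ K) : Prop :=
  ∀ a ∈ S, ∀ k : K, ⁅a, k⁆ ∈ W

/-- For a Lie ideal `K` of `L`: the Lie ideal `J` of `K` is normalized by the Lie subalgebra `T`
of `L`, i.e. `[T, J] ⊆ J`. -/
def IsNormalizedBy {K : LieIdeal ℝ L} (J : LieIdeal ℝ K) (T : LieSubalgebra ℝ L) : Prop :=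
  ∀ a ∈ T, ∀ k ∈ J, ⁅a, k⁆ ∈ J

/-- For a Lie ideal `K` of `L`: the intersection of all maximal finite-codimensional Lie ideals of
`K` that are normalized by the Lie subalgebra `T` of `L`. -/
def normalizedIntersection (K : LieIdeal ℝ L) (T : LieSubalgebra ℝ L) : Submodule ℝ K :=
  (sInf {J : LieIdeal ℝ K | IsMaximalFiniteCodimIdeal J ∧ IsNormalizedBy J T}).toSubmodule

end LieAlgebraic

end


/-!
The conductor of a subspace `T` of a `C^∞(M)`-module `V` is the largest ideal `I` of `C^∞(M)` with
`I • V ⊆ T`. On `M` there are two functions `hⱼ` and invariant fields `aⱼ` such that `∑ⱼ (aⱼ hⱼ)²`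
is invertible; together with the Leibniz rule this shows that the conductor has finite codimension
in `C^∞(M)`, both for a finite-codimensional subalgebra `T` of `𝒜` and for a finite-codimensional
ideal `J` of `𝒦` normalized by `𝒜_m`.

An element `b` of `T` acts on the conductor as a derivation, and a finite-codimensional ideal stable
under a derivation `δ` contains a power of each `δ f`. Hence if for every `m` some `b ∈ T` has a
nonzero anchor at `m`, the conductor has no zeros on `M`; having finite codimension it is the whole
ring, so `T = 𝒜`. Thus the maximal finite-codimensional subalgebras are exactly the `𝒜_m`.

By the same argument the conductor of `J` can only vanish at `m`, so it contains a power of the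
maximal ideal at `m`; since `𝔤` is perfect, maximality of `J` brings the exponent down to one, and
`𝒦(m) ⊆ J`. Conversely evaluation at `m` maps `𝒦` onto `𝔤` with kernel `𝒦(m)`, and the maximal
ideals of the semisimple algebra `𝔤` intersect in zero. So `𝒦^{𝒜_m} = 𝒦(m)`.

Finally `[S, 𝒦] ⊆ 𝒦(m)` if and only if `S ⊆ 𝒜(m)`: the Leibniz rule forces the anchors to vanish at
`m`, and what remains is central in `𝔤`. As `𝒜(m) ⊆ 𝒜_{m'}` only for `m = m'`, the `𝒜(m)` are
pairwise incomparable, and all three claims follow.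
-/

section FiniteCodimension

theorem cofg_comap {R V W : Type*} [Ring R] [IsNoetherianRing R] [AddCommGroup V] [Module R V]
    [AddCommGroup W] [Module R W] {J : Submodule R W} (hJ : J.CoFG) (f : V →ₗ[R] W) :
    (J.comap f).CoFG := by
  rw [← J.ker_mkQ, ← LinearMap.ker_comp]
  have : IsNoetherian R (W ⧸ J) := isNoetherian_of_isNoetherianRing_of_finite R _
  exact Submodule.CoFG.ker _

theorem cofg_iInf {R V ι : Type*} [Ring R] [IsNoetherianRing R] [AddCommGroup V] [Module R V]
    [Finite ι] {N : ι → Submodule R V} (hN : ∀ i, (N i).CoFG) : (⨅ i, N i).CoFG :=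
  Submodule.CoFG.sInf_of_finite (Set.finite_range N) (by rintro _ ⟨i, rfl⟩; exact hN i)

variable {k C L V : Type*} [Field k]

/-- The subspace of the elements of `L` that map all of `V` to `J` under `ρ`. -/
def transporterTop [AddCommGroup L] [Module k L] [AddCommGroup V] [Module k V]
    (ρ : L →ₗ[k] Module.End k V) (J : Submodule k V) : Submodule k L :=
  ⨅ x : V, J.comap (ρ.flip x)

theorem mem_transporterTop [AddCommGroup L] [Module k L] [AddCommGroup V] [Module k V]
    {ρ : L →ₗ[k] Module.End k V} {J : Submodule k V} {a : L} :
    a ∈ transporterTop ρ J ↔ ∀ x, ρ a x ∈ J := by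
  simp [transporterTop, Submodule.mem_iInf]

theorem cofg_transporterTop [AddCommGroup L] [Module k L] [AddCommGroup V] [Module k V]
    (ρ : L →ₗ[k] Module.End k V) {S : Submodule k L} {J : Submodule k V} (hS : S.CoFG)
    (hJ : J.CoFG) (h : ∀ a ∈ S, ∀ x ∈ J, ρ a x ∈ J) : (transporterTop ρ J).CoFG := by
  obtain ⟨F, hF⟩ := J.exists_isCompl
  obtain ⟨s, rfl⟩ := hJ.fg_of_isCompl hF
  refine Submodule.CoFG.of_le (fun a ha => mem_transporterTop.2 fun x => ?_)
    (hS.inf (cofg_iInf fun x : s => cofg_comap hJ (ρ.flip x.1)))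
  have hs : Submodule.span k (s : Set V) ≤ J.comap (ρ a) :=
    Submodule.span_le.2 fun x hx => (Submodule.mem_iInf _).1 ha.2 ⟨x, hx⟩
  exact (hF.sup_eq_top.ge.trans (sup_le (h a ha.1) hs)) Submodule.mem_top

variable [CommRing C] [Algebra k C]

theorem exists_aeval_mem_of_cofg {I : Ideal C} (hI : (I.restrictScalars k).CoFG) (h : C) :
    ∃ p : Polynomial k, p ≠ 0 ∧ Polynomial.aeval h p ∈ I := by
  have hcofg := cofg_comap hI (Polynomial.aeval (R := k) h).toLinearMap
  by_contra! hzero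
  have hbot : (I.restrictScalars k).comap (Polynomial.aeval (R := k) h).toLinearMap = ⊥ :=
    eq_bot_iff.2 fun p hp => by_contra fun hp0 => hzero p hp0 hp
  rw [hbot] at hcofg
  exact Polynomial.not_finite ((Module.Finite.iff_cofg_bot k _).1 hcofg)

/- `I` contains `p(h)` for some `p ≠ 0`. Applying `δ` to `p(h) (δ h) ^ n ∈ I` and multiplying by
`δ h` replaces `p` by its derivative, so that `p` becomes a nonzero constant in the end. -/
theorem exists_pow_derivation_mem_of_cofg [CharZero k] {I : Ideal C}
    (hI : (I.restrictScalars k).CoFG) (δ : Derivation k C C) (hδ : ∀ f ∈ I, δ f ∈ I) (h : C) :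
    ∃ n : ℕ, δ h ^ n ∈ I := by
  obtain ⟨p, hp0, hp⟩ := exists_aeval_mem_of_cofg hI h
  obtain ⟨n, hn⟩ : ∃ n : ℕ, Polynomial.aeval h p * δ h ^ n ∈ I := ⟨0, by simpa using hp⟩
  clear hp
  induction hd : p.natDegree generalizing p n with
  | zero =>
    rw [Polynomial.eq_C_of_natDegree_eq_zero hd] at hn hp0
    have hc : p.coeff 0 ≠ 0 := fun hc => hp0 (by rw [hc, map_zero])
    have hunit : IsUnit (algebraMap k C (p.coeff 0)) := (IsUnit.mk0 _ hc).map _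
    rw [Polynomial.aeval_C] at hn
    exact ⟨n, (Ideal.unit_mul_mem_iff_mem I hunit).1 hn⟩
  | succ d ih =>
    have hderiv : δ (Polynomial.aeval h p * δ h ^ n) * δ h =
        Polynomial.aeval h (Polynomial.derivative p) * δ h ^ (n + 2) +
          n * δ (δ h) * (Polynomial.aeval h p * δ h ^ n) := by
      rw [Derivation.leibniz, Derivation.leibniz_pow, Derivation.map_aeval]
      rcases n with - | n <;> simp [pow_succ] <;> ring
    have hmem := I.mul_mem_right (δ h) (hδ _ hn)
    rw [hderiv] at hmem
    have hn' := (Ideal.add_mem_iff_left I (I.mul_mem_left _ hn)).1 hmem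
    refine ih p.derivative (fun h0 => ?_) (n + 2) hn' ?_
    · have := Polynomial.derivative_eq_zero.1 h0
      omega
    · rw [Polynomial.natDegree_derivative, hd, Nat.add_sub_cancel]

theorem exists_pow_le_of_cofg {I 𝔪 : Ideal C} (hI : (I.restrictScalars k).CoFG)
    (h : ∀ f ∈ 𝔪, ∃ n : ℕ, f ^ n ∈ I) : ∃ n : ℕ, 𝔪 ^ n ≤ I := by
  have : Module.Finite k (C ⧸ I) :=
    Module.Finite.equiv (Submodule.Quotient.restrictScalarsEquiv k I)
  have : IsArtinianRing (C ⧸ I) := IsArtinianRing.of_finite k _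
  obtain ⟨n, hn⟩ := IsArtinianRing.isNilpotent_nilradical (R := C ⧸ I)
  have hle : 𝔪.map (Ideal.Quotient.mk I) ≤ nilradical (C ⧸ I) :=
    Ideal.map_le_iff_le_comap.2 fun f hf => by
      obtain ⟨r, hr⟩ := h f hf
      exact ⟨r, by rw [← map_pow]; exact Ideal.Quotient.eq_zero_iff_mem.2 hr⟩
  have hbot : (𝔪 ^ n).map (Ideal.Quotient.mk I) ≤ ⊥ :=
    (Ideal.map_pow _ _ n).trans_le ((Ideal.pow_right_mono hle n).trans hn.le)
  exact ⟨n, fun f hf => Ideal.Quotient.eq_zero_iff_mem.1 (hbot (Ideal.mem_map_of_mem _ hf))⟩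

variable (C) in
/-- The conductor of `V` into `W`: the ideal of all `f` with `f • V ⊆ W`. Unlike for the colon
ideal, `W` is only a subspace over the base field. -/
def conductorIdeal [AddCommGroup V] [Module k V] [Module C V] (W : Submodule k V) : Ideal C where
  carrier := {f | ∀ v : V, f • v ∈ W}
  zero_mem' v := by simp
  add_mem' hf hg v := by rw [add_smul]; exact W.add_mem (hf v) (hg v)
  smul_mem' g f hf v := by rw [smul_eq_mul, mul_comm, mul_smul]; exact hf _

theorem cofg_of_forall_mul_sq_mem [AddCommGroup L] [Module k L] [Module C L] [IsScalarTower k C L]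
    {ι : Type*} [Fintype ι] {N : Submodule k L} (hN : N.CoFG) {I : Ideal C} (a : ι → L)
    (h w : ι → C) (hw : IsUnit (∑ i, w i ^ 2))
    (H : ∀ i f, f • a i ∈ N → (f * h i) • a i ∈ N → f * w i ^ 2 ∈ I) :
    (I.restrictScalars k).CoFG := by
  have hcofg : (⨅ i, (N.comap ((LinearMap.toSpanSingleton C L (a i)).restrictScalars k) ⊓
      N.comap ((LinearMap.toSpanSingleton C L (h i • a i)).restrictScalars k))).CoFG :=
    cofg_iInf fun i => (cofg_comap hN _).inf (cofg_comap hN _)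
  refine hcofg.of_le fun f hf => (Ideal.mul_unit_mem_iff_mem I hw).1 ?_
  rw [Finset.mul_sum]
  refine I.sum_mem fun i _ => ?_
  obtain ⟨ha, hha⟩ := (Submodule.mem_iInf _).1 hf i
  exact H i f ha (by rw [mul_smul]; exact hha)

section LieRinehart

variable [LieRing L] [LieAlgebra k L] [Module C L] [LieRingModule L C]

theorem smul_lie_eq_sub [LieRinehartRing C L] (f : C) (a b : L) :
    ⁅f • a, b⁆ = f • ⁅a, b⁆ - ⁅b, f⁆ • a := by
  rw [← lie_skew, LieRinehartRing.leibniz_smul_right, ← lie_skew a b, smul_neg, neg_add,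
    sub_eq_add_neg]

theorem cofg_conductorIdeal_of_lieSubalgebra [NeZero (2 : k)] [LieRinehartRing C L]
    [LieRinehartAlgebra k C L] {ι : Type*} [Fintype ι] (a : ι → L) (h : ι → C)
    (hunit : IsUnit (∑ i, ⁅a i, h i⁆ ^ 2)) {T : LieSubalgebra k L} (hT : T.toSubmodule.CoFG) :
    ((conductorIdeal C T.toSubmodule).restrictScalars k).CoFG := by
  have hN : (transporterTop (LieAlgebra.ad k L : L →ₗ[k] Module.End k L) T.toSubmodule).CoFG :=
    cofg_transporterTop _ hT hT fun x hx y hy => T.lie_mem hx hy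
  refine cofg_of_forall_mul_sq_mem hN a h _ hunit fun i f hfa hfha b => ?_
  rw [mem_transporterTop] at hfa hfha
  have hpair (g : C) (b : L) :
      (f * g * ⁅a i, h i⁆) • b + (f * g * ⁅b, h i⁆) • a i ∈ T := by
    have hsub := T.sub_mem (hfa ((g * h i) • b)) (hfha (g • b))
    convert hsub using 1
    simp only [LieAlgebra.ad_apply, LieHom.coe_toLinearMap, smul_lie_eq_sub,
      LieRinehartRing.leibniz_smul_right, LieRinehartRing.lie_smul_eq_mul,
      LieRinehartRing.leibniz_mul_right, smul_eq_mul]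
    module
  have hself (g : C) : (f * g * ⁅a i, h i⁆) • a i ∈ T := by
    have := T.smul_mem (2⁻¹ : k) (hpair g (a i))
    rwa [← two_smul k, smul_smul, inv_mul_cancel₀ two_ne_zero, one_smul] at this
  have hsub := T.sub_mem (hpair ⁅a i, h i⁆ b) (hself ⁅b, h i⁆)
  change (f * ⁅a i, h i⁆ ^ 2) • b ∈ T
  convert hsub using 1
  module

theorem cofg_conductorIdeal_of_forall_lie_mem [IsScalarTower k C L] [AddCommGroup V] [Module k V]
    [Module C V] [LieRingModule L V] [LieModule k L V]
    (leibniz : ∀ (a : L) (f : C) (v : V), ⁅a, f • v⁆ = f • ⁅a, v⁆ + ⁅a, f⁆ • v)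
    (smul_lie' : ∀ (f : C) (a : L) (v : V), ⁅f • a, v⁆ = f • ⁅a, v⁆)
    {ι : Type*} [Fintype ι] (a : ι → L) (h : ι → C) (hunit : IsUnit (∑ i, ⁅a i, h i⁆ ^ 2))
    {S : Submodule k L} (hS : S.CoFG) {J : Submodule k V} (hJ : J.CoFG)
    (hSJ : ∀ a ∈ S, ∀ x ∈ J, ⁅a, x⁆ ∈ J) :
    ((conductorIdeal C J).restrictScalars k).CoFG := by
  have hN : (transporterTop (LieModule.toEnd k L V : L →ₗ[k] Module.End k V) J).CoFG :=
    cofg_transporterTop _ hS hJ hSJ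
  refine cofg_of_forall_mul_sq_mem hN a h _ hunit fun i f hfa hfha v => ?_
  rw [mem_transporterTop] at hfa hfha
  have hsub := J.sub_mem (hfa (h i • ⁅a i, h i⁆ • v)) (hfha (⁅a i, h i⁆ • v))
  convert hsub using 1
  simp only [LieHom.coe_toLinearMap, LieModule.toEnd_apply_apply, smul_lie', leibniz]
  module

end LieRinehart

end FiniteCodimension

section LinearLieAlgebra

theorem sup_pow_smul_top_eq_top {C V : Type*} [CommRing C] [AddCommGroup V] [Module C V]
    {I : Ideal C} {Q : Submodule C V} (h : Q ⊔ I • ⊤ = ⊤) (n : ℕ) :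
    Q ⊔ I ^ n • (⊤ : Submodule C V) = ⊤ := by
  induction n with
  | zero => simp
  | succ n ih =>
    refine eq_top_iff.2 (ih.ge.trans (sup_le le_sup_left ?_))
    calc I ^ n • (⊤ : Submodule C V) = I ^ n • (Q ⊔ I • ⊤) := by rw [h]
      _ = I ^ n • Q ⊔ I ^ (n + 1) • ⊤ := by rw [Submodule.smul_sup, pow_succ, mul_smul]
      _ ≤ Q ⊔ I ^ (n + 1) • ⊤ := sup_le_sup_right Submodule.smul_le_right _

variable {k C K : Type*} [Field k] [CommRing C] [Algebra k C] [LieRing K] [LieAlgebra k K]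
    [LieAlgebra C K] [IsScalarTower k C K]

variable (k K) in
/-- The Lie ideal `I • K` of a Lie algebra `K` over `C`, where `I` is an ideal of the `k`-algebra
`C`. It is an ideal of `K` as a Lie algebra over `k`, in order to be compared with ideals that are
not stable under `C`. -/
def smulTopLieIdeal (I : Ideal C) : LieIdeal k K where
  __ := (I • (⊤ : Submodule C K)).restrictScalars k
  lie_mem {x _} hn := Submodule.smul_top_le_comap_smul_top I (LieAlgebra.ad C K x : K →ₗ[C] K) hn

theorem lie_mem_smulTopLieIdeal_mul {I I' : Ideal C} {x y : K} (hx : x ∈ smulTopLieIdeal k K I)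
    (hy : y ∈ smulTopLieIdeal k K I') : ⁅x, y⁆ ∈ smulTopLieIdeal k K (I * I') := by
  change x ∈ I • (⊤ : Submodule C K) at hx
  change ⁅x, y⁆ ∈ (I * I') • (⊤ : Submodule C K)
  induction hx using Submodule.smul_induction_on' with
  | smul f hf z _ =>
    have hzy : ⁅z, y⁆ ∈ I' • (⊤ : Submodule C K) := (smulTopLieIdeal k K I').lie_mem hy
    rw [smul_lie, mul_smul]
    exact Submodule.smul_mem_smul hf hzy
  | add z _ w _ hz hw => rw [add_lie]; exact add_mem hz hw

theorem smulTopLieIdeal_le_iff {I : Ideal C} {J : LieIdeal k K} :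
    smulTopLieIdeal k K I ≤ J ↔ I ≤ conductorIdeal C J.toSubmodule := by
  refine ⟨fun h f hf x => ?_, fun h x hx => ?_⟩
  · have hfx : f • x ∈ I • (⊤ : Submodule C K) := Submodule.smul_mem_smul hf Submodule.mem_top
    exact h hfx
  change x ∈ I • (⊤ : Submodule C K) at hx
  induction hx using Submodule.smul_induction_on' with
  | smul f hf x _ => exact h hf x
  | add y _ z _ hy hz => exact add_mem hy hz

theorem mem_of_mem_lie_top_top {W : AddSubgroup K} (hW : ∀ x y : K, ⁅x, y⁆ ∈ W) {x : K}
    (hx : x ∈ (⁅(⊤ : LieIdeal C K), (⊤ : LieIdeal C K)⁆ : LieIdeal C K)) : x ∈ W := by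
  rw [← LieSubmodule.mem_toSubmodule, LieSubmodule.lieIdeal_oper_eq_linear_span'] at hx
  induction hx using Submodule.closure_induction with
  | zero => exact W.zero_mem
  | add x y _ _ hx hy => exact W.add_mem hx hy
  | smul_mem f x hx =>
    obtain ⟨y, -, z, -, rfl⟩ := hx
    rw [← lie_smul]
    exact hW y _

theorem IsMaximalFiniteCodimIdeal.sup_eq_top {L : Type*} [LieRing L] [LieAlgebra ℝ L]
    {J I : LieIdeal ℝ L} (hJ : IsMaximalFiniteCodimIdeal J) (hI : ¬ I ≤ J) : J ⊔ I = ⊤ := by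
  by_contra hne
  have hle : J.toSubmodule ≤ (J ⊔ I).toSubmodule := (le_sup_left : J ≤ J ⊔ I)
  exact hI (le_sup_right.trans
    (hJ.le_of_ge ⟨hne, Submodule.CoFG.of_le hle hJ.prop.2⟩ le_sup_left))

/- For the least `s` with `𝔪 ^ s • K ≤ J`, if `s ≥ 2` then `J + 𝔪 ^ (s - 1) • K` is everything, and
since `2 * (s - 1) ≥ s` this puts all brackets into `J`, contradicting that `K` is perfect
modulo `𝔪`. -/
theorem IsMaximalFiniteCodimIdeal.le_conductorIdeal {C K : Type*} [CommRing C] [Algebra ℝ C]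
    [LieRing K] [LieAlgebra ℝ K] [LieAlgebra C K] [IsScalarTower ℝ C K] {J : LieIdeal ℝ K}
    (hJ : IsMaximalFiniteCodimIdeal J) {𝔪 : Ideal C} {r : ℕ}
    (hr : 𝔪 ^ r ≤ conductorIdeal C J.toSubmodule)
    (hperf : (⁅(⊤ : LieIdeal C K), (⊤ : LieIdeal C K)⁆ : LieIdeal C K).toSubmodule ⊔ 𝔪 • ⊤ = ⊤) :
    𝔪 ≤ conductorIdeal C J.toSubmodule := by
  have hex : ∃ s : ℕ, smulTopLieIdeal ℝ K (𝔪 ^ s) ≤ J := ⟨r, smulTopLieIdeal_le_iff.2 hr⟩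
  classical
  set s := Nat.find hex
  have hsJ : smulTopLieIdeal ℝ K (𝔪 ^ s) ≤ J := Nat.find_spec hex
  suffices hs1 : s ≤ 1 by
    calc 𝔪 = 𝔪 ^ 1 := (pow_one 𝔪).symm
      _ ≤ 𝔪 ^ s := Ideal.pow_le_pow_right hs1
      _ ≤ conductorIdeal C J.toSubmodule := smulTopLieIdeal_le_iff.1 hsJ
  by_contra! hs2
  have hsup := hJ.sup_eq_top (Nat.find_min hex (m := s - 1) (by omega))
  have hlie (x y : K) : ⁅x, y⁆ ∈ J := by
    obtain ⟨x₁, hx₁, x₂, hx₂, rfl⟩ := (LieSubmodule.mem_sup ..).1 (hsup ▸ LieSubmodule.mem_top x)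
    obtain ⟨y₁, hy₁, y₂, hy₂, rfl⟩ := (LieSubmodule.mem_sup ..).1 (hsup ▸ LieSubmodule.mem_top y)
    have hmul : 𝔪 ^ (s - 1) * 𝔪 ^ (s - 1) ≤ 𝔪 ^ s := by
      rw [← pow_add]
      exact Ideal.pow_le_pow_right (by omega)
    have hle : smulTopLieIdeal ℝ K (𝔪 ^ (s - 1) * 𝔪 ^ (s - 1)) ≤ J :=
      smulTopLieIdeal_le_iff.2 (hmul.trans (smulTopLieIdeal_le_iff.1 hsJ))
    rw [add_lie, lie_add x₂]
    exact add_mem (lie_mem_left ℝ K J _ _ hx₁)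
      (add_mem (J.lie_mem hy₁) (hle (lie_mem_smulTopLieIdeal_mul hx₂ hy₂)))
  refine hJ.prop.1 (eq_top_iff.2 fun x _ => ?_)
  obtain ⟨q, hq, y, hy, rfl⟩ := Submodule.mem_sup.1
    (sup_pow_smul_top_eq_top hperf s ▸ Submodule.mem_top (x := x))
  exact add_mem (mem_of_mem_lie_top_top (W := J.toSubmodule.toAddSubgroup) hlie hq) (hsJ hy)

end LinearLieAlgebra

section Semisimple

variable {R L : Type*} [CommRing R] [LieRing L] [LieAlgebra R L] [LieAlgebra.IsSemisimple R L]

theorem exists_isCoatom_lieIdeal_notMem {x : L} (hx : x ≠ 0) :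
    ∃ J : LieIdeal R L, IsCoatom J ∧ x ∉ J := by
  have hne : LieSubmodule.lieSpan R L {x} ≠ ⊥ := fun h =>
    hx ((LieSubmodule.lieSpan_eq_bot_iff R L L).1 h x rfl)
  obtain ⟨I, hI, hIx⟩ := (eq_bot_or_exists_atom_le (LieSubmodule.lieSpan R L {x})).resolve_left hne
  refine ⟨Iᶜ, isCoatom_compl.2 hI, fun hmem => hI.1 (le_compl_self.1 ?_)⟩
  exact hIx.trans (LieSubmodule.lieSpan_le.2 (by simpa using hmem))

variable (R L) in
theorem lie_top_top_eq_top : (⁅(⊤ : LieIdeal R L), (⊤ : LieIdeal R L)⁆ : LieIdeal R L) = ⊤ := by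
  rw [← compl_eq_bot]
  refine (LieAlgebra.hasTrivialRadical_iff_no_abelian_ideals R L).1 inferInstance _ ?_
  rw [LieSubmodule.lie_abelian_iff_lie_self_eq_bot, eq_bot_iff]
  calc _ ≤ _ := le_inf (LieSubmodule.mono_lie le_top le_top) (LieSubmodule.lie_le_right _ _)
    _ = ⊥ := inf_compl_eq_bot

end Semisimple

section SmoothFunctions

variable {E M : Type*} [NormedAddCommGroup E] [NormedSpace ℝ E]
    [TopologicalSpace M] [ChartedSpace E M]

theorem isUnit_of_forall_apply_ne_zero {f : C^∞⟮𝓘(ℝ, E), M; ℝ⟯} (hf : ∀ x, f x ≠ 0) :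
    IsUnit f := by
  let g : C^∞⟮𝓘(ℝ, E), M; ℝ⟯ := ⟨fun x => (f x)⁻¹, fun x => (f.contMDiff x).inv₀ (hf x)⟩
  exact IsUnit.of_mul_eq_one g (ContMDiffMap.ext fun x => mul_inv_cancel₀ (hf x))

theorem aeval_contMDiffMap_apply (f : C^∞⟮𝓘(ℝ, E), M; ℝ⟯) (p : Polynomial ℝ) (x : M) :
    Polynomial.aeval f p x = p.eval (f x) := by
  have h := Polynomial.aeval_algHom_apply
    ((Pi.evalAlgHom ℝ (fun _ : M => ℝ) x).comp
      (ContMDiffMap.coeFnAlgHom (I := 𝓘(ℝ, E)) (N := M) (n := ∞) (A := ℝ))) f p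
  rw [Polynomial.coe_aeval_eq_eval] at h
  exact h.symm

variable (E) in
/-- The ideal of the smooth functions that vanish at `m`. -/
noncomputable def vanishingIdealAt (m : M) : Ideal C^∞⟮𝓘(ℝ, E), M; ℝ⟯ :=
  RingHom.ker (ContMDiffMap.evalRingHom (I := 𝓘(ℝ, E)) (I' := 𝓘(ℝ, ℝ)) (n := ∞) (R := ℝ) m)

theorem mem_vanishingIdealAt {m : M} {f : C^∞⟮𝓘(ℝ, E), M; ℝ⟯} :
    f ∈ vanishingIdealAt E m ↔ f m = 0 := Iff.rfl

theorem eq_top_of_isCompact_zeros {I : Ideal C^∞⟮𝓘(ℝ, E), M; ℝ⟯} {f : C^∞⟮𝓘(ℝ, E), M; ℝ⟯}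
    (hf : f ∈ I) (hcompact : IsCompact {x | f x = 0}) (h : ∀ m, ∃ g ∈ I, g m ≠ 0) : I = ⊤ := by
  obtain ⟨g, hg, hg0, hgpos⟩ : ∃ g ∈ I, (∀ x, 0 ≤ g x) ∧ ∀ x ∈ {x | f x = 0}, 0 < g x := by
    refine hcompact.induction_on ?_ ?_ ?_ ?_
    · exact ⟨0, I.zero_mem, fun _ => le_rfl, fun _ hx => hx.elim⟩
    · rintro s t hst ⟨g, hg, hg0, hgpos⟩
      exact ⟨g, hg, hg0, fun x hx => hgpos x (hst hx)⟩
    · rintro s t ⟨g, hg, hg0, hgpos⟩ ⟨g', hg', hg0', hgpos'⟩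
      exact ⟨g + g', I.add_mem hg hg', fun x => add_nonneg (hg0 x) (hg0' x), fun x hx =>
        hx.elim (fun hx => add_pos_of_pos_of_nonneg (hgpos x hx) (hg0' x))
          fun hx => add_pos_of_nonneg_of_pos (hg0 x) (hgpos' x hx)⟩
    · intro m _
      obtain ⟨g, hg, hgm⟩ := h m
      refine ⟨{x | g x ≠ 0}, mem_nhdsWithin_of_mem_nhds
        ((isOpen_ne_fun g.contMDiff.continuous continuous_const).mem_nhds hgm),
        g * g, I.mul_mem_left g hg, fun x => mul_self_nonneg (g x), fun x hx => ?_⟩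
      exact mul_self_pos.2 hx
  have hunit : IsUnit (f * f + g) := isUnit_of_forall_apply_ne_zero fun x => by
    change f x * f x + g x ≠ 0
    by_cases hx : f x = 0
    · exact (add_pos_of_nonneg_of_pos (mul_self_nonneg _) (hgpos x hx)).ne'
    · exact (add_pos_of_pos_of_nonneg (mul_self_pos.2 hx) (hg0 x)).ne'
  exact I.eq_top_of_isUnit_mem (I.add_mem (I.mul_mem_left f hf) hg) hunit

variable [FiniteDimensional ℝ E] [IsManifold 𝓘(ℝ, E) ∞ M] [T2Space M] [SecondCountableTopology M]

variable (E M) in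
theorem exists_contMDiffMap_tendsto_cocompact_atTop :
    ∃ ρ : C^∞⟮𝓘(ℝ, E), M; ℝ⟯, Filter.Tendsto ρ (Filter.cocompact M) Filter.atTop := by
  have := ChartedSpace.locallyCompactSpace E M
  let K := CompactExhaustion.choice M
  obtain ⟨ρ, hρ⟩ := exists_contMDiffMap_forall_mem_convex_of_local_const (n := ⊤) 𝓘(ℝ, E)
    (t := fun x : M => Set.Ici (K.find x : ℝ)) (fun x => convex_Ici _) (fun x => by
      refine ⟨(K.find x + 1 : ℕ), ?_⟩
      have hx : x ∈ interior (K (K.find x + 1)) := K.subset_interior_succ _ (K.mem_find x)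
      filter_upwards [mem_interior_iff_mem_nhds.1 hx] with y hy
      exact Nat.cast_le (α := ℝ).2 (K.mem_iff_find_le.1 hy))
  refine ⟨ρ, Filter.tendsto_atTop.2 fun c => ?_⟩
  filter_upwards [(K.isCompact ⌈c⌉₊).compl_mem_cocompact] with x hx
  have hfind : ⌈c⌉₊ < K.find x := not_le.1 fun hle => hx (K.mem_iff_find_le.2 hle)
  calc c ≤ ⌈c⌉₊ := Nat.le_ceil c
    _ ≤ K.find x := by exact_mod_cast hfind.le
    _ ≤ ρ x := hρ x

theorem exists_mem_isCompact_zeros_of_cofg {I : Ideal C^∞⟮𝓘(ℝ, E), M; ℝ⟯}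
    (hI : (I.restrictScalars ℝ).CoFG) : ∃ f ∈ I, IsCompact {x | f x = 0} := by
  obtain ⟨ρ, hρ⟩ := exists_contMDiffMap_tendsto_cocompact_atTop E M
  obtain ⟨p, hp0, hp⟩ := exists_aeval_mem_of_cofg hI ρ
  refine ⟨_, hp, ?_⟩
  obtain ⟨c, hc⟩ := p.roots.toFinset.bddAbove
  obtain ⟨K, hK, hKc⟩ := Filter.mem_cocompact.1 (hρ.eventually_gt_atTop c)
  refine hK.of_isClosed_subset (isClosed_eq (Polynomial.aeval ρ p).contMDiff.continuous
    continuous_const) fun x hx => by_contra fun hxK => (hKc hxK).not_ge (hc ?_)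
  rw [Set.mem_ofPred_eq, aeval_contMDiffMap_apply] at hx
  simpa using ⟨hp0, hx⟩

theorem eq_top_of_cofg {I : Ideal C^∞⟮𝓘(ℝ, E), M; ℝ⟯} (hI : (I.restrictScalars ℝ).CoFG)
    (h : ∀ m, ∃ f ∈ I, f m ≠ 0) : I = ⊤ :=
  let ⟨_, hf, hcompact⟩ := exists_mem_isCompact_zeros_of_cofg hI
  eq_top_of_isCompact_zeros hf hcompact h

/- Let `f m = 0` and let `I` contain `f ^ r * q(f)` with `q(0) ≠ 0`. Then `I` and `q(f)` have no
common zero, so that `f ^ r` is in `I`. -/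
theorem exists_pow_vanishingIdealAt_le {I : Ideal C^∞⟮𝓘(ℝ, E), M; ℝ⟯}
    (hI : (I.restrictScalars ℝ).CoFG) (m : M) (h : ∀ x, x ≠ m → ∃ f ∈ I, f x ≠ 0) :
    ∃ n : ℕ, vanishingIdealAt E m ^ n ≤ I := by
  refine exists_pow_le_of_cofg hI fun f hf => ?_
  obtain ⟨p, hp0, hp⟩ := exists_aeval_mem_of_cofg hI f
  obtain ⟨q, hq, hq0⟩ := Polynomial.exists_eq_pow_rootMultiplicity_mul_and_not_dvd p hp0 0
  rw [map_zero, sub_zero] at hq hq0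
  rw [Polynomial.X_dvd_iff, Polynomial.coeff_zero_eq_eval_zero] at hq0
  set r := p.rootMultiplicity 0
  set g : C^∞⟮𝓘(ℝ, E), M; ℝ⟯ := Polynomial.aeval f q with hg
  have hle : I.restrictScalars ℝ ≤ (I ⊔ Ideal.span {g}).restrictScalars ℝ :=
    (le_sup_left : I ≤ I ⊔ Ideal.span {g})
  have htop : I ⊔ Ideal.span {g} = ⊤ := by
    refine eq_top_of_cofg (hI.of_le hle) fun x => ?_
    by_cases hx : x = m
    · refine ⟨g, Ideal.mem_sup_right (Ideal.mem_span_singleton_self g), ?_⟩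
      rwa [hx, hg, aeval_contMDiffMap_apply, mem_vanishingIdealAt.1 hf]
    · obtain ⟨f', hf', hne⟩ := h x hx
      exact ⟨f', hle hf', hne⟩
  refine ⟨r, ?_⟩
  rw [hq, map_mul, map_pow, Polynomial.aeval_X] at hp
  obtain ⟨i, hi, y, hy, hiy⟩ := Submodule.mem_sup.1 ((Ideal.eq_top_iff_one _).1 htop)
  obtain ⟨z, rfl⟩ := Ideal.mem_span_singleton'.1 hy
  have hfr : f ^ r = f ^ r * i + z * (f ^ r * g) := by linear_combination -(f ^ r) * hiy
  rw [hfr]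
  exact I.add_mem (I.mul_mem_left _ hi) (I.mul_mem_left _ hp)

end SmoothFunctions

section TangentVectors

open Topology

variable {E M : Type*} [NormedAddCommGroup E] [NormedSpace ℝ E] [TopologicalSpace M]
    [ChartedSpace E M]

theorem mvfderiv_clm_comp {F F' : Type*} [NormedAddCommGroup F] [NormedSpace ℝ F]
    [NormedAddCommGroup F'] [NormedSpace ℝ F'] (ℓ : F →L[ℝ] F') {f : M → F} {x : M}
    (hf : MDifferentiableAt 𝓘(ℝ, E) 𝓘(ℝ, F) f x) (v : TangentSpace 𝓘(ℝ, E) x) :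
    mvfderiv 𝓘(ℝ, E) (ℓ ∘ f) x v = ℓ (mvfderiv 𝓘(ℝ, E) f x v) :=
  congrArg (fun L : E →L[ℝ] F' => L v)
    (ℓ.hasMFDerivAt.comp x hf.hasMFDerivAt :
      HasMFDerivAt 𝓘(ℝ, E) 𝓘(ℝ, F') (ℓ ∘ f) x _).mfderiv

theorem exists_finset_eventually_finsum_clm_eq_sum {ι X E F : Type*} [TopologicalSpace X]
    [NormedAddCommGroup E] [NormedSpace ℝ E] [NormedAddCommGroup F] [NormedSpace ℝ F]
    {ψ : ι → X → E} (hfin : LocallyFinite fun i => Function.support (ψ i)) (i₀ : ι) (x : X) :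
    ∃ s : Finset ι, i₀ ∈ s ∧
      ∀ᶠ y in 𝓝 x, ∀ c : ι → E →L[ℝ] F, ∑ᶠ i, c i (ψ i y) = ∑ i ∈ s, c i (ψ i y) := by
  classical
  obtain ⟨V, hV, hVfin⟩ := hfin x
  refine ⟨insert i₀ hVfin.toFinset, Finset.mem_insert_self _ _, Filter.eventually_of_mem hV
    fun y hy c => finsum_eq_sum_of_support_subset _ fun i hi => ?_⟩
  refine Finset.mem_insert_of_mem (hVfin.mem_toFinset.2 ⟨y, fun h0 => hi ?_, hy⟩)
  simp [h0]

theorem comp_extChartAt_symm_eventuallyEq_id {f : M → E} {p x : M}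
    (hx : x ∈ (extChartAt 𝓘(ℝ, E) p).source) (hf : f =ᶠ[𝓝 x] extChartAt 𝓘(ℝ, E) p) :
    f ∘ (extChartAt 𝓘(ℝ, E) p).symm =ᶠ[𝓝 (extChartAt 𝓘(ℝ, E) p x)] id := by
  rw [← PartialEquiv.left_inv _ hx] at hf
  filter_upwards [(isOpen_extChartAt_target p).mem_nhds (PartialEquiv.map_source _ hx),
    (continuousAt_extChartAt_symm' hx).eventually hf] with z hz hfz
  rw [Function.comp_apply, hfz, PartialEquiv.right_inv _ hz, id]

variable [IsManifold 𝓘(ℝ, E) ∞ M]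

theorem exists_dual_mvfderiv_comp_extChartAt_ne_zero {x : M} {v : TangentSpace 𝓘(ℝ, E) x}
    (hv : v ≠ 0) :
    ∃ ℓ : E →L[ℝ] ℝ, mvfderiv 𝓘(ℝ, E) (ℓ ∘ extChartAt 𝓘(ℝ, E) x) x v ≠ 0 := by
  have hinv := isInvertible_mfderiv_extChartAt (I := 𝓘(ℝ, E))
    (mem_extChartAt_source (I := 𝓘(ℝ, E)) x)
  obtain ⟨ℓ, hℓ⟩ := SeparatingDual.exists_ne_zero (R := ℝ) (V := E)
    (fun h0 => hv (hinv.injective (h0.trans (map_zero _).symm)) :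
      mvfderiv 𝓘(ℝ, E) (extChartAt 𝓘(ℝ, E) x) x v ≠ 0)
  refine ⟨ℓ, ?_⟩
  rwa [mvfderiv_clm_comp ℓ ((contMDiffAt_extChartAt (n := ∞)).mdifferentiableAt (by simp))]

theorem eq_of_forall_mvfderiv_eq {x : M} {v w : TangentSpace 𝓘(ℝ, E) x}
    (h : ∀ φ : M → ℝ, ContMDiffAt 𝓘(ℝ, E) 𝓘(ℝ, ℝ) ∞ φ x →
      mvfderiv 𝓘(ℝ, E) φ x v = mvfderiv 𝓘(ℝ, E) φ x w) : v = w := by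
  by_contra hne
  obtain ⟨ℓ, hℓ⟩ := exists_dual_mvfderiv_comp_extChartAt_ne_zero (sub_ne_zero.2 hne)
  rw [map_sub] at hℓ
  exact sub_ne_zero.1 hℓ (h _ (ℓ.contMDiff.contMDiffAt.comp x contMDiffAt_extChartAt))

variable [FiniteDimensional ℝ E] [T2Space M]

theorem exists_contMDiffMap_tsupport_subset_eventuallyEq_one {m : M} {O : Set M} (hO : O ∈ 𝓝 m) :
    ∃ χ : C^∞⟮𝓘(ℝ, E), M; ℝ⟯, tsupport χ ⊆ O ∧ χ =ᶠ[𝓝 m] 1 := by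
  obtain ⟨f, hf, -⟩ := (SmoothBumpFunction.nhds_basis_support (I := 𝓘(ℝ, E)) hO).mem_iff.1 hO
  exact ⟨⟨f, f.contMDiff⟩, hf, f.eventuallyEq_one⟩

theorem exists_contMDiffMap_mvfderiv_ne_zero {m : M} {v : TangentSpace 𝓘(ℝ, E) m} (hv : v ≠ 0) :
    ∃ f : C^∞⟮𝓘(ℝ, E), M; ℝ⟯, mvfderiv 𝓘(ℝ, E) f m v ≠ 0 := by
  obtain ⟨ℓ, hℓ⟩ := exists_dual_mvfderiv_comp_extChartAt_ne_zero hv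
  obtain ⟨χ⟩ : Nonempty (SmoothBumpFunction 𝓘(ℝ, E) m) := inferInstance
  refine ⟨⟨ℓ ∘ fun x => χ x • extChartAt 𝓘(ℝ, E) m x,
    ℓ.contMDiff.comp (χ.contMDiff_smul contMDiffOn_extChartAt)⟩, ?_⟩
  have heq : (ℓ ∘ fun x => χ x • extChartAt 𝓘(ℝ, E) m x) =ᶠ[𝓝 m] ℓ ∘ extChartAt 𝓘(ℝ, E) m := by
    filter_upwards [χ.eventuallyEq_one] with x hx
    simp [hx]
  rw [ContMDiffMap.coeFn_mk, mvfderiv, heq.mfderiv_eq]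
  exact hℓ

end TangentVectors

section Noncritical

universe u

open Metric Topology

theorem isOpen_setOf_forall_sum_comp_ne_zero {ι E F : Type*} [NormedAddCommGroup E]
    [NormedSpace ℝ E] [NormedAddCommGroup F] [NormedSpace ℝ F] (s : Finset ι)
    {A : ι → E → E →L[ℝ] E} {K : Set E} (hK : IsCompact K) (hA : ∀ i ∈ s, ContinuousOn (A i) K) :
    IsOpen {c : ι → E →L[ℝ] F | ∀ z ∈ K, ∑ i ∈ s, c i ∘L A i z ≠ 0} := by
  have : CompactSpace K := isCompact_iff_compactSpace.1 hK
  let Φ : (ι → E →L[ℝ] F) × K → E →L[ℝ] F := fun p => ∑ i ∈ s, p.1 i ∘L A i p.2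
  have hΦ : Continuous Φ := by
    refine continuous_finsetSum s fun i hi => ?_
    exact ((continuous_apply i).comp continuous_fst).clm_comp
      ((continuousOn_iff_continuous_domRestrict.1 (hA i hi)).comp continuous_snd)
  have hclosed : IsClosed (Prod.fst '' (Φ ⁻¹' {0})) :=
    isClosedMap_fst_of_compactSpace _ (isClosed_singleton.preimage hΦ)
  convert hclosed.isOpen_compl using 1
  ext c
  simp [Φ]

/- Once the other coefficients are chosen, the values of `c i₀` to be avoided form the image of `K`
under a `C¹` map, whose dimension is at most `dim E < dim (E →L[ℝ] F)`. -/
theorem dense_setOf_forall_sum_comp_ne_zero {ι E F : Type*} [NormedAddCommGroup E]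
    [NormedSpace ℝ E] [FiniteDimensional ℝ E] [Nontrivial E] [NormedAddCommGroup F]
    [NormedSpace ℝ F] [FiniteDimensional ℝ F] (hF : 1 < Module.finrank ℝ F) (s : Finset ι)
    {A : ι → E → E →L[ℝ] E} {K : Set E} (hK : Convex ℝ K) (hA : ∀ i ∈ s, ContDiffOn ℝ 1 (A i) K)
    {i₀ : ι} (hi₀ : i₀ ∈ s) (hA₀ : ∀ z ∈ K, A i₀ z = ContinuousLinearMap.id ℝ E) :
    Dense {c : ι → E →L[ℝ] F | ∀ z ∈ K, ∑ i ∈ s, c i ∘L A i z ≠ 0} := by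
  classical
  intro c
  let Ψ : E → E →L[ℝ] F := fun z => -∑ i ∈ s.erase i₀, c i ∘L A i z
  have hΨ : ContDiffOn ℝ 1 Ψ K := (ContDiffOn.sum fun i hi =>
    contDiffOn_const.clm_comp (hA i (Finset.mem_of_mem_erase hi))).neg
  have hdense : Dense (Ψ '' K)ᶜ := by
    refine hΨ.dense_compl_image_of_dimH_lt_finrank hK subset_rfl ?_
    refine (dimH_mono (Set.subset_univ K)).trans_lt ?_
    rw [Real.dimH_univ_eq_finrank, ← LinearMap.toContinuousLinearMap.finrank_eq,
      Module.finrank_linearMap]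
    exact_mod_cast lt_mul_of_one_lt_right Module.finrank_pos hF
  have hmem := map_mem_closure (continuous_const.update i₀ continuous_id) (hdense (c i₀))
    (f := fun l => Function.update c i₀ l)
    (t := {c : ι → E →L[ℝ] F | ∀ z ∈ K, ∑ i ∈ s, c i ∘L A i z ≠ 0})
    (fun l hl z hz h0 => hl ⟨z, hz, ?_⟩)
  · rwa [Function.update_eq_self] at hmem
  · beta_reduce at h0
    rw [← Finset.add_sum_erase _ _ hi₀, Function.update_self, hA₀ z hz,
      ContinuousLinearMap.comp_id, Finset.sum_congr rfl fun i hi => by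
        rw [Function.update_of_ne (Finset.ne_of_mem_erase hi)]] at h0
    exact (eq_neg_of_add_eq_zero_left h0).symm

theorem exists_mem_nhds_isOpen_dense_setOf_sum_fderiv_ne_zero {ι E F : Type*}
    [NormedAddCommGroup E] [NormedSpace ℝ E] [FiniteDimensional ℝ E] [Nontrivial E]
    [NormedAddCommGroup F] [NormedSpace ℝ F] [FiniteDimensional ℝ F]
    (hF : 1 < Module.finrank ℝ F) (s : Finset ι) {g : ι → E → E} {z₀ : E}
    (hg : ∀ i ∈ s, ContDiffAt ℝ 2 (g i) z₀) {i₀ : ι} (hi₀ : i₀ ∈ s) (hg₀ : g i₀ =ᶠ[𝓝 z₀] id) :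
    ∃ K ∈ 𝓝 z₀, IsOpen {c : ι → E →L[ℝ] F | ∀ z ∈ K, ∑ i ∈ s, c i ∘L fderiv ℝ (g i) z ≠ 0} ∧
      Dense {c : ι → E →L[ℝ] F | ∀ z ∈ K, ∑ i ∈ s, c i ∘L fderiv ℝ (g i) z ≠ 0} := by
  have hsmooth : ∀ᶠ z in 𝓝 z₀, ∀ i ∈ s, ContDiffAt ℝ 1 (fderiv ℝ (g i)) z :=
    s.eventually_all.2 fun i hi => ((hg i hi).fderiv_right le_rfl).eventually (by simp)
  have hid : ∀ᶠ z in 𝓝 z₀, fderiv ℝ (g i₀) z = ContinuousLinearMap.id ℝ E := by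
    filter_upwards [hg₀.fderiv (𝕜 := ℝ)] with z hz
    rw [hz, fderiv_id]
  obtain ⟨r, hr, hball⟩ := nhds_basis_closedBall.eventually_iff.1 (hsmooth.and hid)
  refine ⟨closedBall z₀ r, closedBall_mem_nhds z₀ hr,
    isOpen_setOf_forall_sum_comp_ne_zero s (isCompact_closedBall z₀ r) fun i hi z hz =>
      ((hball hz).1 i hi).continuousAt.continuousWithinAt,
    dense_setOf_forall_sum_comp_ne_zero hF s (convex_closedBall z₀ r)
      (fun i hi z hz => ((hball hz).1 i hi).contDiffWithinAt) hi₀ fun z hz => (hball hz).2⟩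

variable {E : Type*} {M : Type u} [NormedAddCommGroup E] [NormedSpace ℝ E] [TopologicalSpace M]
    [ChartedSpace E M]

theorem contMDiff_finsum_clm_comp {ι F : Type*} [NormedAddCommGroup F] [NormedSpace ℝ F]
    {ψ : ι → M → E} (hψ : ∀ i, ContMDiff 𝓘(ℝ, E) 𝓘(ℝ, E) ∞ (ψ i))
    (hfin : LocallyFinite fun i => Function.support (ψ i)) (c : ι → E →L[ℝ] F) :
    ContMDiff 𝓘(ℝ, E) 𝓘(ℝ, F) ∞ fun z => ∑ᶠ i, c i (ψ i z) :=
  contMDiff_finsum (fun i => (c i).contMDiff.comp (hψ i))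
    (hfin.subset fun i => Function.support_comp_subset (map_zero (c i)) _)

variable [IsManifold 𝓘(ℝ, E) ∞ M]

theorem contDiffAt_comp_extChartAt_symm {F : Type*} [NormedAddCommGroup F] [NormedSpace ℝ F]
    {f : M → F} {p y : M} (hf : ContMDiffAt 𝓘(ℝ, E) 𝓘(ℝ, F) ∞ f y)
    (hy : y ∈ (extChartAt 𝓘(ℝ, E) p).source) :
    ContDiffAt ℝ ∞ (f ∘ (extChartAt 𝓘(ℝ, E) p).symm) (extChartAt 𝓘(ℝ, E) p y) := by
  rw [extChartAt_source] at hy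
  have h := (contMDiffAt_iff_source_of_mem_source hy).1 hf
  rwa [modelWithCornersSelf_coe, Set.range_id, contMDiffWithinAt_univ,
    contMDiffAt_iff_contDiffAt] at h

theorem fderiv_comp_extChartAt_symm_eq_zero {F : Type*} [NormedAddCommGroup F] [NormedSpace ℝ F]
    {f : M → F} {p y : M} (hf : MDifferentiableAt 𝓘(ℝ, E) 𝓘(ℝ, F) f y)
    (hy : y ∈ (extChartAt 𝓘(ℝ, E) p).source) (h0 : mvfderiv 𝓘(ℝ, E) f y = 0) :
    fderiv ℝ (f ∘ (extChartAt 𝓘(ℝ, E) p).symm) (extChartAt 𝓘(ℝ, E) p y) = 0 := by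
  have hsymm : MDifferentiableAt 𝓘(ℝ, E) 𝓘(ℝ, E) (extChartAt 𝓘(ℝ, E) p).symm
      (extChartAt 𝓘(ℝ, E) p y) :=
    ((contMDiffOn_extChartAt_symm (n := ∞) p).contMDiffAt
      ((isOpen_extChartAt_target p).mem_nhds (PartialEquiv.map_source _ hy))).mdifferentiableAt
        (by simp)
  have h0' : mfderiv 𝓘(ℝ, E) 𝓘(ℝ, F) f y = 0 := h0
  rw [← mfderiv_eq_fderiv, mfderiv_comp_of_eq hf hsymm (PartialEquiv.left_inv _ hy),
    PartialEquiv.left_inv _ hy, h0']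
  exact ContinuousLinearMap.zero_comp _

variable [FiniteDimensional ℝ E]

theorem exists_mem_nhds_isOpen_dense_mvfderiv_finsum_ne_zero [Nontrivial E] {ι F : Type*}
    [NormedAddCommGroup F] [NormedSpace ℝ F] [FiniteDimensional ℝ F] (hF : 1 < Module.finrank ℝ F)
    {ψ : ι → M → E} (hψ : ∀ i, ContMDiff 𝓘(ℝ, E) 𝓘(ℝ, E) ∞ (ψ i))
    (hfin : LocallyFinite fun i => Function.support (ψ i)) {i₀ : ι} {p x : M}
    (hx : x ∈ (extChartAt 𝓘(ℝ, E) p).source) (hψi₀ : ψ i₀ =ᶠ[𝓝 x] extChartAt 𝓘(ℝ, E) p) :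
    ∃ N ∈ 𝓝 x, ∃ U : Set (ι → E →L[ℝ] F), IsOpen U ∧ Dense U ∧
      ∀ c ∈ U, ∀ y ∈ N, mvfderiv 𝓘(ℝ, E) (fun z => ∑ᶠ i, c i (ψ i z)) y ≠ 0 := by
  obtain ⟨s, hi₀, hsum⟩ := exists_finset_eventually_finsum_clm_eq_sum (F := F) hfin i₀ x
  set χ := extChartAt 𝓘(ℝ, E) p
  obtain ⟨K, hK, hUo, hUd⟩ := exists_mem_nhds_isOpen_dense_setOf_sum_fderiv_ne_zero hF s
    (fun i _ => (contDiffAt_comp_extChartAt_symm (hψ i x) hx).of_le ENat.LEInfty.out)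
    hi₀ (comp_extChartAt_symm_eventuallyEq_id hx hψi₀)
  refine ⟨_, Filter.inter_mem (Filter.inter_mem (extChartAt_source_mem_nhds' hx)
    ((continuousAt_extChartAt' hx).preimage_mem_nhds hK)) hsum.eventually_nhds, _, hUo, hUd, ?_⟩
  rintro c hc y ⟨⟨hys, hyK⟩, hyV : ∀ᶠ z in 𝓝 y, _⟩ h0
  have hψy (i : ι) : DifferentiableAt ℝ (ψ i ∘ χ.symm) (χ y) :=
    (contDiffAt_comp_extChartAt_symm (hψ i y) hys).differentiableAt (by simp)
  have heq : (fun z => ∑ᶠ i, c i (ψ i z)) ∘ χ.symm =ᶠ[𝓝 (χ y)]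
      fun w => ∑ i ∈ s, c i ((ψ i ∘ χ.symm) w) := by
    rw [← χ.left_inv hys] at hyV
    filter_upwards [(continuousAt_extChartAt_symm' hys).eventually hyV] with w hw using hw c
  have hderiv : HasFDerivAt (fun w => ∑ i ∈ s, c i ((ψ i ∘ χ.symm) w))
      (∑ i ∈ s, c i ∘L fderiv ℝ (ψ i ∘ χ.symm) (χ y)) (χ y) :=
    HasFDerivAt.fun_sum fun i _ => (c i).hasFDerivAt.comp _ (hψy i).hasFDerivAt
  refine hc (χ y) hyK ?_
  rw [← hderiv.fderiv, ← heq.fderiv_eq]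
  exact fderiv_comp_extChartAt_symm_eq_zero
    ((contMDiff_finsum_clm_comp hψ hfin c y).mdifferentiableAt (by simp)) hys h0

variable (E M) [T2Space M] [SecondCountableTopology M]

theorem exists_countable_locallyFinite_extChartAt :
    ∃ (ι : Type u) (_ : Countable ι) (ψ : ι → M → E), (∀ i, ContMDiff 𝓘(ℝ, E) 𝓘(ℝ, E) ∞ (ψ i)) ∧
      (LocallyFinite fun i => Function.support (ψ i)) ∧
      ∀ x, ∃ i p, x ∈ (extChartAt 𝓘(ℝ, E) p).source ∧ ψ i =ᶠ[𝓝 x] extChartAt 𝓘(ℝ, E) p := by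
  have := ChartedSpace.locallyCompactSpace E M
  obtain ⟨ι, fs, -⟩ := SmoothBumpCovering.exists_isSubordinate 𝓘(ℝ, E) (isClosed_univ (X := M))
    (U := fun _ => Set.univ) (fun _ _ => Filter.univ_mem)
  refine ⟨ι, Set.countable_univ_iff.1 (fs.locallyFinite.countable_univ fun i =>
    (fs i).nonempty_support), fun i x => fs i x • extChartAt 𝓘(ℝ, E) (fs.c i) x,
    fun i => (fs i).contMDiff_smul contMDiffOn_extChartAt, ?_, fun x => ?_⟩
  · exact fs.locallyFinite.subset fun i => Function.support_smul_subset_left _ _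
  · refine ⟨fs.ind x trivial, _, fs.mem_extChartAt_ind_source x trivial, ?_⟩
    filter_upwards [fs.eventuallyEq_one x trivial] with y hy
    rw [hy, Pi.one_apply, one_smul]

/- A generic locally finite combination of the charts has no critical point: by Baire, since every
point has a neighbourhood on which an open dense set of coefficients will do. -/
theorem exists_contMDiffMap_forall_mvfderiv_ne_zero [Nontrivial E] {F : Type*}
    [NormedAddCommGroup F] [NormedSpace ℝ F] [FiniteDimensional ℝ F]
    (hF : 1 < Module.finrank ℝ F) :
    ∃ H : C^∞⟮𝓘(ℝ, E), M; 𝓘(ℝ, F), F⟯, ∀ x, mvfderiv 𝓘(ℝ, E) H x ≠ 0 := by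
  obtain ⟨ι, _, ψ, hψ, hfin, hchart⟩ := exists_countable_locallyFinite_extChartAt E M
  choose i p hp hψp using hchart
  choose N hN U hUo hUd hU using fun x =>
    exists_mem_nhds_isOpen_dense_mvfderiv_finsum_ne_zero hF hψ hfin (hp x) (hψp x)
  obtain ⟨s, hs, hsN⟩ := TopologicalSpace.countable_cover_nhds hN
  obtain ⟨c, hc⟩ :=
    (dense_biInter_of_isOpen (fun x _ => hUo x) hs fun x _ => hUd x).nonempty
  refine ⟨⟨fun z => ∑ᶠ i, c i (ψ i z), contMDiff_finsum_clm_comp hψ hfin c⟩, fun y => ?_⟩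
  obtain ⟨x, hx, hyx⟩ := Set.mem_iUnion₂.1 (hsN.ge (Set.mem_univ y))
  exact hU x c (Set.mem_iInter₂.1 hc x hx) y hyx

theorem exists_pair_forall_exists_mvfderiv_ne_zero [Nontrivial E] :
    ∃ h : Fin 2 → C^∞⟮𝓘(ℝ, E), M; ℝ⟯, ∀ x, ∃ j, mvfderiv 𝓘(ℝ, E) (h j) x ≠ 0 := by
  obtain ⟨H, hH⟩ := exists_contMDiffMap_forall_mvfderiv_ne_zero E M (F := Fin 2 → ℝ) (by simp)
  let p (j : Fin 2) : (Fin 2 → ℝ) →L[ℝ] ℝ := ContinuousLinearMap.proj j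
  refine ⟨fun j => ⟨p j ∘ H, (p j).contMDiff.comp H.contMDiff⟩, fun x => ?_⟩
  by_contra! h0
  refine hH x (ContinuousLinearMap.ext fun v => funext fun j => ?_)
  have hd := mvfderiv_clm_comp (p j) ((H.contMDiff x).mdifferentiableAt (by simp)) v
  exact hd.symm.trans (congrArg (fun l : E →L[ℝ] ℝ => l v) (h0 j))

end Noncritical

namespace SmoothPrincipalBundle

open Topology

variable {EM EG EP M G P : Type*}
    [NormedAddCommGroup EM] [NormedSpace ℝ EM] [NormedAddCommGroup EG] [NormedSpace ℝ EG]
    [NormedAddCommGroup EP] [NormedSpace ℝ EP]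
    [TopologicalSpace M] [ChartedSpace EM M]
    [TopologicalSpace G] [ChartedSpace EG G] [Group G]
    [TopologicalSpace P] [ChartedSpace EP P]
    (B : SmoothPrincipalBundle EM EG EP M G P)

section LocalTrivialization

/-- An equivariant local trivialization of a principal bundle over the open set `base`: the
witnesses of the field `exists_trivialization` of `SmoothPrincipalBundle`, bundled. -/
structure LocalTrivialization where
  base : Set M
  e : OpenPartialHomeomorph P (M × G)
  isOpen_base : IsOpen base
  source_eq : e.source = B.proj ⁻¹' base
  target_eq : e.target = base ×ˢ Set.univ
  contMDiffOn : ContMDiffOn 𝓘(ℝ, EP) (𝓘(ℝ, EM).prod 𝓘(ℝ, EG)) ∞ e e.source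
  contMDiffOn_symm : ContMDiffOn (𝓘(ℝ, EM).prod 𝓘(ℝ, EG)) 𝓘(ℝ, EP) ∞ e.symm e.target
  fst_apply : ∀ u ∈ e.source, (e u).1 = B.proj u
  apply_act : ∀ u ∈ e.source, ∀ g, e (B.act u g) = (B.proj u, (e u).2 * g)

theorem exists_localTrivialization (m : M) : ∃ t : B.LocalTrivialization, m ∈ t.base := by
  obtain ⟨U, e, hU, hm, hs, ht, he, he', hfst, hact⟩ := B.exists_trivialization m
  exact ⟨⟨U, e, hU, hs, ht, he, he', hfst, hact⟩, hm⟩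

namespace LocalTrivialization

variable {B} (t : B.LocalTrivialization)

/-- The point of `P` with coordinates `x` and `g`; a junk value for `x` outside of the base. -/
def pt (x : M) (g : G) : P := t.e.symm (x, g)

theorem mem_target {x : M} (hx : x ∈ t.base) (g : G) : (x, g) ∈ t.e.target := by
  rw [t.target_eq]
  exact ⟨hx, trivial⟩

theorem mem_source {u : P} : u ∈ t.e.source ↔ B.proj u ∈ t.base := by
  rw [t.source_eq, Set.mem_preimage]

theorem pt_mem_source {x : M} (hx : x ∈ t.base) (g : G) : t.pt x g ∈ t.e.source :=
  t.e.map_target (t.mem_target hx g)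

theorem apply_pt {x : M} (hx : x ∈ t.base) (g : G) : t.e (t.pt x g) = (x, g) :=
  t.e.right_inv (t.mem_target hx g)

theorem proj_pt {x : M} (hx : x ∈ t.base) (g : G) : B.proj (t.pt x g) = x := by
  rw [← t.fst_apply _ (t.pt_mem_source hx g), t.apply_pt hx]

theorem pt_proj {u : P} (hu : B.proj u ∈ t.base) : t.pt (B.proj u) (t.e u).2 = u := by
  have hus := t.mem_source.2 hu
  rw [pt, ← t.fst_apply u hus, t.e.left_inv hus]

theorem act_pt {x : M} (hx : x ∈ t.base) (g h : G) : B.act (t.pt x g) h = t.pt x (g * h) := by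
  have hact : B.proj (B.act (t.pt x g) h) ∈ t.base := by rwa [B.proj_act, t.proj_pt hx]
  rw [← t.pt_proj hact, t.apply_act _ (t.pt_mem_source hx g), t.apply_pt hx, B.proj_act,
    t.proj_pt hx]

theorem contMDiffAt_pt {x : M} (hx : x ∈ t.base) (g : G) :
    ContMDiffAt (𝓘(ℝ, EM).prod 𝓘(ℝ, EG)) 𝓘(ℝ, EP) ∞ (fun p : M × G => t.pt p.1 p.2) (x, g) :=
  t.contMDiffOn_symm.contMDiffAt (t.e.open_target.mem_nhds (t.mem_target hx g))

theorem contMDiffAt_snd_apply {u : P} (hu : B.proj u ∈ t.base) :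
    ContMDiffAt 𝓘(ℝ, EP) 𝓘(ℝ, EG) ∞ (fun w => (t.e w).2) u :=
  _root_.contMDiffAt_snd.comp u (t.contMDiffOn.contMDiffAt
    (t.e.open_source.mem_nhds (t.mem_source.2 hu)))

end LocalTrivialization

theorem exists_act_eq {u w : P} (h : B.proj u = B.proj w) : ∃ g, B.act u g = w := by
  obtain ⟨t, ht⟩ := B.exists_localTrivialization (B.proj u)
  refine ⟨(t.e u).2⁻¹ * (t.e w).2, ?_⟩
  have hw : B.proj w ∈ t.base := h ▸ ht
  have hact := t.act_pt ht (t.e u).2 ((t.e u).2⁻¹ * (t.e w).2)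
  rwa [t.pt_proj ht, mul_inv_cancel_left, h, t.pt_proj hw] at hact

theorem proj_surjective : Function.Surjective B.proj := fun m => by
  obtain ⟨t, ht⟩ := B.exists_localTrivialization m
  exact ⟨t.pt m 1, t.proj_pt ht 1⟩

end LocalTrivialization

section LieRinehart

theorem contMDiff_comp_proj (f : C^∞⟮𝓘(ℝ, EM), M; ℝ⟯) :
    ContMDiff 𝓘(ℝ, EP) 𝓘(ℝ, ℝ) ∞ (f ∘ B.proj) :=
  f.contMDiff.comp B.contMDiff_proj

theorem mdifferentiableAt_comp_proj (f : C^∞⟮𝓘(ℝ, EM), M; ℝ⟯) (u : P) :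
    MDifferentiableAt 𝓘(ℝ, EP) 𝓘(ℝ, ℝ) (f ∘ B.proj) u :=
  (B.contMDiff_comp_proj f u).mdifferentiableAt (by simp)

variable {B} in
theorem contMDiffMap_ext_proj {f g : C^∞⟮𝓘(ℝ, EM), M; ℝ⟯}
    (h : ∀ u, f (B.proj u) = g (B.proj u)) : f = g :=
  ContMDiffMap.ext (B.proj_surjective.forall.2 h)

variable [IsManifold 𝓘(ℝ, EM) ∞ M] [IsManifold 𝓘(ℝ, EP) ∞ P] [CompleteSpace EP]

noncomputable instance : SMul C^∞⟮𝓘(ℝ, EM), M; ℝ⟯ B.atiyahAlgebra where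
  smul f a := ⟨⟨fun u => f (B.proj u) • a.1 u,
      (B.contMDiff_comp_proj f).smul_section a.1.contMDiff⟩,
    fun g u => by
      change mfderiv 𝓘(ℝ, EP) 𝓘(ℝ, EP) (B.rightTranslation g) u (f (B.proj u) • a.1 u) =
        f (B.proj (B.rightTranslation g u)) • a.1 (B.rightTranslation g u)
      rw [← a.2 g u, show B.proj (B.rightTranslation g u) = B.proj u from B.proj_act u g]
      exact map_smul _ _ _⟩

theorem smul_apply (f : C^∞⟮𝓘(ℝ, EM), M; ℝ⟯) (a : B.atiyahAlgebra) (u : P) :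
    (f • a).1 u = f (B.proj u) • a.1 u := rfl

theorem add_apply (a b : B.atiyahAlgebra) (u : P) : (a + b).1 u = a.1 u + b.1 u := rfl

variable {B} in
theorem atiyahAlgebra_ext {a b : B.atiyahAlgebra} (h : ∀ u, a.1 u = b.1 u) : a = b :=
  Subtype.ext (ContMDiffSection.ext h)

noncomputable instance : Module C^∞⟮𝓘(ℝ, EM), M; ℝ⟯ B.atiyahAlgebra where
  one_smul a := atiyahAlgebra_ext fun u => one_smul ℝ (a.1 u)
  mul_smul f g a := atiyahAlgebra_ext fun u => mul_smul (f (B.proj u)) (g (B.proj u)) (a.1 u)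
  smul_zero f := atiyahAlgebra_ext fun u => smul_zero (f (B.proj u))
  smul_add f a b := atiyahAlgebra_ext fun u => smul_add (f (B.proj u)) (a.1 u) (b.1 u)
  add_smul f g a := atiyahAlgebra_ext fun u => add_smul (f (B.proj u)) (g (B.proj u)) (a.1 u)
  zero_smul a := atiyahAlgebra_ext fun u => zero_smul ℝ (a.1 u)

/-- The derivative of a smooth function on `M` along the anchor of a section, computed at an
arbitrary point of the fibre. -/
noncomputable def anchorDeriv (a : B.atiyahAlgebra) (f : C^∞⟮𝓘(ℝ, EM), M; ℝ⟯) (m : M) : ℝ :=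
  mvfderiv 𝓘(ℝ, EP) (f ∘ B.proj) (Function.surjInv B.proj_surjective m)
    (a.1 (Function.surjInv B.proj_surjective m))

theorem anchorDeriv_proj (a : B.atiyahAlgebra) (f : C^∞⟮𝓘(ℝ, EM), M; ℝ⟯) (u : P) :
    B.anchorDeriv a f (B.proj u) = mvfderiv 𝓘(ℝ, EP) (f ∘ B.proj) u (a.1 u) := by
  obtain ⟨g, hg⟩ := B.exists_act_eq (Function.surjInv_eq B.proj_surjective (B.proj u)).symm
  rw [anchorDeriv, ← hg]
  exact B.mvfderiv_comp_proj_act a.2 u g ((f.contMDiff _).mdifferentiableAt (by simp))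

theorem contMDiff_anchorDeriv (a : B.atiyahAlgebra) (f : C^∞⟮𝓘(ℝ, EM), M; ℝ⟯) :
    ContMDiff 𝓘(ℝ, EM) 𝓘(ℝ, ℝ) ∞ (B.anchorDeriv a f) := by
  intro m
  obtain ⟨t, ht⟩ := B.exists_localTrivialization m
  have hsection : ContMDiffAt 𝓘(ℝ, EM) 𝓘(ℝ, EP) ∞ (fun x => t.pt x 1) m :=
    (t.contMDiffAt_pt ht 1).comp m (contMDiffAt_id.prodMk contMDiffAt_const)
  have hderiv := SmoothVectorField.contMDiffAt_mvfderiv_apply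
    ((B.contMDiff_comp_proj f) (t.pt m 1)) a.1
  refine (hderiv.comp m hsection).congr_of_eventuallyEq ?_
  filter_upwards [t.isOpen_base.mem_nhds ht] with x hx
  conv_lhs => rw [← t.proj_pt hx 1]
  exact B.anchorDeriv_proj a f _

noncomputable instance : Bracket B.atiyahAlgebra C^∞⟮𝓘(ℝ, EM), M; ℝ⟯ where
  bracket a f := ⟨B.anchorDeriv a f, B.contMDiff_anchorDeriv a f⟩

theorem lie_apply_proj (a : B.atiyahAlgebra) (f : C^∞⟮𝓘(ℝ, EM), M; ℝ⟯) (u : P) :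
    ⁅a, f⁆ (B.proj u) = mvfderiv 𝓘(ℝ, EP) (f ∘ B.proj) u (a.1 u) :=
  B.anchorDeriv_proj a f u

theorem lie_comp_proj (a : B.atiyahAlgebra) (f : C^∞⟮𝓘(ℝ, EM), M; ℝ⟯) :
    (⁅a, f⁆ : C^∞⟮𝓘(ℝ, EM), M; ℝ⟯) ∘ B.proj = fun u => mvfderiv 𝓘(ℝ, EP) (f ∘ B.proj) u (a.1 u) :=
  funext (B.lie_apply_proj a f)

theorem lie_apply_proj_eq_mvfderiv (a : B.atiyahAlgebra) (f : C^∞⟮𝓘(ℝ, EM), M; ℝ⟯) (u : P) :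
    ⁅a, f⁆ (B.proj u) = mvfderiv 𝓘(ℝ, EM) f (B.proj u)
      (mfderiv 𝓘(ℝ, EP) 𝓘(ℝ, EM) B.proj u (a.1 u)) := by
  rw [lie_apply_proj, mvfderiv_comp u ((f.contMDiff _).mdifferentiableAt (by simp))
    (B.mdifferentiableAt_proj u), ContinuousLinearMap.comp_apply]

noncomputable instance : LieRingModule B.atiyahAlgebra C^∞⟮𝓘(ℝ, EM), M; ℝ⟯ where
  add_lie a b f := contMDiffMap_ext_proj (B := B) fun u => by
    rw [ContMDiffMap.coe_add, Pi.add_apply]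
    simp only [lie_apply_proj, add_apply, map_add]
  lie_add a f g := contMDiffMap_ext_proj (B := B) fun u => by
    rw [ContMDiffMap.coe_add, Pi.add_apply]
    simp only [lie_apply_proj]
    exact congrArg (fun l => l (a.1 u)) (mvfderiv_add (I := 𝓘(ℝ, EP))
      (B.mdifferentiableAt_comp_proj f u) (B.mdifferentiableAt_comp_proj g u))
  leibniz_lie a b f := contMDiffMap_ext_proj (B := B) fun u => by
    rw [ContMDiffMap.coe_add, Pi.add_apply]
    simp only [lie_apply_proj, lie_comp_proj]
    rw [← sub_eq_iff_eq_add]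
    exact (SmoothVectorField.mvfderiv_bracket (B.contMDiff_comp_proj f u) a.1 b.1).symm

instance : LieRinehartRing C^∞⟮𝓘(ℝ, EM), M; ℝ⟯ B.atiyahAlgebra where
  lie_smul_eq_mul' f g a := contMDiffMap_ext_proj (B := B) fun u => by
    rw [ContMDiffMap.coe_mul, Pi.mul_apply]
    simp only [lie_apply_proj, smul_apply, map_smul, smul_eq_mul]
  leibniz_mul_right' a f g := contMDiffMap_ext_proj (B := B) fun u => by
    rw [smul_eq_mul, mul_comm ⁅a, f⁆, ContMDiffMap.coe_add, Pi.add_apply, ContMDiffMap.coe_mul,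
      ContMDiffMap.coe_mul, Pi.mul_apply, Pi.mul_apply]
    simp only [lie_apply_proj]
    exact congrArg (fun l => l (a.1 u)) (mvfderiv_mul (I := 𝓘(ℝ, EP))
      (B.mdifferentiableAt_comp_proj f u) (B.mdifferentiableAt_comp_proj g u))
  leibniz_smul_right' a b f := atiyahAlgebra_ext fun u => by
    rw [add_apply, smul_apply, smul_apply, lie_apply_proj, add_comm]
    exact mlieBracket_smul_right (B.mdifferentiableAt_comp_proj f u) (b.1.mdifferentiableAt u)

instance : LieRinehartAlgebra ℝ C^∞⟮𝓘(ℝ, EM), M; ℝ⟯ B.atiyahAlgebra where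
  smul_assoc c f a := atiyahAlgebra_ext fun u => smul_assoc c (f (B.proj u)) (a.1 u)
  smul_lie c a f := contMDiffMap_ext_proj (B := B) fun u => by
    rw [ContMDiffMap.coe_smul, Pi.smul_apply, lie_apply_proj, lie_apply_proj]
    exact map_smul _ c (a.1 u)
  lie_smul c a f := contMDiffMap_ext_proj (B := B) fun u => by
    rw [ContMDiffMap.coe_smul, Pi.smul_apply]
    simp only [lie_apply_proj]
    exact congrArg (fun l => l (a.1 u)) (const_smul_mfderiv (I := 𝓘(ℝ, EP))
      (B.mdifferentiableAt_comp_proj f u) c)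

end LieRinehart

end SmoothPrincipalBundle

section ParametricDerivative

open Topology

variable {E E' N P : Type*} [NormedAddCommGroup E] [NormedSpace ℝ E] [NormedAddCommGroup E']
    [NormedSpace ℝ E'] [TopologicalSpace P] [ChartedSpace E P] [IsManifold 𝓘(ℝ, E) ∞ P]
    [TopologicalSpace N] [ChartedSpace E' N] [IsManifold 𝓘(ℝ, E') ∞ N]

theorem contMDiffAt_mfderiv_of_deformation {F : P → N → P} {y₀ : N} {u₀ : P}
    (hF : ContMDiffAt (𝓘(ℝ, E).prod 𝓘(ℝ, E')) 𝓘(ℝ, E) ∞ (Function.uncurry F) (u₀, y₀))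
    (hid : ∀ᶠ u in 𝓝 u₀, F u y₀ = u) (w : TangentSpace 𝓘(ℝ, E') y₀) :
    ContMDiffAt 𝓘(ℝ, E) (𝓘(ℝ, E).prod 𝓘(ℝ, E)) ∞ (fun u => (Bundle.TotalSpace.mk' E u
      (mfderiv 𝓘(ℝ, E') 𝓘(ℝ, E) (F u) y₀ w) : TangentBundle 𝓘(ℝ, E) P)) u₀ := by
  have hderiv := ContMDiffAt.mfderiv (m := ∞) F (fun _ => y₀) hF contMDiffAt_const (by simp)
  have hbase : ContMDiffAt 𝓘(ℝ, E) 𝓘(ℝ, E) ∞ (fun u => F u y₀) u₀ :=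
    contMDiffAt_id.congr_of_eventuallyEq hid
  have hconst : ContMDiffAt 𝓘(ℝ, E) (𝓘(ℝ, E').prod 𝓘(ℝ, E')) ∞
      (fun _ : P => (Bundle.TotalSpace.mk' E' y₀ w : TangentBundle 𝓘(ℝ, E') N)) u₀ :=
    contMDiffAt_const
  refine (ContMDiffAt.clm_apply_of_inCoordinates (n := ∞) (E₁ := TangentSpace 𝓘(ℝ, E'))
    (E₂ := TangentSpace 𝓘(ℝ, E)) (ϕ := fun u => mfderiv 𝓘(ℝ, E') 𝓘(ℝ, E) (F u) y₀)
    (v := fun _ => w) (b₁ := fun _ => y₀) (b₂ := fun u => F u y₀)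
    hderiv hconst hbase).congr_of_eventuallyEq ?_
  have hmk (x y : P) (hxy : x = y) (v : E) : (Bundle.TotalSpace.mk' E x v :
      TangentBundle 𝓘(ℝ, E) P) = Bundle.TotalSpace.mk' E y v := by
    subst hxy; rfl
  filter_upwards [hid] with u hu
  exact hmk _ _ hu.symm _

end ParametricDerivative

namespace SmoothPrincipalBundle

open Topology

variable {EM EG EP M G P : Type*}
    [NormedAddCommGroup EM] [NormedSpace ℝ EM] [NormedAddCommGroup EG] [NormedSpace ℝ EG]
    [NormedAddCommGroup EP] [NormedSpace ℝ EP]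
    [TopologicalSpace M] [ChartedSpace EM M] [IsManifold 𝓘(ℝ, EM) ∞ M]
    [TopologicalSpace G] [ChartedSpace EG G] [Group G]
    [TopologicalSpace P] [ChartedSpace EP P] [IsManifold 𝓘(ℝ, EP) ∞ P]
    {B : SmoothPrincipalBundle EM EG EP M G P} [CompleteSpace EP]

section Membership

theorem mem_vanishingAt_iff {a : B.atiyahAlgebra} {m : M} {u : P} (hu : B.proj u = m) :
    a ∈ B.vanishingAt m ↔ a.1 u = 0 := by
  refine ⟨fun h => congrFun (congrArg Subtype.val (h : B.value m a = 0)) ⟨u, hu⟩, fun h => ?_⟩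
  refine Subtype.ext (funext fun w => ?_)
  obtain ⟨g, hg⟩ := B.exists_act_eq (hu.trans w.2.symm)
  have hinv := a.2 g u
  rw [h] at hinv
  change a.1 w.1 = 0
  rw [← hg]
  exact hinv.symm.trans (map_zero _)

theorem mem_anchorVanishingAt_iff {a : B.atiyahAlgebra} {m : M} {u : P} (hu : B.proj u = m) :
    a ∈ B.anchorVanishingAt m ↔ mfderiv 𝓘(ℝ, EP) 𝓘(ℝ, EM) B.proj u (a.1 u) = 0 := by
  refine ⟨fun h => (h : B.value m a ∈ B.kernelFiber m) ⟨u, hu⟩, ?_⟩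
  rintro h ⟨w, hw⟩
  obtain ⟨g, rfl⟩ := B.exists_act_eq (hu.trans hw.symm)
  have hc : B.proj ∘ B.rightTranslation g = B.proj := funext fun y => B.proj_act y g
  have hchain := mfderiv_comp_apply (I := 𝓘(ℝ, EP)) (I' := 𝓘(ℝ, EP)) (I'' := 𝓘(ℝ, EM)) u
    (B.mdifferentiableAt_proj (B.rightTranslation g u))
    (B.mdifferentiableAt_rightTranslation g u) (a.1 u)
  rw [hc, a.2 g u] at hchain
  exact hchain.symm.trans h

theorem mem_kernel_iff {a : B.atiyahAlgebra} :
    a ∈ B.kernel ↔ ∀ u, mfderiv 𝓘(ℝ, EP) 𝓘(ℝ, EM) B.proj u (a.1 u) = 0 :=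
  ⟨fun h u => h (B.proj u) ⟨u, rfl⟩, fun h _ u => h u.1⟩

theorem mem_kernelVanishingAt_iff {k : B.kernel} {m : M} :
    k ∈ B.kernelVanishingAt m ↔ k.1 ∈ B.vanishingAt m := Iff.rfl

theorem mem_anchorVanishingAt_iff_forall_lie [FiniteDimensional ℝ EM] [T2Space M]
    {a : B.atiyahAlgebra} {m : M} :
    a ∈ B.anchorVanishingAt m ↔ ∀ f : C^∞⟮𝓘(ℝ, EM), M; ℝ⟯, ⁅a, f⁆ m = 0 := by
  obtain ⟨u, rfl⟩ := B.proj_surjective m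
  simp only [mem_anchorVanishingAt_iff rfl, lie_apply_proj_eq_mvfderiv]
  refine ⟨fun h f => by rw [h, map_zero], fun h => ?_⟩
  by_contra h0
  obtain ⟨f, hf⟩ := exists_contMDiffMap_mvfderiv_ne_zero h0
  exact hf (h f)

theorem vanishingAt_le_anchorVanishingAt (m : M) : B.vanishingAt m ≤ B.anchorVanishingAt m := by
  obtain ⟨u, hu⟩ := B.proj_surjective m
  intro a ha
  rw [mem_vanishingAt_iff hu] at ha
  rw [mem_anchorVanishingAt_iff hu, ha]
  exact map_zero _

theorem cofg_anchorVanishingAt [FiniteDimensional ℝ EM] (m : M) :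
    (B.anchorVanishingAt m).toSubmodule.CoFG := by
  obtain ⟨u, hu⟩ := B.proj_surjective m
  let anchorAt : B.atiyahAlgebra →ₗ[ℝ] EM :=
    { toFun := fun a => mfderiv 𝓘(ℝ, EP) 𝓘(ℝ, EM) B.proj u (a.1 u)
      map_add' := fun a b => map_add (mfderiv 𝓘(ℝ, EP) 𝓘(ℝ, EM) B.proj u) (a.1 u) (b.1 u)
      map_smul' := fun c a => map_smul (mfderiv 𝓘(ℝ, EP) 𝓘(ℝ, EM) B.proj u) c (a.1 u) }
  exact Submodule.CoFG.of_le (S := LinearMap.ker anchorAt)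
    (fun a ha => (mem_anchorVanishingAt_iff hu).2 ha) (Submodule.CoFG.ker anchorAt)

end Membership

section KernelModule

theorem lie_eq_zero_of_mem_kernel {a : B.atiyahAlgebra} (ha : a ∈ B.kernel)
    (f : C^∞⟮𝓘(ℝ, EM), M; ℝ⟯) : ⁅a, f⁆ = 0 :=
  contMDiffMap_ext_proj (B := B) fun u => by
    rw [lie_apply_proj_eq_mvfderiv, mem_kernel_iff.1 ha u, map_zero, ContMDiffMap.coe_zero,
      Pi.zero_apply]

theorem smul_mem_kernel (f : C^∞⟮𝓘(ℝ, EM), M; ℝ⟯) {a : B.atiyahAlgebra} (ha : a ∈ B.kernel) :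
    f • a ∈ B.kernel := by
  rw [mem_kernel_iff] at *
  intro u
  rw [smul_apply]
  refine (map_smul _ (f (B.proj u)) (a.1 u)).trans ?_
  rw [ha u, smul_zero]

noncomputable instance : SMul C^∞⟮𝓘(ℝ, EM), M; ℝ⟯ B.kernel where
  smul f k := ⟨f • k.1, smul_mem_kernel f k.2⟩

theorem coe_smul_kernel (f : C^∞⟮𝓘(ℝ, EM), M; ℝ⟯) (k : B.kernel) :
    ((f • k : B.kernel) : B.atiyahAlgebra) = f • (k : B.atiyahAlgebra) := rfl

noncomputable instance : Module C^∞⟮𝓘(ℝ, EM), M; ℝ⟯ B.kernel :=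
  Function.Injective.module _ (B.kernel.toSubmodule.subtype.toAddMonoidHom)
    Subtype.val_injective (fun _ _ => rfl)

instance : IsScalarTower ℝ C^∞⟮𝓘(ℝ, EM), M; ℝ⟯ B.kernel where
  smul_assoc c f k := Subtype.ext (smul_assoc c f (k : B.atiyahAlgebra))

theorem lie_smul_kernel (a : B.atiyahAlgebra) (f : C^∞⟮𝓘(ℝ, EM), M; ℝ⟯) (k : B.kernel) :
    ⁅a, f • k⁆ = f • ⁅a, k⁆ + ⁅a, f⁆ • k :=
  Subtype.ext (LieRinehartRing.leibniz_smul_right a k.1 f)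

theorem smul_lie_kernel (f : C^∞⟮𝓘(ℝ, EM), M; ℝ⟯) (a : B.atiyahAlgebra) (k : B.kernel) :
    ⁅f • a, k⁆ = f • ⁅a, k⁆ :=
  Subtype.ext <| (smul_lie_eq_sub f a k.1).trans <| by
    rw [lie_eq_zero_of_mem_kernel k.2, zero_smul, sub_zero]
    rfl

noncomputable instance : LieAlgebra C^∞⟮𝓘(ℝ, EM), M; ℝ⟯ B.kernel where
  lie_smul f k l := Subtype.ext <| (LieRinehartRing.leibniz_smul_right k.1 l.1 f).trans <| by
    rw [lie_eq_zero_of_mem_kernel k.2, zero_smul, add_zero]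
    rfl

end KernelModule

section InvariantFields

variable {EN N : Type*} [NormedAddCommGroup EN] [NormedSpace ℝ EN] [TopologicalSpace N]
    [ChartedSpace EN N]

omit [CompleteSpace EP] in
theorem mfderiv_deformation_act {F : P → N → P} {y₀ : N} {u : P} {g : G}
    (hF : MDifferentiableAt 𝓘(ℝ, EN) 𝓘(ℝ, EP) (F u) y₀) (hid : F u y₀ = u)
    (hact : ∀ᶠ y in 𝓝 y₀, F (B.act u g) y = B.act (F u y) g) (w : TangentSpace 𝓘(ℝ, EN) y₀) :
    (mfderiv 𝓘(ℝ, EN) 𝓘(ℝ, EP) (F (B.act u g)) y₀ w : EP) =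
      mfderiv 𝓘(ℝ, EP) 𝓘(ℝ, EP) (B.rightTranslation g) u
        (mfderiv 𝓘(ℝ, EN) 𝓘(ℝ, EP) (F u) y₀ w : EP) := by
  have hev : F (B.act u g) =ᶠ[𝓝 y₀] B.rightTranslation g ∘ F u := hact
  exact (congrArg (fun l : EN →L[ℝ] EP => l w) hev.mfderiv_eq).trans
    (mfderiv_comp_apply_of_eq _ (B.mdifferentiableAt_rightTranslation g u) hF hid w)

variable [IsManifold 𝓘(ℝ, EN) ∞ N]

/- The velocity field of an equivariant deformation of the identity is invariant; the cutoff `χ`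
extends it from the part of `P` over `O` to all of `P`. -/
theorem exists_atiyahAlgebra_eq_smul_mfderiv {O : Set M} (hO : IsOpen O) {F : P → N → P} {y₀ : N}
    (hF : ∀ u, B.proj u ∈ O →
      ContMDiffAt (𝓘(ℝ, EP).prod 𝓘(ℝ, EN)) 𝓘(ℝ, EP) ∞ (Function.uncurry F) (u, y₀))
    (hid : ∀ u, B.proj u ∈ O → F u y₀ = u)
    (hact : ∀ u, B.proj u ∈ O → ∀ g, ∀ᶠ y in 𝓝 y₀, F (B.act u g) y = B.act (F u y) g)
    (w : TangentSpace 𝓘(ℝ, EN) y₀) {χ : C^∞⟮𝓘(ℝ, EM), M; ℝ⟯} (hχ : tsupport χ ⊆ O) :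
    ∃ a : B.atiyahAlgebra, ∀ u,
      a.1 u = χ (B.proj u) • (mfderiv 𝓘(ℝ, EN) 𝓘(ℝ, EP) (F u) y₀ w : EP) := by
  have hO' : IsOpen (B.proj ⁻¹' O) := hO.preimage B.contMDiff_proj.continuous
  let velocity : ∀ u : P, TangentSpace 𝓘(ℝ, EP) u := fun u =>
    (mfderiv 𝓘(ℝ, EN) 𝓘(ℝ, EP) (F u) y₀ w : EP)
  have hvelocity : ContMDiffOn 𝓘(ℝ, EP) (𝓘(ℝ, EP).prod 𝓘(ℝ, EP)) ∞
      (fun u => (velocity u : TangentBundle 𝓘(ℝ, EP) P)) (B.proj ⁻¹' O) := fun u hu =>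
    (contMDiffAt_mfderiv_of_deformation (hF u hu)
      (Filter.eventually_of_mem (hO'.mem_nhds hu) hid) w).contMDiffWithinAt
  have hsupp : tsupport (χ ∘ B.proj) ⊆ B.proj ⁻¹' O :=
    (tsupport_comp_subset_preimage χ B.contMDiff_proj.continuous).trans (Set.preimage_mono hχ)
  refine ⟨⟨⟨(χ ∘ B.proj) • velocity, ContMDiffOn.smul_section_of_tsupport
    (B.contMDiff_comp_proj χ).contMDiffOn hO' hsupp hvelocity⟩, fun g u => ?_⟩, fun u => rfl⟩
  change mfderiv 𝓘(ℝ, EP) 𝓘(ℝ, EP) (B.rightTranslation g) u (χ (B.proj u) • velocity u) =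
    χ (B.proj (B.act u g)) • velocity (B.act u g)
  rw [B.proj_act]
  refine (map_smul _ _ _).trans ?_
  by_cases hu : B.proj u ∈ O
  · have hFu : ContMDiffAt 𝓘(ℝ, EN) 𝓘(ℝ, EP) ∞ (Function.uncurry F ∘ fun y => (u, y)) y₀ :=
      (hF u hu).comp y₀ (contMDiffAt_const.prodMk contMDiffAt_id)
    exact congrArg _ (mfderiv_deformation_act (hFu.mdifferentiableAt (by simp)) (hid u hu)
      (hact u hu g) w).symm
  · rw [image_eq_zero_of_notMem_tsupport fun h => hu (hχ h)]
    exact (zero_smul ℝ _).trans (zero_smul ℝ _).symm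

end InvariantFields

end SmoothPrincipalBundle

namespace SmoothPrincipalBundle

open Topology

variable {EM EG EP M G P : Type*}
    [NormedAddCommGroup EM] [NormedSpace ℝ EM] [NormedAddCommGroup EG] [NormedSpace ℝ EG]
    [NormedAddCommGroup EP] [NormedSpace ℝ EP]
    [TopologicalSpace M] [ChartedSpace EM M]
    [TopologicalSpace G] [ChartedSpace EG G] [Group G]
    [TopologicalSpace P] [ChartedSpace EP P]
    {B : SmoothPrincipalBundle EM EG EP M G P}

section Shift

namespace LocalTrivialization

variable (t : B.LocalTrivialization) (m : M)

/-- The point over `proj u + v`, the sum being taken in the chart of `M` at `m`, with the same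
`G`-coordinate as `u`; junk unless `proj u` is in the domains of both charts and `v` is small. -/
noncomputable def shift (u : P) (v : EM) : P :=
  t.pt ((extChartAt 𝓘(ℝ, EM) m).symm (extChartAt 𝓘(ℝ, EM) m (B.proj u) + v)) (t.e u).2

variable {t m} {u : P}

theorem shift_zero (hu : B.proj u ∈ t.base ∩ (extChartAt 𝓘(ℝ, EM) m).source) :
    t.shift m u 0 = u := by
  rw [shift, add_zero, (extChartAt 𝓘(ℝ, EM) m).left_inv hu.2, t.pt_proj hu.1]

theorem eventually_symm_add_mem_base
    (hu : B.proj u ∈ t.base ∩ (extChartAt 𝓘(ℝ, EM) m).source) :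
    ∀ᶠ v in 𝓝 (0 : EM), (extChartAt 𝓘(ℝ, EM) m).symm (extChartAt 𝓘(ℝ, EM) m (B.proj u) + v) ∈
      t.base := by
  have hcont : ContinuousAt (fun v : EM =>
      (extChartAt 𝓘(ℝ, EM) m).symm (extChartAt 𝓘(ℝ, EM) m (B.proj u) + v)) 0 := by
    refine ContinuousAt.comp (g := (extChartAt 𝓘(ℝ, EM) m).symm) ?_
      (continuousAt_const.add continuousAt_id)
    rw [add_zero]
    exact continuousAt_extChartAt_symm' hu.2
  refine hcont.eventually_mem (t.isOpen_base.mem_nhds ?_)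
  rw [add_zero, (extChartAt 𝓘(ℝ, EM) m).left_inv hu.2]
  exact hu.1

theorem eventually_shift_act (hu : B.proj u ∈ t.base ∩ (extChartAt 𝓘(ℝ, EM) m).source) (g : G) :
    ∀ᶠ v in 𝓝 (0 : EM), t.shift m (B.act u g) v = B.act (t.shift m u v) g := by
  filter_upwards [eventually_symm_add_mem_base hu] with v hv
  rw [shift, shift, t.act_pt hv, B.proj_act, t.apply_act u (t.mem_source.2 hu.1)]

theorem eventually_proj_shift (hu : B.proj u ∈ t.base ∩ (extChartAt 𝓘(ℝ, EM) m).source) :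
    ∀ᶠ v in 𝓝 (0 : EM), B.proj (t.shift m u v) =
      (extChartAt 𝓘(ℝ, EM) m).symm (extChartAt 𝓘(ℝ, EM) m (B.proj u) + v) := by
  filter_upwards [eventually_symm_add_mem_base hu] with v hv using t.proj_pt hv _

variable [IsManifold 𝓘(ℝ, EM) ∞ M]

theorem contMDiffAt_uncurry_shift
    (hu : B.proj u ∈ t.base ∩ (extChartAt 𝓘(ℝ, EM) m).source) :
    ContMDiffAt (𝓘(ℝ, EP).prod 𝓘(ℝ, EM)) 𝓘(ℝ, EP) ∞ (Function.uncurry (t.shift m)) (u, 0) := by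
  let χ := extChartAt 𝓘(ℝ, EM) m
  have hχ : ContMDiffAt 𝓘(ℝ, EM) 𝓘(ℝ, EM) ∞ χ (B.proj u) :=
    contMDiffAt_extChartAt' (by rw [← extChartAt_source 𝓘(ℝ, EM)]; exact hu.2)
  have hsymm : ContMDiffAt 𝓘(ℝ, EM) 𝓘(ℝ, EM) ∞ χ.symm (χ (B.proj u)) :=
    (contMDiffOn_extChartAt_symm m).contMDiffAt
      ((isOpen_extChartAt_target m).mem_nhds (χ.map_source hu.2))
  have hadd : ContMDiffAt (𝓘(ℝ, EP).prod 𝓘(ℝ, EM)) 𝓘(ℝ, EM) ∞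
      (fun p : P × EM => χ (B.proj p.1) + p.2) (u, 0) :=
    ((hχ.comp u (B.contMDiff_proj u)).comp (u, (0 : EM)) contMDiffAt_fst).add contMDiffAt_snd
  have hbase : ContMDiffAt (𝓘(ℝ, EP).prod 𝓘(ℝ, EM)) 𝓘(ℝ, EM) ∞
      (fun p : P × EM => χ.symm (χ (B.proj p.1) + p.2)) (u, 0) := by
    refine ContMDiffAt.comp (u, (0 : EM)) ?_ hadd
    rwa [add_zero]
  have hfibre : ContMDiffAt (𝓘(ℝ, EP).prod 𝓘(ℝ, EM)) 𝓘(ℝ, EG) ∞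
      (fun p : P × EM => (t.e p.1).2) (u, 0) :=
    ContMDiffAt.comp (u, (0 : EM)) (g := fun w => (t.e w).2) (t.contMDiffAt_snd_apply hu.1)
      contMDiffAt_fst
  refine ContMDiffAt.comp (u, (0 : EM)) (g := fun p : M × G => t.pt p.1 p.2) ?_
    (hbase.prodMk hfibre)
  simp only [add_zero, χ.left_inv hu.2]
  exact t.contMDiffAt_pt hu.1 _

theorem mfderiv_proj_mfderiv_shift [IsManifold 𝓘(ℝ, EP) ∞ P] (ht : B.proj u ∈ t.base)
    (v : TangentSpace 𝓘(ℝ, EM) (B.proj u)) :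
    mfderiv 𝓘(ℝ, EP) 𝓘(ℝ, EM) B.proj u (mfderiv 𝓘(ℝ, EM) 𝓘(ℝ, EP) (t.shift (B.proj u) u) 0
      (mfderiv 𝓘(ℝ, EM) 𝓘(ℝ, EM) (extChartAt 𝓘(ℝ, EM) (B.proj u)) (B.proj u) v : EM) : EP) =
      v := by
  let χ := extChartAt 𝓘(ℝ, EM) (B.proj u)
  have hu : B.proj u ∈ t.base ∩ χ.source := ⟨ht, mem_extChartAt_source (B.proj u)⟩
  let w : EM := mfderiv 𝓘(ℝ, EM) 𝓘(ℝ, EM) χ (B.proj u) v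
  have hshift : MDifferentiableAt 𝓘(ℝ, EM) 𝓘(ℝ, EP) (t.shift (B.proj u) u) 0 :=
    (ContMDiffAt.comp (0 : EM) (contMDiffAt_uncurry_shift hu)
      (contMDiffAt_const.prodMk contMDiffAt_id)).mdifferentiableAt (by simp)
  have hsymm : MDifferentiableAt 𝓘(ℝ, EM) 𝓘(ℝ, EM) χ.symm (χ (B.proj u)) :=
    ((contMDiffOn_extChartAt_symm (n := ∞) (B.proj u)).contMDiffAt
      ((isOpen_extChartAt_target _).mem_nhds (χ.map_source hu.2))).mdifferentiableAt (by simp)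
  have hadd : HasMFDerivAt 𝓘(ℝ, EM) 𝓘(ℝ, EM) (fun v : EM => χ (B.proj u) + v) 0
      (ContinuousLinearMap.id ℝ EM) :=
    ((hasFDerivAt_id (0 : EM)).const_add (χ (B.proj u))).hasMFDerivAt
  have hev : B.proj ∘ t.shift (B.proj u) u =ᶠ[𝓝 0] χ.symm ∘ fun v => χ (B.proj u) + v :=
    eventually_proj_shift hu
  have hleft : mfderiv 𝓘(ℝ, EM) 𝓘(ℝ, EM) χ.symm (χ (B.proj u)) w = v := by
    have h := mfderivWithin_extChartAt_symm_comp_mfderiv_extChartAt' (I := 𝓘(ℝ, EM)) hu.2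
    rw [ModelWithCorners.range_eq_univ, mfderivWithin_univ] at h
    exact congrArg (fun l : EM →L[ℝ] EM => l v) h
  have hchain := mfderiv_comp_apply_of_eq (0 : EM) hsymm hadd.mdifferentiableAt (add_zero _) w
  rw [hadd.mfderiv] at hchain
  exact (mfderiv_comp_apply_of_eq _ (B.mdifferentiableAt_proj u) hshift
    (shift_zero hu) w).symm.trans ((congrArg (fun l : EM →L[ℝ] EM => l w) hev.mfderiv_eq).trans
      (hchain.trans hleft))

end LocalTrivialization

end Shift

variable [IsManifold 𝓘(ℝ, EM) ∞ M] [IsManifold 𝓘(ℝ, EP) ∞ P] [CompleteSpace EP]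
variable (B) [FiniteDimensional ℝ EM] [T2Space M]

section AnchorSurjective

theorem exists_mfderiv_proj_eq (u : P) (v : TangentSpace 𝓘(ℝ, EM) (B.proj u)) :
    ∃ a : B.atiyahAlgebra, mfderiv 𝓘(ℝ, EP) 𝓘(ℝ, EM) B.proj u (a.1 u) = v := by
  obtain ⟨t, ht⟩ := B.exists_localTrivialization (B.proj u)
  have hO : IsOpen (t.base ∩ (extChartAt 𝓘(ℝ, EM) (B.proj u)).source) :=
    t.isOpen_base.inter (isOpen_extChartAt_source (B.proj u))
  obtain ⟨χ, hχ, hχ1⟩ := exists_contMDiffMap_tsupport_subset_eventuallyEq_one (E := EM)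
    (hO.mem_nhds ⟨ht, mem_extChartAt_source (B.proj u)⟩)
  obtain ⟨a, ha⟩ := exists_atiyahAlgebra_eq_smul_mfderiv hO
    (fun _ => LocalTrivialization.contMDiffAt_uncurry_shift)
    (fun _ => LocalTrivialization.shift_zero)
    (fun _ hw => LocalTrivialization.eventually_shift_act hw)
    (mfderiv 𝓘(ℝ, EM) 𝓘(ℝ, EM) (extChartAt 𝓘(ℝ, EM) (B.proj u)) (B.proj u) v : EM) hχ
  refine ⟨a, ?_⟩
  rw [ha u, hχ1.eq_of_nhds]
  exact (congrArg _ (one_smul ℝ _)).trans (LocalTrivialization.mfderiv_proj_mfderiv_shift ht v)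

theorem exists_lie_apply_eq_one {f : C^∞⟮𝓘(ℝ, EM), M; ℝ⟯} {m : M}
    (hf : mvfderiv 𝓘(ℝ, EM) f m ≠ 0) : ∃ a : B.atiyahAlgebra, ⁅a, f⁆ m = 1 := by
  obtain ⟨u, rfl⟩ := B.proj_surjective m
  obtain ⟨v, hv⟩ := LinearMap.surjective
    (f := (mvfderiv 𝓘(ℝ, EM) f (B.proj u)).toLinearMap)
    (fun h => hf (ContinuousLinearMap.coe_injective h)) 1
  obtain ⟨a, rfl⟩ := B.exists_mfderiv_proj_eq u v
  exact ⟨a, (B.lie_apply_proj_eq_mvfderiv a f u).trans hv⟩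

variable {B} [Nontrivial EM]

theorem anchorVanishingAt_ne_top (m : M) : B.anchorVanishingAt m ≠ ⊤ := by
  obtain ⟨u, hu⟩ := B.proj_surjective m
  obtain ⟨v, hv⟩ := exists_ne (0 : EM)
  obtain ⟨a, ha⟩ := B.exists_mfderiv_proj_eq u v
  intro htop
  have hmem : a ∈ B.anchorVanishingAt m := htop ▸ LieSubalgebra.mem_top a
  exact hv (ha.symm.trans ((mem_anchorVanishingAt_iff hu).1 hmem))

theorem eq_of_vanishingAt_le_anchorVanishingAt {m m' : M}
    (h : B.vanishingAt m ≤ B.anchorVanishingAt m') : m = m' := by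
  by_contra hne
  obtain ⟨a, ha⟩ := SetLike.exists_not_mem_of_ne_top _ (anchorVanishingAt_ne_top (B := B) m') rfl
  obtain ⟨χ, hχ, hχ1⟩ := exists_contMDiffMap_tsupport_subset_eventuallyEq_one (E := EM)
    (isOpen_compl_singleton.mem_nhds (Ne.symm hne : m' ∈ ({m} : Set M)ᶜ))
  obtain ⟨u, hu⟩ := B.proj_surjective m
  obtain ⟨u', hu'⟩ := B.proj_surjective m'
  have hmem : χ • a ∈ B.vanishingAt m := by
    rw [mem_vanishingAt_iff hu, smul_apply, hu,
      image_eq_zero_of_notMem_tsupport fun hm => hχ hm rfl]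
    exact zero_smul ℝ _
  have hanchor := (mem_anchorVanishingAt_iff hu').1 (h hmem)
  rw [smul_apply, hu', hχ1.eq_of_nhds] at hanchor
  exact ha ((mem_anchorVanishingAt_iff hu').2 ((congrArg _ (one_smul ℝ _).symm).trans hanchor))

end AnchorSurjective

section PartitionOfUnity

variable {B} in
omit [FiniteDimensional ℝ EM] [T2Space M] in
theorem support_smul_apply_subset {ι : Type*} (ρ : ι → C^∞⟮𝓘(ℝ, EM), M; ℝ⟯)
    (a : ι → B.atiyahAlgebra) (u : P) :
    (Function.support fun i => (ρ i • a i).1 u) ⊆ {i | ρ i (B.proj u) ≠ 0} := fun i hi h0 =>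
  hi ((congrArg (· • (a i).1 u) h0).trans (zero_smul ℝ _))

omit [FiniteDimensional ℝ EM] [T2Space M] in
theorem exists_eq_finsum_smul {ι : Type*} {ρ : ι → C^∞⟮𝓘(ℝ, EM), M; ℝ⟯}
    (hρ : LocallyFinite fun i => Function.support (ρ i)) (a : ι → B.atiyahAlgebra) :
    ∃ b : B.atiyahAlgebra, ∀ u, b.1 u = ∑ᶠ i, (ρ i • a i).1 u := by
  have hsmooth := ContMDiff.finsum_section_of_locallyFinite (I := 𝓘(ℝ, EP)) (F := EP) (n := ∞)
    (V := (TangentSpace 𝓘(ℝ, EP) : P → Type _)) (t := fun i u => (ρ i • a i).1 u)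
    ((hρ.preimage_continuous B.contMDiff_proj.continuous).subset
      fun i u hu => support_smul_apply_subset ρ a u hu)
    (fun i => (ρ i • a i).1.contMDiff)
  refine ⟨⟨⟨_, hsmooth⟩, fun g u => ?_⟩, fun u => rfl⟩
  let translate : EP →L[ℝ] EP := mfderiv 𝓘(ℝ, EP) 𝓘(ℝ, EP) (B.rightTranslation g) u
  refine (translate.toLinearMap.toAddMonoidHom.map_finsum
    ((hρ.point_finite (B.proj u)).subset (support_smul_apply_subset ρ a u))).trans ?_
  exact finsum_congr fun i => (ρ i • a i).2 g u

omit [FiniteDimensional ℝ EM] [T2Space M] in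
theorem exists_forall_lie_apply_eq_finsum {ι : Type*} {ρ : ι → C^∞⟮𝓘(ℝ, EM), M; ℝ⟯}
    (hρ : LocallyFinite fun i => Function.support (ρ i)) (a : ι → B.atiyahAlgebra) :
    ∃ b : B.atiyahAlgebra, ∀ (f : C^∞⟮𝓘(ℝ, EM), M; ℝ⟯) (m : M),
      ⁅b, f⁆ m = ∑ᶠ i, ρ i m * ⁅a i, f⁆ m := by
  obtain ⟨b, hb⟩ := B.exists_eq_finsum_smul hρ a
  refine ⟨b, fun f m => ?_⟩
  obtain ⟨u, rfl⟩ := B.proj_surjective m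
  let df : EP →L[ℝ] ℝ := mvfderiv 𝓘(ℝ, EP) (f ∘ B.proj) u
  rw [lie_apply_proj, hb u]
  refine (df.toLinearMap.toAddMonoidHom.map_finsum
    ((hρ.point_finite (B.proj u)).subset (support_smul_apply_subset ρ a u))).trans ?_
  refine finsum_congr fun i => ?_
  rw [lie_apply_proj]
  exact map_smul df (ρ i (B.proj u)) ((a i).1 u)

variable [SecondCountableTopology M]

theorem exists_forall_sum_lie_apply_pos {ι : Type*} [Fintype ι] {h : ι → C^∞⟮𝓘(ℝ, EM), M; ℝ⟯}
    (hh : ∀ x, ∃ j, mvfderiv 𝓘(ℝ, EM) (h j) x ≠ 0) :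
    ∃ a : ι → B.atiyahAlgebra, ∀ m, 0 < ∑ j, ⁅a j, h j⁆ m := by
  classical
  have := ChartedSpace.locallyCompactSpace EM M
  have hlocal : ∀ x, ∃ a : ι → B.atiyahAlgebra, 0 < ∑ j, ⁅a j, h j⁆ x := fun x => by
    obtain ⟨j, hj⟩ := hh x
    obtain ⟨a, ha⟩ := B.exists_lie_apply_eq_one hj
    refine ⟨Pi.single j a, ?_⟩
    rw [Finset.sum_eq_single_of_mem j (Finset.mem_univ j) fun i _ hi => by
      rw [Pi.single_eq_of_ne hi, zero_lie, ContMDiffMap.coe_zero, Pi.zero_apply],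
      Pi.single_eq_same, ha]
    exact one_pos
  choose a ha using hlocal
  have hopen : ∀ x, IsOpen {y | 0 < ∑ j, ⁅a x j, h j⁆ y} := fun x =>
    isOpen_lt continuous_const
      (continuous_finsetSum _ fun j _ => ⁅a x j, h j⁆.contMDiff.continuous)
  obtain ⟨ρ, hρ⟩ := SmoothPartitionOfUnity.exists_isSubordinate 𝓘(ℝ, EM) isClosed_univ _ hopen
    (fun x _ => Set.mem_iUnion.2 ⟨x, ha x⟩)
  choose b hb using fun j =>
    B.exists_forall_lie_apply_eq_finsum ρ.locallyFinite (fun x => a x j)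
  refine ⟨b, fun m => ?_⟩
  have hfinite (c : M → ℝ) : (Function.support fun x => ρ x m * c x).Finite :=
    (ρ.locallyFinite.point_finite m).subset fun i hi => left_ne_zero_of_mul hi
  have hsum : ∑ j, ⁅b j, h j⁆ m = ∑ᶠ x, ρ x m * ∑ j, ⁅a x j, h j⁆ m := by
    simp only [hb, Finset.mul_sum]
    exact (finsum_sum_comm _ _ fun j _ => hfinite _).symm
  have hpos {x : M} (hx : ρ x m ≠ 0) : 0 < ∑ j, ⁅a x j, h j⁆ m := hρ x (subset_closure hx)
  obtain ⟨x, hx⟩ := ρ.exists_pos_of_mem (Set.mem_univ m)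
  rw [hsum]
  refine finsum_pos (fun y => ?_) ⟨x, mul_pos hx (hpos hx.ne')⟩ (hfinite _)
  rcases eq_or_ne (ρ y m) 0 with hy | hy
  · rw [hy, zero_mul]
  · exact mul_nonneg (ρ.nonneg y m) (hpos hy).le

theorem exists_isUnit_sum_lie_sq [Nontrivial EM] : ∃ (a : Fin 2 → B.atiyahAlgebra)
    (h : Fin 2 → C^∞⟮𝓘(ℝ, EM), M; ℝ⟯), IsUnit (∑ j, ⁅a j, h j⁆ ^ 2) := by
  obtain ⟨h, hh⟩ := exists_pair_forall_exists_mvfderiv_ne_zero EM M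
  obtain ⟨a, ha⟩ := B.exists_forall_sum_lie_apply_pos hh
  refine ⟨a, h, isUnit_of_forall_apply_ne_zero fun x hx => (ha x).ne' ?_⟩
  have hsq : ∑ j, (⁅a j, h j⁆ x) ^ 2 = 0 := by simpa [Fin.sum_univ_two] using hx
  rw [Finset.sum_eq_zero_iff_of_nonneg fun _ _ => sq_nonneg _] at hsq
  exact Finset.sum_eq_zero fun j hj => pow_eq_zero_iff two_ne_zero |>.1 (hsq j hj)

end PartitionOfUnity

section MaximalSubalgebras

variable {B} [SecondCountableTopology M] [Nontrivial EM]

theorem exists_le_anchorVanishingAt {T : LieSubalgebra ℝ B.atiyahAlgebra} (hT : T ≠ ⊤)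
    (hcofg : T.toSubmodule.CoFG) : ∃ m, T ≤ B.anchorVanishingAt m := by
  by_contra! hnot
  obtain ⟨a, h, hunit⟩ := B.exists_isUnit_sum_lie_sq
  have hU := cofg_conductorIdeal_of_lieSubalgebra a h hunit hcofg
  have htop : conductorIdeal C^∞⟮𝓘(ℝ, EM), M; ℝ⟯ T.toSubmodule = ⊤ := by
    refine eq_top_of_cofg hU fun m => ?_
    obtain ⟨b, hbT, hb⟩ := SetLike.not_le_iff_exists.1 (hnot m)
    rw [mem_anchorVanishingAt_iff_forall_lie] at hb
    push Not at hb
    obtain ⟨f, hf⟩ := hb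
    have hstable : ∀ g ∈ conductorIdeal C^∞⟮𝓘(ℝ, EM), M; ℝ⟯ T.toSubmodule,
        ⁅b, g⁆ ∈ conductorIdeal C^∞⟮𝓘(ℝ, EM), M; ℝ⟯ T.toSubmodule := fun g hg v => by
      have hlie := T.lie_mem hbT (hg v)
      rw [LieRinehartRing.leibniz_smul_right] at hlie
      simpa using T.sub_mem hlie (hg ⁅b, v⁆)
    obtain ⟨n, hn⟩ := exists_pow_derivation_mem_of_cofg hU
      (LieRinehartAlgebra.anchor ℝ C^∞⟮𝓘(ℝ, EM), M; ℝ⟯ B.atiyahAlgebra b) hstable f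
    exact ⟨_, hn, pow_ne_zero n hf⟩
  refine hT (eq_top_iff.2 fun b _ => ?_)
  have hone : (1 : C^∞⟮𝓘(ℝ, EM), M; ℝ⟯) ∈ conductorIdeal C^∞⟮𝓘(ℝ, EM), M; ℝ⟯ T.toSubmodule :=
    htop ▸ Submodule.mem_top
  simpa using hone b

theorem isMaximalFiniteCodimSubalgebra_iff {T : LieSubalgebra ℝ B.atiyahAlgebra} :
    IsMaximalFiniteCodimSubalgebra T ↔ ∃ m, T = B.anchorVanishingAt m := by
  constructor
  · intro hT
    obtain ⟨m, hm⟩ := exists_le_anchorVanishingAt hT.prop.1 hT.prop.2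
    exact ⟨m, hT.eq_of_le ⟨anchorVanishingAt_ne_top m, cofg_anchorVanishingAt m⟩ hm⟩
  · rintro ⟨m, rfl⟩
    refine ⟨⟨anchorVanishingAt_ne_top m, cofg_anchorVanishingAt m⟩, fun S hS hle => ?_⟩
    obtain ⟨m', hm'⟩ := exists_le_anchorVanishingAt hS.1 hS.2
    have : m = m' := eq_of_vanishingAt_le_anchorVanishingAt
      ((vanishingAt_le_anchorVanishingAt m).trans (hle.trans hm'))
    rwa [this]

end MaximalSubalgebras

end SmoothPrincipalBundle

section RelatedFields

open Topology

variable {E E' N P : Type*} [NormedAddCommGroup E] [NormedSpace ℝ E]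
    [NormedAddCommGroup E'] [NormedSpace ℝ E']
    [TopologicalSpace P] [ChartedSpace E P] [IsManifold 𝓘(ℝ, E) ∞ P]
    [TopologicalSpace N] [ChartedSpace E' N] [IsManifold 𝓘(ℝ, E') ∞ N]

namespace SmoothVectorField

/-- The vector fields `X'` and `X` are `j`-related: `j` maps the values of `X'` to those of `X`. -/
def IsRelated (j : N → P) (X' : SmoothVectorField E' N) (X : SmoothVectorField E P) : Prop :=
  ∀ y, X (j y) = mfderiv 𝓘(ℝ, E') 𝓘(ℝ, E) j y (X' y)

namespace IsRelated

variable {j : N → P} {X Y : SmoothVectorField E P} {X' Y' : SmoothVectorField E' N} {φ : P → ℝ}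
    {y : N}

theorem mvfderiv_comp (hX : IsRelated j X' X) (hj : MDifferentiableAt 𝓘(ℝ, E') 𝓘(ℝ, E) j y)
    (hφ : MDifferentiableAt 𝓘(ℝ, E) 𝓘(ℝ, ℝ) φ (j y)) :
    mvfderiv 𝓘(ℝ, E') (φ ∘ j) y (X' y) = mvfderiv 𝓘(ℝ, E) φ (j y) (X (j y)) := by
  rw [hX y, _root_.mvfderiv_comp y hφ hj]
  rfl

theorem mvfderiv_mvfderiv_comp (hX : IsRelated j X' X) (hY : IsRelated j Y' Y)
    (hj : ContMDiff 𝓘(ℝ, E') 𝓘(ℝ, E) ∞ j) (hφ : ContMDiffAt 𝓘(ℝ, E) 𝓘(ℝ, ℝ) ∞ φ (j y)) :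
    mvfderiv 𝓘(ℝ, E') (fun z => mvfderiv 𝓘(ℝ, E') (φ ∘ j) z (Y' z)) y (X' y) =
      mvfderiv 𝓘(ℝ, E) (fun u => mvfderiv 𝓘(ℝ, E) φ u (Y u)) (j y) (X (j y)) := by
  have hjd : MDifferentiable 𝓘(ℝ, E') 𝓘(ℝ, E) j := hj.mdifferentiable (by simp)
  have hφ' : ∀ᶠ u in 𝓝 (j y), MDifferentiableAt 𝓘(ℝ, E) 𝓘(ℝ, ℝ) φ u :=
    ((contMDiffAt_iff_contMDiffAt_nhds (n := 1) (by simp)).1 (hφ.of_le (by simp))).mono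
      fun u hu => hu.mdifferentiableAt (by simp)
  have hev : (fun z => mvfderiv 𝓘(ℝ, E') (φ ∘ j) z (Y' z)) =ᶠ[𝓝 y]
      (fun u => mvfderiv 𝓘(ℝ, E) φ u (Y u)) ∘ j :=
    (hj.continuous.continuousAt.eventually hφ').mono fun z hz => hY.mvfderiv_comp (hjd z) hz
  refine (congrArg (fun l : E' →L[ℝ] ℝ => l (X' y)) hev.mfderiv_eq).trans ?_
  exact hX.mvfderiv_comp (hjd y) ((contMDiffAt_mvfderiv_apply hφ Y).mdifferentiableAt (by simp))

theorem bracket [CompleteSpace E] [CompleteSpace E'] (hX : IsRelated j X' X) (hY : IsRelated j Y' Y)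
    (hj : ContMDiff 𝓘(ℝ, E') 𝓘(ℝ, E) ∞ j) : IsRelated j ⁅X', Y'⁆ ⁅X, Y⁆ := fun y => by
  refine eq_of_forall_mvfderiv_eq fun φ hφ => ?_
  have hcomp := congrArg (fun l : E' →L[ℝ] ℝ => l (⁅X', Y'⁆ y))
    (_root_.mvfderiv_comp y (hφ.mdifferentiableAt (by simp)) (hj.mdifferentiable (by simp) y))
  refine (mvfderiv_bracket hφ X Y).trans (.trans ?_ hcomp)
  rw [← hX.mvfderiv_mvfderiv_comp hY hj hφ, ← hY.mvfderiv_mvfderiv_comp hX hj hφ]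
  exact (mvfderiv_bracket (hφ.comp y (hj y)) X' Y').symm

end IsRelated

theorem contMDiffAt_mfderiv_apply {q : P → N} {u : P} (hq : ContMDiffAt 𝓘(ℝ, E) 𝓘(ℝ, E') ∞ q u)
    (X : SmoothVectorField E P) :
    ContMDiffAt 𝓘(ℝ, E) (𝓘(ℝ, E').prod 𝓘(ℝ, E')) ∞ (fun w => (Bundle.TotalSpace.mk' E' (q w)
      (mfderiv 𝓘(ℝ, E) 𝓘(ℝ, E') q w (X w)) : TangentBundle 𝓘(ℝ, E') N)) u :=
  ContMDiffAt.clm_apply_of_inCoordinates (n := ∞) (E₁ := TangentSpace 𝓘(ℝ, E))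
    (E₂ := TangentSpace 𝓘(ℝ, E')) (ϕ := fun w => mfderiv 𝓘(ℝ, E) 𝓘(ℝ, E') q w)
    (v := fun w => X w) (b₁ := id) (b₂ := q) (hq.mfderiv_const (m := ∞) (by simp))
    (X.contMDiff _) hq

end SmoothVectorField

omit [IsManifold 𝓘(ℝ, E) ∞ P] in
theorem contMDiffAt_of_contMDiffAt_mk_const {c : P → E'} {y₀ : N} {u : P}
    (hc : ContMDiffAt 𝓘(ℝ, E) (𝓘(ℝ, E').prod 𝓘(ℝ, E')) ∞
      (fun w => (Bundle.TotalSpace.mk' E' y₀ (c w) : TangentBundle 𝓘(ℝ, E') N)) u) :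
    ContMDiffAt 𝓘(ℝ, E) 𝓘(ℝ, E') ∞ c u :=
  (Bundle.contMDiffAt_totalSpace.1 hc).2.congr_of_eventuallyEq <| .of_forall fun w =>
    (congrArg Prod.snd
      ((tangentBundleCore 𝓘(ℝ, E') N).localTrivAt_apply_mk y₀ (c w))).symm

end RelatedFields

section LeftInvariant

variable {EG G : Type*} [NormedAddCommGroup EG] [NormedSpace ℝ EG] [TopologicalSpace G]
    [ChartedSpace EG G] [Group G] [LieGroup 𝓘(ℝ, EG) ∞ G]

/-- The left-invariant vector field of an element of the Lie algebra, bundled as a smooth vector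
field. -/
noncomputable def leftInvariantField (ξ : GroupLieAlgebra 𝓘(ℝ, EG) G) : SmoothVectorField EG G :=
  ⟨mulInvariantVectorField ξ, fun g =>
    contMDiffAt_mfderiv_of_deformation (F := fun g h : G => g * h) (y₀ := (1 : G))
      (contMDiff_mul 𝓘(ℝ, EG) ∞ (g, 1)) (Filter.Eventually.of_forall fun g => mul_one g) ξ⟩

end LeftInvariant

section Vertical

open Topology

variable {EM EG EP M G P : Type*}
    [NormedAddCommGroup EM] [NormedSpace ℝ EM] [NormedAddCommGroup EG] [NormedSpace ℝ EG]
    [NormedAddCommGroup EP] [NormedSpace ℝ EP]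
    [TopologicalSpace M] [ChartedSpace EM M] [TopologicalSpace G] [ChartedSpace EG G]
    [TopologicalSpace P] [ChartedSpace EP P]

theorem mfderiv_snd_of_mfderiv_fst_eq_zero {f : M × G → P} {p : P → M} {q : P → G} {u : P} {x : M}
    {g : G} (hx : p u = x) (hg : q u = g)
    (hf : MDifferentiableAt (𝓘(ℝ, EM).prod 𝓘(ℝ, EG)) 𝓘(ℝ, EP) f (x, g))
    (hp : MDifferentiableAt 𝓘(ℝ, EP) 𝓘(ℝ, EM) p u) (hq : MDifferentiableAt 𝓘(ℝ, EP) 𝓘(ℝ, EG) q u)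
    (hid : ∀ᶠ w in 𝓝 u, f (p w, q w) = w) {v : TangentSpace 𝓘(ℝ, EP) u}
    (hv : mfderiv 𝓘(ℝ, EP) 𝓘(ℝ, EM) p u v = 0) :
    (mfderiv 𝓘(ℝ, EG) 𝓘(ℝ, EP) (fun h => f (x, h)) g (mfderiv 𝓘(ℝ, EP) 𝓘(ℝ, EG) q u v : EG) :
      EP) = v := by
  subst hx hg
  let ξ : EG := mfderiv 𝓘(ℝ, EP) 𝓘(ℝ, EG) q u v
  have hpair : mfderiv 𝓘(ℝ, EP) (𝓘(ℝ, EM).prod 𝓘(ℝ, EG)) (fun w => (p w, q w)) u v =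
      ((0 : EM), ξ) := by
    rw [mfderiv_prodMk hp hq]
    exact Prod.ext hv rfl
  have hsplit := mfderiv_prod_eq_add_apply hf (v := ((0 : EM), ξ))
  have hzero : (mfderiv 𝓘(ℝ, EM) 𝓘(ℝ, EP) (fun z => f (z, q u)) (p u) (0 : EM) : EP) = 0 :=
    map_zero (mfderiv 𝓘(ℝ, EM) 𝓘(ℝ, EP) (fun z => f (z, q u)) (p u))
  have hchain := mfderiv_comp_apply (I' := 𝓘(ℝ, EM).prod 𝓘(ℝ, EG)) u hf (hp.prodMk hq) v
  have hev : f ∘ (fun w => (p w, q w)) =ᶠ[𝓝 u] id := hid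
  have hleft : (mfderiv 𝓘(ℝ, EP) 𝓘(ℝ, EP) (f ∘ fun w => (p w, q w)) u v : EP) = v := by
    rw [hev.mfderiv_eq, mfderiv_id]
    rfl
  rw [hpair] at hchain
  refine .trans ?_ (hchain.symm.trans hleft)
  exact ((congrArg (· + _) hzero).trans (zero_add _)).symm.trans hsplit.symm

end Vertical

namespace SmoothPrincipalBundle

namespace LocalTrivialization

open Topology

variable {EM EG EP M G P : Type*}
    [NormedAddCommGroup EM] [NormedSpace ℝ EM] [NormedAddCommGroup EG] [NormedSpace ℝ EG]
    [NormedAddCommGroup EP] [NormedSpace ℝ EP]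
    [TopologicalSpace M] [ChartedSpace EM M]
    [TopologicalSpace G] [ChartedSpace EG G] [Group G]
    [TopologicalSpace P] [ChartedSpace EP P]
    {B : SmoothPrincipalBundle EM EG EP M G P} (t : B.LocalTrivialization)

section FibreMap

/-- The inverse of the group coordinate. -/
noncomputable def invCoord (u : P) : G := (t.e u).2⁻¹

/-- The parametrization of the fibre over `x` by the inverse of the group coordinate; a junk value
for `x` outside of the base. The inverse turns the right translations of `P` into left translations
of `G`, so that left-invariant vector fields can be used. -/
noncomputable def fibreMap (x : M) (g : G) : P := t.pt x g⁻¹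

variable {t} {x : M} {u : P}

theorem proj_fibreMap (hx : x ∈ t.base) (g : G) : B.proj (t.fibreMap x g) = x :=
  t.proj_pt hx _

theorem invCoord_fibreMap (hx : x ∈ t.base) (g : G) : t.invCoord (t.fibreMap x g) = g := by
  rw [invCoord, fibreMap, t.apply_pt hx, inv_inv]

theorem fibreMap_invCoord (hu : B.proj u ∈ t.base) :
    t.fibreMap (B.proj u) (t.invCoord u) = u := by
  rw [invCoord, fibreMap, inv_inv, t.pt_proj hu]

theorem act_fibreMap (hx : x ∈ t.base) (g h : G) :
    B.act (t.fibreMap x h) g = t.fibreMap x (g⁻¹ * h) := by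
  rw [fibreMap, t.act_pt hx, fibreMap, mul_inv_rev, inv_inv]

theorem invCoord_act (hu : B.proj u ∈ t.base) (g : G) :
    t.invCoord (B.act u g) = g⁻¹ * t.invCoord u := by
  rw [invCoord, t.apply_act u (t.mem_source.2 hu), mul_inv_rev, invCoord]

variable [LieGroup 𝓘(ℝ, EG) ∞ G]

theorem contMDiffAt_invCoord (hu : B.proj u ∈ t.base) :
    ContMDiffAt 𝓘(ℝ, EP) 𝓘(ℝ, EG) ∞ t.invCoord u :=
  (t.contMDiffAt_snd_apply hu).inv

theorem contMDiffAt_uncurry_fibreMap (hx : x ∈ t.base) (g : G) :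
    ContMDiffAt (𝓘(ℝ, EM).prod 𝓘(ℝ, EG)) 𝓘(ℝ, EP) ∞ (Function.uncurry t.fibreMap) (x, g) :=
  ContMDiffAt.comp (x, g) (t.contMDiffAt_pt hx g⁻¹)
    (contMDiffAt_fst.prodMk contMDiffAt_snd.inv)

theorem contMDiff_fibreMap (hx : x ∈ t.base) :
    ContMDiff 𝓘(ℝ, EG) 𝓘(ℝ, EP) ∞ (t.fibreMap x) := fun g =>
  ContMDiffAt.comp (f := fun h => (x, h)) g (contMDiffAt_uncurry_fibreMap hx g)
    (contMDiffAt_const.prodMk contMDiffAt_id)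

theorem mdifferentiable_fibreMap (hx : x ∈ t.base) :
    MDifferentiable 𝓘(ℝ, EG) 𝓘(ℝ, EP) (t.fibreMap x) :=
  (contMDiff_fibreMap hx).mdifferentiable (by simp)

end FibreMap

section Vertical

variable [LieGroup 𝓘(ℝ, EG) ∞ G]

/-- The derivative at the unit of the parametrization of the fibre over `x`. -/
noncomputable def verticalIncl (x : M) : EG →L[ℝ] EP :=
  mfderiv 𝓘(ℝ, EG) 𝓘(ℝ, EP) (t.fibreMap x) 1

variable {t} {x : M}

theorem mfderiv_invCoord_verticalIncl (hx : x ∈ t.base) (ξ : EG) :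
    (mfderiv 𝓘(ℝ, EP) 𝓘(ℝ, EG) t.invCoord (t.fibreMap x 1) (t.verticalIncl x ξ : EP) : EG) =
      ξ := by
  have hx' : B.proj (t.fibreMap x 1) ∈ t.base := by rwa [proj_fibreMap hx]
  have hid : t.invCoord ∘ t.fibreMap x = id := funext (invCoord_fibreMap hx)
  refine (mfderiv_comp_apply (1 : G) ((contMDiffAt_invCoord hx').mdifferentiableAt (by simp))
    (mdifferentiable_fibreMap hx 1) ξ).symm.trans ?_
  rw [hid, mfderiv_id]
  rfl

variable [IsManifold 𝓘(ℝ, EM) ∞ M] [IsManifold 𝓘(ℝ, EP) ∞ P] [CompleteSpace EP]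
variable (t) in
/-- The coordinate in the Lie algebra of the vertical component of an invariant vector field, at the
point of the fibre over `x` with unit group coordinate. -/
noncomputable def verticalCoeff (a : B.atiyahAlgebra) (x : M) : EG :=
  mfderiv 𝓘(ℝ, EP) 𝓘(ℝ, EG) t.invCoord (t.fibreMap x 1) (a.1 (t.fibreMap x 1))

theorem verticalCoeff_eq (hx : x ∈ t.base) {a : B.atiyahAlgebra} {ξ : EG}
    (h : a.1 (t.fibreMap x 1) = t.verticalIncl x ξ) : t.verticalCoeff a x = ξ := by
  rw [verticalCoeff, h]
  exact mfderiv_invCoord_verticalIncl hx ξ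

theorem verticalIncl_verticalCoeff (hx : x ∈ t.base) {a : B.atiyahAlgebra}
    (ha : a ∈ B.anchorVanishingAt x) :
    t.verticalIncl x (t.verticalCoeff a x) = a.1 (t.fibreMap x 1) := by
  have hpx := proj_fibreMap hx 1
  have hx' : B.proj (t.fibreMap x 1) ∈ t.base := by rwa [hpx]
  exact mfderiv_snd_of_mfderiv_fst_eq_zero hpx (invCoord_fibreMap hx 1)
    ((contMDiffAt_uncurry_fibreMap hx 1).mdifferentiableAt (by simp))
    (B.mdifferentiableAt_proj _) ((contMDiffAt_invCoord hx').mdifferentiableAt (by simp))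
    (Filter.eventually_of_mem ((t.isOpen_base.preimage B.contMDiff_proj.continuous).mem_nhds hx')
      fun _ => fibreMap_invCoord) ((mem_anchorVanishingAt_iff hpx).1 ha)

theorem mem_vanishingAt_iff_verticalCoeff_eq_zero (hx : x ∈ t.base) {a : B.atiyahAlgebra}
    (ha : a ∈ B.anchorVanishingAt x) : a ∈ B.vanishingAt x ↔ t.verticalCoeff a x = 0 := by
  rw [mem_vanishingAt_iff (proj_fibreMap hx 1), ← verticalIncl_verticalCoeff hx ha]
  refine ⟨fun h => ?_, fun h => by rw [h]; exact map_zero _⟩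
  rw [← mfderiv_invCoord_verticalIncl hx (t.verticalCoeff a x), h]
  exact map_zero _

theorem isRelated_leftInvariantField (hx : x ∈ t.base) {a : B.atiyahAlgebra}
    (ha : a ∈ B.anchorVanishingAt x) :
    SmoothVectorField.IsRelated (t.fibreMap x)
      (leftInvariantField (G := G) (t.verticalCoeff a x)) a.1 := fun g => by
  have hact : B.rightTranslation g⁻¹ ∘ t.fibreMap x = t.fibreMap x ∘ fun h => g * h :=
    funext fun h => (act_fibreMap hx g⁻¹ h).trans (by rw [inv_inv]; rfl)
  have hg : B.rightTranslation g⁻¹ (t.fibreMap x 1) = t.fibreMap x g :=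
    (congrFun hact 1).trans (congrArg (t.fibreMap x) (mul_one g))
  have hright := mfderiv_comp_apply (1 : G)
    (B.mdifferentiableAt_rightTranslation g⁻¹ (t.fibreMap x 1)) (mdifferentiable_fibreMap hx 1)
    (t.verticalCoeff a x)
  have hleft := mfderiv_comp_apply_of_eq (1 : G) (mdifferentiable_fibreMap hx g)
    ((contMDiff_mul_left (I := 𝓘(ℝ, EG)) (n := ∞) (a := g) 1).mdifferentiableAt (by simp))
    (mul_one g) (t.verticalCoeff a x)
  refine (congrArg (fun u => (a.1 u : EP)) hg).symm.trans ((a.2 g⁻¹ (t.fibreMap x 1)).symm.trans ?_)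
  rw [hact] at hright
  exact (congrArg (mfderiv 𝓘(ℝ, EP) 𝓘(ℝ, EP) (B.rightTranslation g⁻¹) (t.fibreMap x 1))
    (verticalIncl_verticalCoeff hx ha).symm).trans (hright.symm.trans hleft)

theorem verticalCoeff_lie [CompleteSpace EG] (hx : x ∈ t.base) {a b : B.atiyahAlgebra}
    (ha : a ∈ B.anchorVanishingAt x) (hb : b ∈ B.anchorVanishingAt x) :
    t.verticalCoeff ⁅a, b⁆ x = Bracket.bracket (L := GroupLieAlgebra 𝓘(ℝ, EG) G)
      (M := GroupLieAlgebra 𝓘(ℝ, EG) G) (t.verticalCoeff a x) (t.verticalCoeff b x) :=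
  verticalCoeff_eq hx ((isRelated_leftInvariantField hx ha).bracket
    (isRelated_leftInvariantField hx hb) (contMDiff_fibreMap hx) 1)

theorem contMDiffAt_verticalCoeff (a : B.atiyahAlgebra) (hx : x ∈ t.base) :
    ContMDiffAt 𝓘(ℝ, EM) 𝓘(ℝ, EG) ∞ (t.verticalCoeff a) x := by
  have hx' : B.proj (t.fibreMap x 1) ∈ t.base := by rwa [proj_fibreMap hx]
  have hσ : ContMDiffAt 𝓘(ℝ, EM) 𝓘(ℝ, EP) ∞ (fun y => t.fibreMap y 1) x :=
    ContMDiffAt.comp (f := fun y => (y, (1 : G))) x (contMDiffAt_uncurry_fibreMap hx 1)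
      (contMDiffAt_id.prodMk contMDiffAt_const)
  refine contMDiffAt_of_contMDiffAt_mk_const (y₀ := (1 : G)) <| (ContMDiffAt.comp x
    (SmoothVectorField.contMDiffAt_mfderiv_apply (contMDiffAt_invCoord hx') a.1)
    hσ).congr_of_eventuallyEq ?_
  filter_upwards [t.isOpen_base.mem_nhds hx] with y hy
  exact congrArg (fun g => (Bundle.TotalSpace.mk' EG g (t.verticalCoeff a y) :
    TangentBundle 𝓘(ℝ, EG) G)) (invCoord_fibreMap hy 1).symm

end Vertical

section FibreTranslate

/-- The point of the fibre through `u` whose inverted group coordinate is that of `u` multiplied by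
`h` on the right; a junk value for `u` outside of the trivialization. -/
noncomputable def fibreTranslate (u : P) (h : G) : P := t.fibreMap (B.proj u) (t.invCoord u * h)

variable {t} {x : M} {u : P}

theorem fibreTranslate_one (hu : B.proj u ∈ t.base) : t.fibreTranslate u 1 = u := by
  rw [fibreTranslate, mul_one, fibreMap_invCoord hu]

theorem proj_fibreTranslate (hu : B.proj u ∈ t.base) (h : G) :
    B.proj (t.fibreTranslate u h) = B.proj u :=
  proj_fibreMap hu _

theorem fibreTranslate_act (hu : B.proj u ∈ t.base) (g h : G) :
    t.fibreTranslate (B.act u g) h = B.act (t.fibreTranslate u h) g := by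
  rw [fibreTranslate, fibreTranslate, act_fibreMap hu, invCoord_act hu, B.proj_act, mul_assoc]

theorem fibreTranslate_fibreMap_one (hx : x ∈ t.base) :
    t.fibreTranslate (t.fibreMap x 1) = t.fibreMap x := funext fun h => by
  rw [fibreTranslate, proj_fibreMap hx, invCoord_fibreMap hx, one_mul]

variable [LieGroup 𝓘(ℝ, EG) ∞ G]

theorem contMDiffAt_uncurry_fibreTranslate (hu : B.proj u ∈ t.base) (h : G) :
    ContMDiffAt (𝓘(ℝ, EP).prod 𝓘(ℝ, EG)) 𝓘(ℝ, EP) ∞ (Function.uncurry t.fibreTranslate) (u, h) :=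
  ContMDiffAt.comp (g := Function.uncurry t.fibreMap) (u, h) (contMDiffAt_uncurry_fibreMap hu _)
    (((B.contMDiff_proj u).comp (u, h) contMDiffAt_fst).prodMk
      (((contMDiffAt_invCoord hu).comp (u, h) contMDiffAt_fst).mul contMDiffAt_snd))

theorem mfderiv_proj_mfderiv_fibreTranslate [IsManifold 𝓘(ℝ, EM) ∞ M] [IsManifold 𝓘(ℝ, EP) ∞ P]
    (hu : B.proj u ∈ t.base) (ξ : EG) :
    mfderiv 𝓘(ℝ, EP) 𝓘(ℝ, EM) B.proj u
      (mfderiv 𝓘(ℝ, EG) 𝓘(ℝ, EP) (t.fibreTranslate u) 1 ξ : EP) = 0 := by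
  have hdiff : MDifferentiableAt 𝓘(ℝ, EG) 𝓘(ℝ, EP) (t.fibreTranslate u) 1 :=
    (ContMDiffAt.comp (1 : G) (contMDiffAt_uncurry_fibreTranslate hu 1)
      (contMDiffAt_const.prodMk contMDiffAt_id)).mdifferentiableAt (by simp)
  have hconst : B.proj ∘ t.fibreTranslate u = fun _ => B.proj u :=
    funext (proj_fibreTranslate hu)
  have hchain := mfderiv_comp_apply_of_eq (1 : G) (B.mdifferentiableAt_proj u) hdiff
    (fibreTranslate_one hu) ξ
  rw [hconst, mfderiv_const] at hchain
  exact hchain.symm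

variable [IsManifold 𝓘(ℝ, EM) ∞ M] [IsManifold 𝓘(ℝ, EP) ∞ P] [CompleteSpace EP]

theorem exists_kernel_eq_verticalIncl (ξ : EG) {χ : C^∞⟮𝓘(ℝ, EM), M; ℝ⟯}
    (hχ : tsupport χ ⊆ t.base) :
    ∃ k : B.kernel, ∀ x ∈ t.base, k.1.1 (t.fibreMap x 1) = χ x • t.verticalIncl x ξ := by
  obtain ⟨a, ha⟩ := exists_atiyahAlgebra_eq_smul_mfderiv t.isOpen_base
    (fun _ hu => contMDiffAt_uncurry_fibreTranslate hu (1 : G)) (fun _ => fibreTranslate_one)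
    (fun _ hu g => .of_forall (fibreTranslate_act hu g)) ξ hχ
  refine ⟨⟨a, mem_kernel_iff.2 fun u => ?_⟩, fun x hx => (ha _).trans ?_⟩
  · rw [ha]
    refine (map_smul _ _ _).trans ?_
    by_cases hu : B.proj u ∈ t.base
    · exact (congrArg (fun v : TangentSpace 𝓘(ℝ, EM) (B.proj u) => χ (B.proj u) • v)
        (mfderiv_proj_mfderiv_fibreTranslate hu ξ)).trans (smul_zero _)
    · rw [image_eq_zero_of_notMem_tsupport fun h => hu (hχ h)]
      exact zero_smul ℝ _
  · rw [fibreTranslate_fibreMap_one hx, proj_fibreMap hx]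
    rfl

end FibreTranslate

end LocalTrivialization

end SmoothPrincipalBundle

section MaximalIdeals

variable {R K L : Type*} [CommRing R] [LieRing K] [LieAlgebra R K] [LieRing L] [LieAlgebra R L]
    {θ : K →ₗ⁅R⁆ L}

theorem isCoatom_lieIdeal_comap (hθ : Function.Surjective θ) {J : LieIdeal R L}
    (hJ : IsCoatom J) : IsCoatom (J.comap θ) := by
  refine ⟨fun h => hJ.1 (eq_top_iff.2 fun y _ => ?_), fun I hI => ?_⟩
  · obtain ⟨x, rfl⟩ := hθ y
    exact LieIdeal.mem_comap.1 (h ▸ LieSubmodule.mem_top x)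
  · have hker : θ.ker ≤ I :=
      le_trans (fun x hx => LieIdeal.mem_comap.2 ((LieHom.mem_ker.1 hx).symm ▸ zero_mem J)) hI.le
    have hcomap : (I.map θ).comap θ = I := by
      rw [LieIdeal.comap_map_eq (congrArg SetLike.coe (I.coe_map_of_surjective hθ)),
        sup_eq_left.2 hker]
    have hJI : J < I.map θ := by
      refine lt_of_le_not_ge (fun y hy => ?_) fun h => hI.not_ge (LieIdeal.map_le_iff_le_comap.1 h)
      obtain ⟨x, rfl⟩ := hθ y
      exact LieIdeal.mem_map (hI.le (LieIdeal.mem_comap.2 hy))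
    rw [← hcomap, hJ.2 _ hJI]
    exact eq_top_iff.2 fun x _ => LieIdeal.mem_comap.2 (LieSubmodule.mem_top _)

theorem isMaximalFiniteCodimIdeal_comap {K L : Type*} [LieRing K] [LieAlgebra ℝ K] [LieRing L]
    [LieAlgebra ℝ L] [FiniteDimensional ℝ L] {θ : K →ₗ⁅ℝ⁆ L} (hθ : Function.Surjective θ)
    {J : LieIdeal ℝ L} (hJ : IsCoatom J) : IsMaximalFiniteCodimIdeal (J.comap θ) := by
  have hcofg : (J.comap θ).toSubmodule.CoFG :=
    cofg_comap (J := J.toSubmodule) (inferInstance : FiniteDimensional ℝ (L ⧸ J.toSubmodule))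
      (θ : K →ₗ[ℝ] L)
  have hcoatom := isCoatom_lieIdeal_comap hθ hJ
  exact ⟨⟨hcoatom.1, hcofg⟩, fun _ hI hle => ((hcoatom.le_iff.1 hle).resolve_left hI.1).le⟩

theorem mem_normalizedIntersection_iff {L : Type*} [LieRing L] [LieAlgebra ℝ L] {K : LieIdeal ℝ L}
    {T : LieSubalgebra ℝ L} {k : K} : k ∈ normalizedIntersection K T ↔
    ∀ J : LieIdeal ℝ K, IsMaximalFiniteCodimIdeal J → IsNormalizedBy J T → k ∈ J := by
  simp only [normalizedIntersection, LieSubmodule.sInf_toSubmodule_eq_iInf, Submodule.mem_iInf,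
    Set.mem_ofPred_eq, and_imp, LieSubmodule.mem_toSubmodule]

theorem eq_zero_of_forall_lie_eq_zero [LieAlgebra.HasTrivialRadical R L] {x : L}
    (h : ∀ y : L, ⁅x, y⁆ = 0) : x = 0 := by
  have hcenter : x ∈ LieAlgebra.center R L := by
    rw [LieModule.mem_maxTrivSubmodule]
    intro y
    rw [← lie_skew, h, neg_zero]
  rwa [LieAlgebra.center_eq_bot, LieSubmodule.mem_bot] at hcenter

end MaximalIdeals

namespace SmoothPrincipalBundle

open Topology

variable {EM EG EP M G P : Type*}
    [NormedAddCommGroup EM] [NormedSpace ℝ EM] [NormedAddCommGroup EG] [NormedSpace ℝ EG]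
    [NormedAddCommGroup EP] [NormedSpace ℝ EP]
    [TopologicalSpace M] [ChartedSpace EM M] [IsManifold 𝓘(ℝ, EM) ∞ M]
    [TopologicalSpace G] [ChartedSpace EG G] [Group G]
    [TopologicalSpace P] [ChartedSpace EP P] [IsManifold 𝓘(ℝ, EP) ∞ P]
    {B : SmoothPrincipalBundle EM EG EP M G P} [CompleteSpace EP] {m : M}

section Kernel

theorem coe_kernel_mem_anchorVanishingAt (k : B.kernel) (m : M) : k.1 ∈ B.anchorVanishingAt m :=
  k.2 m

theorem smul_mem_kernelVanishingAt {f : C^∞⟮𝓘(ℝ, EM), M; ℝ⟯} (hf : f m = 0) (k : B.kernel) :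
    f • k ∈ B.kernelVanishingAt m := by
  obtain ⟨u, rfl⟩ := B.proj_surjective m
  rw [mem_kernelVanishingAt_iff, mem_vanishingAt_iff rfl, coe_smul_kernel, smul_apply, hf]
  exact zero_smul ℝ _

theorem kernel_eq_zero_of_forall_mem_kernelVanishingAt {k : B.kernel}
    (h : ∀ x, k ∈ B.kernelVanishingAt x) : k = 0 :=
  Subtype.ext (atiyahAlgebra_ext fun u => (mem_vanishingAt_iff rfl).1 (h (B.proj u)))

end Kernel

theorem exists_eq_vanishingAt_iff_maximal [FiniteDimensional ℝ EM] [T2Space M] [Nontrivial EM]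
    {A₀ : LieSubalgebra ℝ B.atiyahAlgebra} :
    (∃ m : M, A₀ = B.vanishingAt m) ↔
      Maximal (fun S : LieSubalgebra ℝ B.atiyahAlgebra => ∃ m : M, S ≤ B.vanishingAt m) A₀ := by
  constructor
  · rintro ⟨m, rfl⟩
    refine ⟨⟨m, le_rfl⟩, fun S ⟨m', hm'⟩ hS => ?_⟩
    obtain rfl := eq_of_vanishingAt_le_anchorVanishingAt
      ((hS.trans hm').trans (vanishingAt_le_anchorVanishingAt m'))
    exact hm'
  · rintro ⟨⟨m, hm⟩, hmax⟩
    exact ⟨m, le_antisymm hm (hmax ⟨m, le_rfl⟩ hm)⟩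

section Conductor

variable [FiniteDimensional ℝ EM] [T2Space M] [SecondCountableTopology M] [Nontrivial EM]
    {J : LieIdeal ℝ B.kernel}

theorem cofg_conductorIdeal_of_isNormalizedBy (hJ : J.toSubmodule.CoFG)
    (hn : IsNormalizedBy J (B.anchorVanishingAt m)) :
    ((conductorIdeal C^∞⟮𝓘(ℝ, EM), M; ℝ⟯ J.toSubmodule).restrictScalars ℝ).CoFG := by
  obtain ⟨a, h, hunit⟩ := B.exists_isUnit_sum_lie_sq
  exact cofg_conductorIdeal_of_forall_lie_mem lie_smul_kernel smul_lie_kernel a h hunit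
    (cofg_anchorVanishingAt m) hJ hn

theorem exists_mem_conductorIdeal_apply_ne_zero (hJ : J.toSubmodule.CoFG)
    (hn : IsNormalizedBy J (B.anchorVanishingAt m)) {x : M} (hx : x ≠ m) :
    ∃ f ∈ conductorIdeal C^∞⟮𝓘(ℝ, EM), M; ℝ⟯ J.toSubmodule, f x ≠ 0 := by
  have hnot : ¬ B.vanishingAt m ≤ B.anchorVanishingAt x := fun h =>
    hx (eq_of_vanishingAt_le_anchorVanishingAt h).symm
  obtain ⟨b, hbm, hbx⟩ := SetLike.not_le_iff_exists.1 hnot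
  rw [mem_anchorVanishingAt_iff_forall_lie] at hbx
  push Not at hbx
  obtain ⟨f, hf⟩ := hbx
  have hstable : ∀ g ∈ conductorIdeal C^∞⟮𝓘(ℝ, EM), M; ℝ⟯ J.toSubmodule,
      ⁅b, g⁆ ∈ conductorIdeal C^∞⟮𝓘(ℝ, EM), M; ℝ⟯ J.toSubmodule := fun g hg k => by
    have hlie := hn b (vanishingAt_le_anchorVanishingAt m hbm) _ (hg k)
    rw [lie_smul_kernel] at hlie
    simpa using J.toSubmodule.sub_mem hlie (hg ⁅b, k⁆)
  obtain ⟨n, hpow⟩ := exists_pow_derivation_mem_of_cofg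
    (cofg_conductorIdeal_of_isNormalizedBy hJ hn)
    (LieRinehartAlgebra.anchor ℝ C^∞⟮𝓘(ℝ, EM), M; ℝ⟯ B.atiyahAlgebra b) hstable f
  exact ⟨_, hpow, pow_ne_zero n hf⟩

end Conductor

variable [LieGroup 𝓘(ℝ, EG) ∞ G]

namespace LocalTrivialization

variable {t : B.LocalTrivialization}

section KernelEval

variable [CompleteSpace EG]

/-- The value at `m` of the sections of the kernel, read in the Lie algebra of `G` through a local
trivialization: sections of the kernel are sections of a bundle of Lie algebras. -/
noncomputable def kernelEval (hm : m ∈ t.base) : B.kernel →ₗ⁅ℝ⁆ GroupLieAlgebra 𝓘(ℝ, EG) G where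
  toFun k := t.verticalCoeff k m
  map_add' _ _ := map_add (mfderiv 𝓘(ℝ, EP) 𝓘(ℝ, EG) t.invCoord (t.fibreMap m 1)) _ _
  map_smul' _ _ := map_smul (mfderiv 𝓘(ℝ, EP) 𝓘(ℝ, EG) t.invCoord (t.fibreMap m 1)) _ _
  map_lie' {k l} := verticalCoeff_lie hm (coe_kernel_mem_anchorVanishingAt k m)
    (coe_kernel_mem_anchorVanishingAt l m)

variable (hm : m ∈ t.base)
include hm

theorem kernelEval_eq_zero_iff {k : B.kernel} :
    kernelEval hm k = 0 ↔ k ∈ B.kernelVanishingAt m :=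
  (mem_vanishingAt_iff_verticalCoeff_eq_zero hm (coe_kernel_mem_anchorVanishingAt k m)).symm

theorem kernelEval_smul (f : C^∞⟮𝓘(ℝ, EM), M; ℝ⟯) (k : B.kernel) :
    kernelEval hm (f • k) = f m • kernelEval hm k := by
  have h : (f • k.1).1 (t.fibreMap m 1) = f m • k.1.1 (t.fibreMap m 1) := by
    rw [smul_apply, proj_fibreMap hm]
  refine (congrArg (mfderiv 𝓘(ℝ, EP) 𝓘(ℝ, EG) t.invCoord (t.fibreMap m 1)) h).trans ?_
  exact map_smul (mfderiv 𝓘(ℝ, EP) 𝓘(ℝ, EG) t.invCoord (t.fibreMap m 1)) _ _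

theorem kernelEval_lie {a : B.atiyahAlgebra} (ha : a ∈ B.anchorVanishingAt m) (k : B.kernel) :
    kernelEval hm ⁅a, k⁆ = Bracket.bracket (L := GroupLieAlgebra 𝓘(ℝ, EG) G)
      (t.verticalCoeff a m) (kernelEval hm k) :=
  verticalCoeff_lie hm ha (coe_kernel_mem_anchorVanishingAt k m)

theorem kernelEval_surjective [FiniteDimensional ℝ EM] [T2Space M] :
    Function.Surjective (kernelEval hm) := by
  intro ξ
  obtain ⟨χ, hχ, hχ_one⟩ := exists_contMDiffMap_tsupport_subset_eventuallyEq_one (E := EM)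
    (t.isOpen_base.mem_nhds hm)
  obtain ⟨k, hk⟩ := exists_kernel_eq_verticalIncl (t := t) (EG := EG) ξ hχ
  refine ⟨k, verticalCoeff_eq hm ?_⟩
  rw [hk m hm, hχ_one.eq_of_nhds]
  exact one_smul ℝ _

end KernelEval

variable {χ : C^∞⟮𝓘(ℝ, EM), M; ℝ⟯}

theorem exists_contMDiffMap_eq_mul_verticalCoeff (ℓ : EG →L[ℝ] ℝ) (a : B.atiyahAlgebra)
    (hχ : tsupport χ ⊆ t.base) :
    ∃ c : C^∞⟮𝓘(ℝ, EM), M; ℝ⟯, ∀ x, c x = χ x * ℓ (t.verticalCoeff a x) := by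
  refine ⟨⟨fun x => χ x * ℓ (t.verticalCoeff a x), contMDiff_of_tsupport fun x hx => ?_⟩,
    fun _ => rfl⟩
  have hx' : x ∈ t.base := hχ (closure_mono (Function.support_mul_subset_left _ _) hx)
  exact (χ.contMDiff x).mul
    (ContMDiffAt.comp x ℓ.contMDiff.contMDiffAt (contMDiffAt_verticalCoeff a hx'))

theorem exists_mul_self_smul_eq_sum_smul [FiniteDimensional ℝ EM] [T2Space M]
    [FiniteDimensional ℝ EG] (k : B.kernel)
    (hχ : tsupport χ ⊆ t.base) :
    ∃ (c : Fin (Module.finrank ℝ EG) → C^∞⟮𝓘(ℝ, EM), M; ℝ⟯)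
      (e : Fin (Module.finrank ℝ EG) → B.kernel), (∀ i x, c i x =
        χ x * (Module.finBasis ℝ EG).repr (t.verticalCoeff k x) i) ∧
      (χ * χ) • k = ∑ i, c i • e i := by
  have : CompleteSpace EG := FiniteDimensional.complete ℝ EG
  let b := Module.finBasis ℝ EG
  choose e he using fun i => exists_kernel_eq_verticalIncl (t := t) (b i) hχ
  choose c hc using fun i => exists_contMDiffMap_eq_mul_verticalCoeff
    (LinearMap.toContinuousLinearMap (b.coord i)) k.1 hχ
  refine ⟨c, e, hc, sub_eq_zero.1 (kernel_eq_zero_of_forall_mem_kernelVanishingAt fun x => ?_)⟩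
  by_cases hx : x ∈ t.base
  · have hei (i) : kernelEval hx (e i) = χ x • (b i : EG) :=
      verticalCoeff_eq hx ((he i x hx).trans (map_smul (t.verticalIncl x) _ _).symm)
    have hsum : (∑ i, c i x • χ x • b i : EG) = (χ x * χ x) • t.verticalCoeff k x := by
      conv_rhs => rw [← b.sum_repr (t.verticalCoeff k x), Finset.smul_sum]
      refine Finset.sum_congr rfl fun i _ => ?_
      rw [hc, smul_smul, smul_smul]
      exact congrArg (· • b i) (mul_right_comm _ _ _)
    rw [← kernelEval_eq_zero_iff hx, map_sub, map_sum, sub_eq_zero, kernelEval_smul]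
    simp only [kernelEval_smul, hei]
    exact hsum.symm
  · have hχx : χ x = 0 := image_eq_zero_of_notMem_tsupport fun h => hx (hχ h)
    refine sub_mem (smul_mem_kernelVanishingAt ?_ k) (sum_mem fun i _ =>
      smul_mem_kernelVanishingAt ?_ (e i))
    · rw [ContMDiffMap.coe_mul, Pi.mul_apply, hχx, zero_mul]
    · rw [hc, hχx, zero_mul]

end LocalTrivialization

open LocalTrivialization

section LieAction

variable [CompleteSpace EG]

theorem lie_mem_kernelVanishingAt {a : B.atiyahAlgebra} (ha : a ∈ B.vanishingAt m)
    (k : B.kernel) : ⁅a, k⁆ ∈ B.kernelVanishingAt m := by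
  obtain ⟨t, hm⟩ := B.exists_localTrivialization m
  have ha' := vanishingAt_le_anchorVanishingAt m ha
  rw [← kernelEval_eq_zero_iff hm, kernelEval_lie hm ha',
    (mem_vanishingAt_iff_verticalCoeff_eq_zero hm ha').1 ha]
  exact zero_lie (L := GroupLieAlgebra 𝓘(ℝ, EG) G) (M := GroupLieAlgebra 𝓘(ℝ, EG) G) _

variable [FiniteDimensional ℝ EM] [T2Space M] [Nontrivial EG]

theorem mem_anchorVanishingAt_of_forall_lie_mem {a : B.atiyahAlgebra}
    (h : ∀ k : B.kernel, ⁅a, k⁆ ∈ B.kernelVanishingAt m) : a ∈ B.anchorVanishingAt m := by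
  obtain ⟨t, hm⟩ := B.exists_localTrivialization m
  obtain ⟨ξ, hξ⟩ := exists_ne (0 : EG)
  obtain ⟨k, hk⟩ := kernelEval_surjective hm ξ
  rw [mem_anchorVanishingAt_iff_forall_lie]
  intro f
  have hfk := (kernelEval_eq_zero_iff hm).2 (h (f • k))
  rw [lie_smul_kernel, map_add, kernelEval_smul, kernelEval_smul,
    (kernelEval_eq_zero_iff hm).2 (h k), smul_zero, zero_add, hk] at hfk
  exact (smul_eq_zero.1 hfk).resolve_right hξ

variable [LieAlgebra.HasTrivialRadical ℝ (GroupLieAlgebra 𝓘(ℝ, EG) G)]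

theorem mem_vanishingAt_of_forall_lie_mem {a : B.atiyahAlgebra}
    (h : ∀ k : B.kernel, ⁅a, k⁆ ∈ B.kernelVanishingAt m) : a ∈ B.vanishingAt m := by
  obtain ⟨t, hm⟩ := B.exists_localTrivialization m
  have ha := mem_anchorVanishingAt_of_forall_lie_mem h
  refine (mem_vanishingAt_iff_verticalCoeff_eq_zero hm ha).2
    (eq_zero_of_forall_lie_eq_zero (R := ℝ) (L := GroupLieAlgebra 𝓘(ℝ, EG) G) fun η => ?_)
  obtain ⟨k, rfl⟩ := kernelEval_surjective hm η
  rw [← kernelEval_lie hm ha, kernelEval_eq_zero_iff]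
  exact h k

theorem bracketIncluded_kernelVanishingAt_iff {S : LieSubalgebra ℝ B.atiyahAlgebra} :
    BracketIncluded S (B.kernelVanishingAt m) ↔ S ≤ B.vanishingAt m :=
  ⟨fun h a ha => mem_vanishingAt_of_forall_lie_mem (h a ha),
    fun h _ ha k => lie_mem_kernelVanishingAt (h ha) k⟩

end LieAction

section Semisimple

variable [FiniteDimensional ℝ EM] [T2Space M] [CompleteSpace EG] [FiniteDimensional ℝ EG]

omit [CompleteSpace EG] in
theorem mem_vanishingIdealAt_smul_top {k : B.kernel} (hk : k ∈ B.kernelVanishingAt m) :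
    k ∈ vanishingIdealAt EM m • (⊤ : Submodule C^∞⟮𝓘(ℝ, EM), M; ℝ⟯ B.kernel) := by
  obtain ⟨t, hm⟩ := B.exists_localTrivialization m
  obtain ⟨χ, hχ, hχ_one⟩ := exists_contMDiffMap_tsupport_subset_eventuallyEq_one (E := EM)
    (t.isOpen_base.mem_nhds hm)
  obtain ⟨c, e, hc, hsum⟩ := exists_mul_self_smul_eq_sum_smul k hχ
  have hsplit : k = (1 - χ * χ) • k + ∑ i, c i • e i := by
    rw [← hsum, sub_smul, one_smul, sub_add_cancel]
  rw [hsplit]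
  refine add_mem (Submodule.smul_mem_smul ?_ trivial)
    (sum_mem fun i _ => Submodule.smul_mem_smul ?_ trivial)
  · have hχm : χ m = 1 := hχ_one.eq_of_nhds
    simp [mem_vanishingIdealAt, hχm]
  · rw [mem_vanishingIdealAt, hc, (mem_vanishingAt_iff_verticalCoeff_eq_zero hm
      (coe_kernel_mem_anchorVanishingAt k m)).1 hk, map_zero, Finsupp.zero_apply, mul_zero]

variable [LieAlgebra.HasTrivialRadical ℝ (GroupLieAlgebra 𝓘(ℝ, EG) G)]

variable (B m) in
theorem lie_top_top_sup_vanishingIdealAt_smul_top :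
    (⁅(⊤ : LieIdeal C^∞⟮𝓘(ℝ, EM), M; ℝ⟯ B.kernel), (⊤ : LieIdeal C^∞⟮𝓘(ℝ, EM), M; ℝ⟯ B.kernel)⁆ :
      LieIdeal C^∞⟮𝓘(ℝ, EM), M; ℝ⟯ B.kernel).toSubmodule ⊔ vanishingIdealAt EM m • ⊤ = ⊤ := by
  obtain ⟨t, hm⟩ := B.exists_localTrivialization m
  set Q := (⁅(⊤ : LieIdeal C^∞⟮𝓘(ℝ, EM), M; ℝ⟯ B.kernel),
    (⊤ : LieIdeal C^∞⟮𝓘(ℝ, EM), M; ℝ⟯ B.kernel)⁆ :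
      LieIdeal C^∞⟮𝓘(ℝ, EM), M; ℝ⟯ B.kernel).toSubmodule
  have : FiniteDimensional ℝ (GroupLieAlgebra 𝓘(ℝ, EG) G) := ‹FiniteDimensional ℝ EG›
  have himage : (⊤ : Submodule ℝ (GroupLieAlgebra 𝓘(ℝ, EG) G)) ≤
      (Q.restrictScalars ℝ).map (kernelEval hm : B.kernel →ₗ[ℝ] GroupLieAlgebra 𝓘(ℝ, EG) G) := by
    rw [← LieSubmodule.top_toSubmodule (R := ℝ) (L := GroupLieAlgebra 𝓘(ℝ, EG) G),
      ← lie_top_top_eq_top ℝ (GroupLieAlgebra 𝓘(ℝ, EG) G),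
      LieSubmodule.lieIdeal_oper_eq_linear_span', Submodule.span_le]
    rintro _ ⟨ξ, -, η, -, rfl⟩
    obtain ⟨k, rfl⟩ := kernelEval_surjective hm ξ
    obtain ⟨l, rfl⟩ := kernelEval_surjective hm η
    exact ⟨⁅k, l⁆, LieSubmodule.lie_mem_lie (LieSubmodule.mem_top k) (LieSubmodule.mem_top l),
      LieHom.map_lie _ k l⟩
  refine eq_top_iff.2 fun k _ => ?_
  obtain ⟨q, hq, hqk⟩ := himage (x := kernelEval hm k) trivial
  have hkq : k - q ∈ B.kernelVanishingAt m := by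
    rw [← kernelEval_eq_zero_iff hm, map_sub, sub_eq_zero]
    exact hqk.symm
  simpa using Submodule.add_mem_sup (show q ∈ Q from hq) (mem_vanishingIdealAt_smul_top hkq)

section Normalized

variable (B m) in
theorem normalizedIntersection_anchorVanishingAt_le :
    normalizedIntersection B.kernel (B.anchorVanishingAt m) ≤ B.kernelVanishingAt m := by
  obtain ⟨t, hm⟩ := B.exists_localTrivialization m
  have : FiniteDimensional ℝ (GroupLieAlgebra 𝓘(ℝ, EG) G) := ‹FiniteDimensional ℝ EG›
  intro k hk
  by_contra hkm
  rw [← kernelEval_eq_zero_iff hm] at hkm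
  obtain ⟨J, hJ, hkJ⟩ := exists_isCoatom_lieIdeal_notMem (R := ℝ) hkm
  have hnorm : IsNormalizedBy (J.comap (kernelEval hm)) (B.anchorVanishingAt m) := by
    intro a ha x hx
    rw [LieIdeal.mem_comap] at hx ⊢
    rw [kernelEval_lie hm ha]
    exact lie_mem_right ℝ _ J _ _ hx
  have hmem := mem_normalizedIntersection_iff.1 hk _
    (isMaximalFiniteCodimIdeal_comap (kernelEval_surjective hm) hJ) hnorm
  exact hkJ (LieIdeal.mem_comap.1 hmem)

variable [SecondCountableTopology M] [Nontrivial EM] {J : LieIdeal ℝ B.kernel}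

theorem kernelVanishingAt_le_of_isNormalizedBy (hJ : IsMaximalFiniteCodimIdeal J)
    (hn : IsNormalizedBy J (B.anchorVanishingAt m)) : B.kernelVanishingAt m ≤ J.toSubmodule := by
  obtain ⟨r, hr⟩ := exists_pow_vanishingIdealAt_le
    (cofg_conductorIdeal_of_isNormalizedBy hJ.prop.2 hn) m
    fun _ => exists_mem_conductorIdeal_apply_ne_zero hJ.prop.2 hn
  have hle := hJ.le_conductorIdeal hr (lie_top_top_sup_vanishingIdealAt_smul_top B m)
  exact fun k hk => Submodule.smul_induction_on (p := (· ∈ J.toSubmodule))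
    (mem_vanishingIdealAt_smul_top hk) (fun f hf l _ => hle hf l) fun _ _ => J.toSubmodule.add_mem

theorem normalizedIntersection_anchorVanishingAt (m : M) :
    normalizedIntersection B.kernel (B.anchorVanishingAt m) = B.kernelVanishingAt m :=
  le_antisymm (normalizedIntersection_anchorVanishingAt_le B m) fun _ hk =>
    mem_normalizedIntersection_iff.2 fun _ hJ hn => kernelVanishingAt_le_of_isNormalizedBy hJ hn hk

variable [Nontrivial EG] {S : LieSubalgebra ℝ B.atiyahAlgebra}

theorem bracketIncluded_normalizedIntersection_anchorVanishingAt_iff :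
    BracketIncluded S (normalizedIntersection B.kernel (B.anchorVanishingAt m)) ↔
      S ≤ B.vanishingAt m := by
  rw [normalizedIntersection_anchorVanishingAt, bracketIncluded_kernelVanishingAt_iff]

theorem exists_bracketIncluded_normalizedIntersection_iff :
    (∃ T : LieSubalgebra ℝ B.atiyahAlgebra, IsMaximalFiniteCodimSubalgebra T ∧
      BracketIncluded S (normalizedIntersection B.kernel T)) ↔ ∃ m : M, S ≤ B.vanishingAt m := by
  simp only [isMaximalFiniteCodimSubalgebra_iff,
    ← bracketIncluded_normalizedIntersection_anchorVanishingAt_iff]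
  exact ⟨fun ⟨_, ⟨m, hm⟩, h⟩ => ⟨m, hm ▸ h⟩, fun ⟨m, h⟩ => ⟨_, ⟨m, rfl⟩, h⟩⟩

end Normalized

end Semisimple

end SmoothPrincipalBundle

theorem mainTheorem7_general {EM EG EP M G P : Type*}
    [NormedAddCommGroup EM] [NormedSpace ℝ EM] [FiniteDimensional ℝ EM] [Nontrivial EM]
    [NormedAddCommGroup EG] [NormedSpace ℝ EG] [FiniteDimensional ℝ EG] [CompleteSpace EG]
    [Nontrivial EG]
    [NormedAddCommGroup EP] [NormedSpace ℝ EP] [CompleteSpace EP]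
    [TopologicalSpace M] [ChartedSpace EM M] [IsManifold 𝓘(ℝ, EM) ∞ M]
    [T2Space M] [SecondCountableTopology M]
    [TopologicalSpace G] [ChartedSpace EG G] [Group G] [LieGroup 𝓘(ℝ, EG) ∞ G]
    [TopologicalSpace P] [ChartedSpace EP P] [IsManifold 𝓘(ℝ, EP) ∞ P]
    [LieAlgebra.HasTrivialRadical ℝ (GroupLieAlgebra 𝓘(ℝ, EG) G)]
    (B : SmoothPrincipalBundle EM EG EP M G P) :
    (∀ A₀ : LieSubalgebra ℝ B.atiyahAlgebra,
      (∃ m : M, A₀ = B.vanishingAt m) ↔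
        Maximal (fun S : LieSubalgebra ℝ B.atiyahAlgebra =>
          ∃ m : M, BracketIncluded S (B.kernelVanishingAt m)) A₀) ∧
    (∀ A₀ : LieSubalgebra ℝ B.atiyahAlgebra,
      (∃ m : M, A₀ = B.vanishingAt m) ↔
        Maximal (fun S : LieSubalgebra ℝ B.atiyahAlgebra =>
          ∃ T : LieSubalgebra ℝ B.atiyahAlgebra, IsMaximalFiniteCodimSubalgebra T ∧
            BracketIncluded S (normalizedIntersection B.kernel T)) A₀) ∧
    (∀ m : M,
      IsMaximalFiniteCodimSubalgebra (B.anchorVanishingAt m) ∧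
      Maximal (fun S : LieSubalgebra ℝ B.atiyahAlgebra =>
        BracketIncluded S (normalizedIntersection B.kernel (B.anchorVanishingAt m)))
        (B.vanishingAt m) ∧
      ∀ T : LieSubalgebra ℝ B.atiyahAlgebra, IsMaximalFiniteCodimSubalgebra T →
        BracketIncluded (B.vanishingAt m) (normalizedIntersection B.kernel T) →
          T = B.anchorVanishingAt m) := by
  refine ⟨fun A₀ => ?_, fun A₀ => ?_, fun m => ⟨?_, ?_, fun T hT hbracket => ?_⟩⟩
  · simp only [SmoothPrincipalBundle.bracketIncluded_kernelVanishingAt_iff]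
    exact SmoothPrincipalBundle.exists_eq_vanishingAt_iff_maximal
  · simp only [SmoothPrincipalBundle.exists_bracketIncluded_normalizedIntersection_iff]
    exact SmoothPrincipalBundle.exists_eq_vanishingAt_iff_maximal
  · exact SmoothPrincipalBundle.isMaximalFiniteCodimSubalgebra_iff.2 ⟨m, rfl⟩
  · simp only [SmoothPrincipalBundle.bracketIncluded_normalizedIntersection_anchorVanishingAt_iff]
    exact ⟨le_rfl, fun _ hS _ => hS⟩
  · obtain ⟨m', rfl⟩ := SmoothPrincipalBundle.isMaximalFiniteCodimSubalgebra_iff.1 hT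
    have hle : B.vanishingAt m ≤ B.vanishingAt m' :=
      SmoothPrincipalBundle.bracketIncluded_normalizedIntersection_anchorVanishingAt_iff.1 hbracket
    rw [SmoothPrincipalBundle.eq_of_vanishingAt_le_anchorVanishingAt
      (hle.trans (SmoothPrincipalBundle.vanishingAt_le_anchorVanishingAt m'))]

theorem mainTheorem7 {EM EG EP M G P : Type*}
    [NormedAddCommGroup EM] [NormedSpace ℝ EM] [FiniteDimensional ℝ EM] [Nontrivial EM]
    [NormedAddCommGroup EG] [NormedSpace ℝ EG] [FiniteDimensional ℝ EG] [CompleteSpace EG]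
    [Nontrivial EG]
    [NormedAddCommGroup EP] [NormedSpace ℝ EP] [FiniteDimensional ℝ EP] [CompleteSpace EP]
    [TopologicalSpace M] [ChartedSpace EM M] [IsManifold 𝓘(ℝ, EM) ∞ M]
    [T2Space M] [SecondCountableTopology M]
    [TopologicalSpace G] [ChartedSpace EG G] [Group G] [LieGroup 𝓘(ℝ, EG) ∞ G]
    [T2Space G] [SecondCountableTopology G]
    [TopologicalSpace P] [ChartedSpace EP P] [IsManifold 𝓘(ℝ, EP) ∞ P]
    [T2Space P] [SecondCountableTopology P]
    [LieAlgebra.HasTrivialRadical ℝ (GroupLieAlgebra 𝓘(ℝ, EG) G)]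
    (B : SmoothPrincipalBundle EM EG EP M G P) :
    (∀ A₀ : LieSubalgebra ℝ B.atiyahAlgebra,
      (∃ m : M, A₀ = B.vanishingAt m) ↔
        Maximal (fun S : LieSubalgebra ℝ B.atiyahAlgebra =>
          ∃ m : M, BracketIncluded S (B.kernelVanishingAt m)) A₀) ∧
    (∀ A₀ : LieSubalgebra ℝ B.atiyahAlgebra,
      (∃ m : M, A₀ = B.vanishingAt m) ↔
        Maximal (fun S : LieSubalgebra ℝ B.atiyahAlgebra =>
          ∃ T : LieSubalgebra ℝ B.atiyahAlgebra, IsMaximalFiniteCodimSubalgebra T ∧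
            BracketIncluded S (normalizedIntersection B.kernel T)) A₀) ∧
    (∀ m : M,
      IsMaximalFiniteCodimSubalgebra (B.anchorVanishingAt m) ∧
      Maximal (fun S : LieSubalgebra ℝ B.atiyahAlgebra =>
        BracketIncluded S (normalizedIntersection B.kernel (B.anchorVanishingAt m)))
        (B.vanishingAt m) ∧
      ∀ T : LieSubalgebra ℝ B.atiyahAlgebra, IsMaximalFiniteCodimSubalgebra T →
        BracketIncluded (B.vanishingAt m) (normalizedIntersection B.kernel T) →
          T = B.anchorVanishingAt m) :=
  mainTheorem7_general B
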